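/- **Setting.** Let $(X_t)_{t\ge 0}$ be a real-valued stochastic process on a probability space, fix $t\ge 0$, and put $X^{(t)}_\tau:=X_{t+\tau}-X_t$. For $\varepsilon>0$ let $Y_\varepsilon:=\varepsilon X^{(t)}_{1/\varepsilon}$ (that is, $\tau^{-1}X^{(t)}_\tau$ with $\varepsilon=1/\tau$), $$\Lambda_\varepsilon(u):=\varepsilon\log\mathbb E\big[e^{uY_\varepsilon/\varepsilon}\big],\qquad \mathcal D_\varepsilon:=\{u\in\mathbb R:|\Lambda_\varepsilon(u)|<\infty\},$$ and, for complex $z$, $\mathrm{Re}\,\Lambda_\varepsilon(z):=\varepsilon\log\big|\mathbb E[e^{zY_\varepsilon/\varepsilon}]\big|$ (equal to $-\infty$ where the expectation vanishes). Let $\mathcal D_0:=\bigcup_{\varepsilon>0}\bigcap_{0<s\le\varepsilon}\mathcal D_s$, with interior $\mathcal D_0^o$. **Assumptions.** The limit $\mathcal D_0=\lim_{\varepsilon\downarrow0}\mathcal D_\varepsilon$ exists, i.e. also $\mathcal D_0=\bigcap_{\varepsilon>0}\bigcup_{0<s\le\varepsilon}\mathcal D_s$; there are real functions $\Lambda_0,\Lambda_1,\Lambda_2$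 on $\mathcal D_0^o$, and $\Lambda_0$ has an analytic continuation, also denoted $\Lambda_0$, to $\{z\in\mathbb C:\mathrm{Re}\,z\in\mathcal D_0^o\}$, such that: 1. for each $u\in\mathcal D_0^o$, $\Lambda_\varepsilon(u)=\Lambda_0(u)+\Lambda_1(u)\varepsilon+\Lambda_2(u)\varepsilon^2+\mathcal O(\varepsilon^3)$ as $\varepsilon\downarrow0$; 2. there is $\varepsilon_0>0$ such that $(\varepsilon,u)\mapsto\Lambda_\varepsilon(u)$ is finite and $C^\infty$ on $(0,\varepsilon_0)\times\mathcal D_0^o$; 3. $0\in\mathcal D_0^o$, and moreover $1\in\mathcal D_0^o$; 4. $\Lambda_0$ is strictly convex on $\mathcal D_0^o$ and essentially smooth: it is differentiable on $\mathcal D_0^o$ and $|\Lambda_0'(u_n)|\to\infty$ for every sequence $(u_n)$ in $\mathcal D_0^o$ converging to a boundary point of $\mathcal D_0^o$; 5. for every fixed $p_r\in\mathcal D_0^o\setminus\{0\}$: (a) $\mathrm{Re}\,\Lambda_\varepsilon(p_r+ip_i)=\mathrm{Re}\,\Lambda_0(p_r+ip_i)+\mathcal O(\varepsilon)$ as $\varepsilon\downarrow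 0$, uniformly for $p_i$ in bounded subsets of $\mathbb R$ (in particular the left side is finite there for small $\varepsilon$); (b) $L(p_i):=\mathrm{Re}\,\Lambda_0(p_r+ip_i)$, $p_i\in\mathbb R$, has a unique maximum at $p_i=0$ and is bounded away from $L(0)$ as $|p_i|\to\infty$; (c) there are $\varepsilon_1,p^*>0$ and $M$ such that $\mathrm{Re}\,\Lambda_\varepsilon(p_r+ip_i)-\mathrm{Re}\,\Lambda_0(p_r+ip_i)\le M\varepsilon$ for all $|p_i|\ge p^*$ and $0<\varepsilon\le\varepsilon_1$. **Notation.** $\Lambda_{i,l}:=\partial_u^l\Lambda_i$. For $k\in\Lambda_{0,1}(\mathcal D_0^o)$ let $u^*(k)\in\mathcal D_0^o$ be the solution of $\Lambda_{0,1}(u^*(k))=k$, and let $\Lambda^*(k):=\sup_{u\in\mathcal D_0^o}\{uk-\Lambda_0(u)\}$. With all $\Lambda_i,\Lambda_{i,l}$ evaluated at $u^*=u^*(k)$, put $$\Upsilon(1,k):=\Lambda_2-\frac{5\Lambda_{0,3}^2}{24\Lambda_{0,2}^3}+\frac{4\Lambda_{1,1}\Lambda_{0,3}+\Lambda_{0,4}}{8\Lambda_{0,2}^2}-\frac{\Lambda_{1,1}^2+\Lambda_{1,2}}{2\Lambda_{0,2}}-\frac{\Lambda_{0,3}}{2u^*\Lambda_{0,2}^2}-\frac{\Lambda_{0,3}}{2(u^*-1)\Lambda_{0,2}^2}-\frac{\Lambda_{1,1}(1-2u^*)+3}{u^*(u^*-1)\Lambda_{0,2}}-\frac{1}{(u^*)^2(u^*-1)^2\Lambda_{0,2}}.$$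 **Corollary.** Let $k\in\Lambda_{0,1}(\mathcal D_0^o)$ with $k\notin\{\Lambda_{0,1}(0),\Lambda_{0,1}(1)\}$. Then $u^*(k)$ is unique, $\Lambda_0$ is $C^4$ and $\Lambda_1$ is $C^2$ near $u^*(k)$, $\Lambda_{0,2}(u^*(k))>0$, and, as $\tau\uparrow\infty$, $$\frac{e^{-\tau(\Lambda^*(k)-k)+\Lambda_1}\,\tau^{-1/2}}{u^*(k)(u^*(k)-1)\sqrt{2\pi\Lambda_{0,2}}}\left(1+\frac{\Upsilon(1,k)}{\tau}+\mathcal O\!\left(\frac1{\tau^2}\right)\right)=\begin{cases}\mathbb E\big(e^{X^{(t)}_\tau}-e^{k\tau}\big)^+,&k>\Lambda_{0,1}(1),\\[2pt]\mathbb E\big(e^{k\tau}-e^{X^{(t)}_\tau}\big)^+,&k<\Lambda_{0,1}(0),\\[2pt]-\mathbb E\big(e^{X^{(t)}_\tau}\wedge e^{k\tau}\big),&\Lambda_{0,1}(0)<k<\Lambda_{0,1}(1),\end{cases}$$ where for all large $\tau$ the payoff in question is integrable. -/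

import Mathlib

open MeasureTheory ProbabilityTheory Filter Set Asymptotics
open scoped Topology

noncomputable section

namespace ForwardStart

variable {Ω : Type*} [MeasurableSpace Ω]

/-- The renormalised logarithmic moment generating function
`Λ_ε(u) = ε log E[exp(u Y_ε / ε)]`, for real `u`. -/
def lmgf (P : Measure Ω) (Y : ℝ → Ω → ℝ) (ε u : ℝ) : ℝ :=
  ε * cgf (fun ω => Y ε ω / ε) P u

/-- The effective domain `𝓓_ε`, where `Λ_ε` is finite. Since `E[exp(u Y_ε / ε)] > 0`, this is the set
of `u` at which `exp(u Y_ε / ε)` is integrable. -/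
def effDomain (P : Measure Ω) (Y : ℝ → Ω → ℝ) (ε : ℝ) : Set ℝ :=
  integrableExpSet (fun ω => Y ε ω / ε) P

/-- `liminf_{ε ↓ 0} D_ε = ⋃_{ε > 0} ⋂_{0 < s ≤ ε} D_s`. -/
def liminfSet (D : ℝ → Set ℝ) : Set ℝ := ⋃ ε ∈ Ioi (0 : ℝ), ⋂ s ∈ Ioc 0 ε, D s

/-- `limsup_{ε ↓ 0} D_ε = ⋂_{ε > 0} ⋃_{0 < s ≤ ε} D_s`. -/
def limsupSet (D : ℝ → Set ℝ) : Set ℝ := ⋂ ε ∈ Ioi (0 : ℝ), ⋃ s ∈ Ioc 0 ε, D s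

/-- The limiting domain `𝓓₀ = lim_{ε ↓ 0} 𝓓_ε` (that the limit exists is part of the assumptions). -/
def limDomain (P : Measure Ω) (Y : ℝ → Ω → ℝ) : Set ℝ := liminfSet (effDomain P Y)

/-- `E[exp(z Y_ε / ε)]` for complex `z`. -/
def cmgf (P : Measure Ω) (Y : ℝ → Ω → ℝ) (ε : ℝ) (z : ℂ) : ℂ :=
  complexMGF (fun ω => Y ε ω / ε) P z

/-- `Re Λ_ε(z) = ε log |E[exp(z Y_ε / ε)]|` for complex `z` (meaningful where the expectation is
non-zero; where it is zero the mathematical value is `-∞`). -/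
def reLmgf (P : Measure Ω) (Y : ℝ → Ω → ℝ) (ε : ℝ) (z : ℂ) : ℝ :=
  ε * Real.log ‖cmgf P Y ε z‖

/-- A real function `h` is essentially smooth on the open set `U` (the interior of its domain): `U` is
non-empty, `h` is differentiable on `U`, and `|h'|` tends to infinity along every sequence
in `U` that converges to a boundary point of `U`. -/
structure EssentiallySmoothOn (h : ℝ → ℝ) (U : Set ℝ) : Prop where
  nonempty : U.Nonempty
  differentiableOn : DifferentiableOn ℝ h U
  steep : ∀ x ∈ frontier U, ∀ u : ℕ → ℝ, (∀ n, u n ∈ U) → Tendsto u atTop (𝓝 x) →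
    Tendsto (fun n => |deriv h (u n)|) atTop atTop

/-- The standing assumptions on the family `(Y_ε)_{ε > 0}`, with expansion coefficients
`Λ 0, Λ 1, Λ 2` on the interior of `𝓓₀`. The function `L₀` is the analytic continuation of `Λ 0` to
the strip `Re z ∈ 𝓓₀ᵒ`, which gives the meaning of `Λ₀(p_r + i p_i)`. -/
structure SharpLDAssumption (P : Measure Ω) (Y : ℝ → Ω → ℝ) (Λ : Fin 3 → ℝ → ℝ) (L₀ : ℂ → ℂ) :
    Prop where
  /-- the limit `𝓓₀` of the sets `𝓓_ε` exists -/
  domain_lim : liminfSet (effDomain P Y) = limsupSet (effDomain P Y)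
  /-- expansion property -/
  expansion : ∀ u ∈ interior (limDomain P Y),
    (fun ε : ℝ => lmgf P Y ε u - ∑ i : Fin 3, Λ i u * ε ^ (i : ℕ)) =O[𝓝[>] 0] fun ε : ℝ => ε ^ 3
  /-- differentiability: for some `ε₀`, the map `(ε, u) ↦ Λ_ε(u)` is finite and smooth on
  `(0, ε₀) × 𝓓₀ᵒ` -/
  smooth : ∃ ε₀ > 0, (∀ ε ∈ Ioo 0 ε₀, interior (limDomain P Y) ⊆ effDomain P Y ε) ∧
    ContDiffOn ℝ (⊤ : ℕ∞) (fun p : ℝ × ℝ => lmgf P Y p.1 p.2) (Ioo 0 ε₀ ×ˢ interior (limDomain P Y))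
  /-- non-degenerate interior -/
  zero_mem : (0 : ℝ) ∈ interior (limDomain P Y)
  /-- strict convexity of the limit -/
  strictConvex : StrictConvexOn ℝ (interior (limDomain P Y)) (Λ 0)
  /-- essential smoothness of the limit -/
  essSmooth : EssentiallySmoothOn (Λ 0) (interior (limDomain P Y))
  /-- `L₀` is analytic in the strip -/
  ext_analytic : DifferentiableOn ℂ L₀ {z : ℂ | z.re ∈ interior (limDomain P Y)}
  /-- `L₀` extends `Λ 0` -/
  ext_eq : ∀ u ∈ interior (limDomain P Y), L₀ (u : ℂ) = (Λ 0 u : ℂ)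
  /-- tail error control, first part: for fixed `p_r`, `Re Λ_ε = Re Λ₀ + O(ε)` on the line
  `p_r + i ℝ`, uniformly for `p_i` in bounded sets -/
  tail_compact : ∀ pr ∈ interior (limDomain P Y), pr ≠ 0 → ∀ R : ℝ, ∃ C : ℝ, ∃ ε₁ > 0,
    ∀ ε ∈ Ioc 0 ε₁, ∀ q : ℝ, |q| ≤ R →
      cmgf P Y ε ⟨pr, q⟩ ≠ 0 ∧ |reLmgf P Y ε ⟨pr, q⟩ - (L₀ ⟨pr, q⟩).re| ≤ C * ε
  /-- tail error control, second part: `p_i ↦ Re Λ₀(p_r + i p_i)` has its unique maximum at `0` and is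
  bounded away from it at infinity -/
  tail_max : ∀ pr ∈ interior (limDomain P Y), pr ≠ 0 →
    (∀ q : ℝ, q ≠ 0 → (L₀ ⟨pr, q⟩).re < (L₀ ⟨pr, 0⟩).re) ∧
    ∃ δ > 0, ∃ R : ℝ, ∀ q : ℝ, R ≤ |q| → (L₀ ⟨pr, q⟩).re ≤ (L₀ ⟨pr, 0⟩).re - δ
  /-- tail error control, third part: `Re (Λ_ε - Λ₀) ≤ M ε` for `|p_i| ≥ p*` and `ε ≤ ε₁` (the
  inequality holds trivially where `Re Λ_ε = -∞`) -/
  tail_far : ∀ pr ∈ interior (limDomain P Y), pr ≠ 0 → ∃ ε₁ > 0, ∃ pstar > 0, ∃ M : ℝ,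
    ∀ ε ∈ Ioc 0 ε₁, ∀ q : ℝ, pstar ≤ |q| → cmgf P Y ε ⟨pr, q⟩ ≠ 0 →
      reLmgf P Y ε ⟨pr, q⟩ - (L₀ ⟨pr, q⟩).re ≤ M * ε

/-- The derivatives `Λ_{i,l} = ∂_u^l Λ_i`. -/
def coeffDeriv (Λ : Fin 3 → ℝ → ℝ) (i : Fin 3) (l : ℕ) (u : ℝ) : ℝ := iteratedDeriv l (Λ i) u

/-- The Fenchel-Legendre transform `Λ*(k) = sup {u k - Λ₀(u)}` over the set `U` on which the limit
`Λ₀` is given (the interior of `𝓓₀`). -/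
def legendre (U : Set ℝ) (Λ : Fin 3 → ℝ → ℝ) (k : ℝ) : ℝ :=
  sSup ((fun u => u * k - Λ 0 u) '' U)

/-- The saddlepoint `u*(k)`: the point `u ∈ U` with `Λ_{0,1}(u) = k`, if there is one. -/
def saddle (U : Set ℝ) (Λ : Fin 3 → ℝ → ℝ) (k : ℝ) : ℝ :=
  Function.invFunOn (coeffDeriv Λ 0 1) U k

/-- The first-order coefficient `Υ(b, k)`, as a function of `b` and of `u = u*(k)`. -/
def upsilon (Λ : Fin 3 → ℝ → ℝ) (b u : ℝ) : ℝ :=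
  let d := fun (i : Fin 3) (l : ℕ) => coeffDeriv Λ i l u
  Λ 2 u - 5 * d 0 3 ^ 2 / (24 * d 0 2 ^ 3)
    + (4 * d 1 1 * d 0 3 + d 0 4) / (8 * d 0 2 ^ 2)
    - (d 1 1 ^ 2 + d 1 2) / (2 * d 0 2)
    - d 0 3 / (2 * u * d 0 2 ^ 2)
    - d 0 3 / (2 * (u - b) * d 0 2 ^ 2)
    - (d 1 1 * (b - 2 * u) + 3) / (u * (u - b) * d 0 2)
    - b ^ 2 / (u ^ 2 * (u - b) ^ 2 * d 0 2)

/-- The forward increment `X^{(t)}_τ = X_{t+τ} - X_t`. -/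
def fwd (X : ℝ → Ω → ℝ) (t τ : ℝ) (ω : Ω) : ℝ := X (t + τ) ω - X t ω

/-- The rescaled family `Y_ε = ε X^{(t)}_{1/ε}`, that is `τ⁻¹ X^{(t)}_τ` with `ε = τ⁻¹`. -/
def largeMat (X : ℝ → Ω → ℝ) (t ε : ℝ) (ω : Ω) : ℝ := ε * fwd X t ε⁻¹ ω

/-- The large-maturity prefactor
`exp(-τ (Λ*(k) - k) + Λ₁) τ^{-1/2} / (u* (u* - 1) √(2π Λ_{0,2}))`, coefficients taken at `u* = u*(k)`. -/
def prefactor (U : Set ℝ) (Λ : Fin 3 → ℝ → ℝ) (k τ : ℝ) : ℝ :=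
  let u := saddle U Λ k
  Real.exp (-τ * (legendre U Λ k - k) + Λ 1 u) * τ ^ (-(1 / 2) : ℝ) /
    (u * (u - 1) * √(2 * Real.pi * coeffDeriv Λ 0 2 u))

end ForwardStart

end

namespace ForwardStart

/-! ### Holomorphic families that are small at every real point -/

/-! The three payoffs are, up to the scale `exp(kτ)`, functions of `y = X - kτ` whose bilateral
Laplace transform is the same `1 / (z (z - 1))`, on `Re z > 1`, `Re z < 0` and `0 < Re z < 1`
respectively. Fourier inversion writes each expectation as an integral over `Re z = u` of the moment
generating function times `exp(-zkτ) / (z (z - 1))`. With `u = u*(k)` the phase `Λ₀(z) - kz` is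
stationary on that line, and `Λ₀'` being increasing, the position of `k` decides which strip
contains `u`. Laplace's method with one correction term then gives the result.

The difficulty is that the expansion of `Λ_ε` holds only pointwise at real `u`, that nothing is
assumed about the regularity of `Λ₁` and `Λ₂`, and that the tail control is not uniform in `p_r`.
All is read off the holomorphic ratio `f_ε(z) = E[exp(z Y_ε / ε)] exp(-Λ₀(z) / ε)` (`tilted`). It is
bounded uniformly in `ε` on each admissible vertical line, and Phragmén–Lindelöf between two such
lines bounds it on a strip (`exists_norm_tilted_le_strip`).

At real points `f_ε = exp(Λ₁) (1 + Λ₂ ε) + O(ε²)`, with a constant depending on the point. The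
combination `f_ε - 3 f_{ε/2} + 2 f_{ε/4}` removes both unknown coefficients. Its pointwise bound is
uniform on a real set of large measure, and a Remez-type inequality carries it to a complex disc at
the price of a factor `ε^{-1/2}`. The resulting `O(ε^{3/2})` is still summable after division by `ε`
along `ε / 2ⁿ`, so `f_ε = F + O(ε)` uniformly, with `F` holomorphic (`exists_holomorphic_limit`). As
`F = exp(Λ₁)` on the real axis, `Λ₁` is smooth.

Strict convexity alone would allow `Λ₀''(u*) = 0`. Positivity comes instead from `Re Λ₀(z) ≤ Λ₀(Re
z)`, which a saddle of higher order violates in some direction (`second_deriv_pos_of_vertical_max`).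

Near the saddle the amplitude depends on `ε = 1/τ`, so `exists_laplace_bound` is uniform over
bounded holomorphic amplitudes. The `1/τ` coefficient needs `f_ε` only up to `O(ε)`, that is `F`;
the leading term needs only the real value `f_ε(u*)`, known up to `O(ε²)`. Away from the saddle the
integrand is exponentially small. -/

theorem norm_iteratedDeriv_le_of_ball {f : ℂ → ℂ} {c : ℂ} {R K : ℝ} (hR : 0 < R)
    (hf : DifferentiableOn ℂ f (Metric.ball c R)) (hK : ∀ z ∈ Metric.ball c R, ‖f z‖ ≤ K) (n : ℕ) :
    ‖iteratedDeriv n f c‖ ≤ n.factorial * K / (R / 2) ^ n := by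
  have hsub : Metric.closedBall c (R / 2) ⊆ Metric.ball c R :=
    Metric.closedBall_subset_ball (by linarith)
  refine Complex.norm_iteratedDeriv_le_of_forall_mem_sphere_norm_le n (by positivity) ?_ ?_
  · exact (hf.mono hsub).diffContOnCl_ball Subset.rfl
  · exact fun z hz => hK z (hsub (Metric.sphere_subset_closedBall hz))

/-- Cauchy's estimates on radius `R / 2` bound the `i`-th Taylor term by `K qⁱ` with `q = 2 ‖z - c‖
/ R ≤ 1 / 2`, and the geometric tail costs a factor `2`. -/
theorem norm_sub_taylor_le {f : ℂ → ℂ} {c : ℂ} {R K : ℝ} (hR : 0 < R)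
    (hf : DifferentiableOn ℂ f (Metric.ball c R)) (hK : ∀ z ∈ Metric.ball c R, ‖f z‖ ≤ K) (n : ℕ)
    {z : ℂ} (hz : ‖z - c‖ ≤ R / 4) :
    ‖f z - ∑ i ∈ Finset.range n, (i.factorial : ℂ)⁻¹ * iteratedDeriv i f c * (z - c) ^ i‖ ≤
      2 * K * (2 * ‖z - c‖ / R) ^ n := by
  have hK0 : 0 ≤ K := (norm_nonneg _).trans (hK c (Metric.mem_ball_self hR))
  have hzb : z ∈ Metric.ball c R := by
    rw [mem_ball_iff_norm]; linarith
  set q : ℝ := 2 * ‖z - c‖ / R with hq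
  have hq0 : 0 ≤ q := by positivity
  have hq1 : q ≤ 1 / 2 := by
    rw [hq, div_le_iff₀ hR]; linarith
  set a : ℕ → ℂ := fun i => (i.factorial : ℂ)⁻¹ * iteratedDeriv i f c * (z - c) ^ i with ha
  have hsum : HasSum a (f z) := by
    have := Complex.hasSum_taylorSeries_on_ball hf hzb
    rwa [show (fun n : ℕ ↦ (n.factorial : ℂ)⁻¹ • (z - c) ^ n • iteratedDeriv n f c) = a from
      funext fun i => by simp only [ha, smul_eq_mul]; ring] at this
  have hbound : ∀ i, ‖a i‖ ≤ K * q ^ i := by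
    intro i
    have h1 := norm_iteratedDeriv_le_of_ball hR hf hK i
    have hfac : (0 : ℝ) < i.factorial := by exact_mod_cast i.factorial_pos
    simp only [ha, norm_mul, norm_inv, norm_pow, Complex.norm_natCast]
    calc (i.factorial : ℝ)⁻¹ * ‖iteratedDeriv i f c‖ * ‖z - c‖ ^ i
        ≤ (i.factorial : ℝ)⁻¹ * (i.factorial * K / (R / 2) ^ i) * ‖z - c‖ ^ i := by gcongr
      _ = K * q ^ i := by
        have : q ^ i = ‖z - c‖ ^ i / (R / 2) ^ i := by
          rw [← div_pow, hq]; congr 1; field_simp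
        rw [this]
        field_simp
  have hgeo : HasSum (fun i => K * q ^ n * q ^ i) (K * q ^ n * (1 - q)⁻¹) :=
    (hasSum_geometric_of_lt_one hq0 (by linarith)).mul_left _
  have htail : HasSum (fun i => a (i + n)) (f z - ∑ i ∈ Finset.range n, a i) :=
    (hasSum_nat_add_iff' n).2 hsum
  rw [← htail.tsum_eq]
  refine (tsum_of_norm_bounded hgeo fun i => ?_).trans ?_
  · refine (hbound (i + n)).trans (le_of_eq ?_)
    rw [pow_add]; ring
  · have : (1 - q)⁻¹ ≤ 2 := by
      rw [inv_le_comm₀ (by linarith) (by norm_num)]; linarith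
    calc K * q ^ n * (1 - q)⁻¹ ≤ K * q ^ n * 2 := by gcongr
      _ = _ := by ring

/-! ### A Remez-type inequality for sets of large measure -/

/-- Greedy choice: take the least point of `A` and discard the points within `d` of it, which costs
measure at most `d`. What remains still has measure above `(n - 1) d`. -/
theorem exists_separated {d : ℝ} (hd : 0 ≤ d) (n : ℕ) {A : Set ℝ} (hA : IsCompact A)
    (hvol : ENNReal.ofReal (n * d) < volume A) :
    ∃ x : ℕ → ℝ, (∀ i ≤ n, x i ∈ A) ∧ ∀ i < n, x i + d ≤ x (i + 1) := by
  induction n generalizing A with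
  | zero =>
    obtain ⟨y, hy⟩ := nonempty_of_measure_ne_zero (ne_of_gt (bot_le.trans_lt hvol))
    exact ⟨fun _ => y, fun _ _ => hy, by simp⟩
  | succ n ih =>
    have hne : A.Nonempty := nonempty_of_measure_ne_zero (ne_of_gt (bot_le.trans_lt hvol))
    set y := sInf A
    have hcov : A ⊆ (A ∩ Ici (y + d)) ∪ Icc y (y + d) := by
      intro u hu
      rcases le_total (y + d) u with h | h
      · exact Or.inl ⟨hu, h⟩
      · exact Or.inr ⟨csInf_le hA.bddBelow hu, h⟩
    have hle : volume A ≤ volume (A ∩ Ici (y + d)) + ENNReal.ofReal d := by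
      refine (measure_mono hcov).trans ((measure_union_le _ _).trans ?_)
      simp
    have hlt : ENNReal.ofReal (n * d) < volume (A ∩ Ici (y + d)) := by
      by_contra! hcon
      refine absurd hvol (not_lt.2 (hle.trans ((add_le_add_left hcon _).trans ?_)))
      rw [← ENNReal.ofReal_add (by positivity) hd]
      refine ENNReal.ofReal_le_ofReal ?_
      push_cast; linarith
    obtain ⟨x, hx, hxd⟩ := ih (hA.inter_right isClosed_Ici) hlt
    refine ⟨fun i => Nat.casesOn i y x, ?_, ?_⟩
    · rintro (_ | i) hi
      · exact hA.sInf_mem hne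
      · exact (hx i (by omega)).1
    · rintro (_ | i) hi
      · exact (hx 0 (by omega)).2
      · exact hxd i (by omega)

theorem add_mul_le_of_separated {x : ℕ → ℝ} {d : ℝ} {n : ℕ} (hx : ∀ i < n, x i + d ≤ x (i + 1))
    (i k : ℕ) (h : i + k ≤ n) : x i + k * d ≤ x (i + k) := by
  induction k with
  | zero => simp
  | succ k ih =>
    have h1 := ih (by omega)
    have h2 := hx (i + k) (by omega)
    rw [← add_assoc]
    push_cast; linarith

/-- The denominators of the Lagrange basis at the nodes `0, …, i + k`. -/
theorem prod_erase_abs_sub (i k : ℕ) :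
    ∏ j ∈ (Finset.range (i + k + 1)).erase i, |(i : ℝ) - j| = i.factorial * k.factorial := by
  set g : ℕ → ℝ := fun j => if j = i then 1 else |(i : ℝ) - j| with hg
  have h1 : ∏ j ∈ (Finset.range (i + k + 1)).erase i, |(i : ℝ) - j| =
      ∏ j ∈ (Finset.range (i + k + 1)).erase i, g j := by
    refine Finset.prod_congr rfl fun j hj => ?_
    simp [hg, Finset.ne_of_mem_erase hj]
  rw [h1, Finset.prod_erase _ (by simp [hg]), show i + k + 1 = (i + 1) + k by ring,
    Finset.prod_range_add, Finset.prod_range_succ]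
  have h2 : ∏ j ∈ Finset.range i, g j = i.factorial := by
    rw [← Finset.prod_range_reflect, ← Finset.prod_range_add_one_eq_factorial]
    push_cast
    refine Finset.prod_congr rfl fun j hj => ?_
    have hj' := Finset.mem_range.1 hj
    have : i - 1 - j ≠ i := by omega
    simp only [hg, this, if_false]
    rw [show ((i - 1 - j : ℕ) : ℝ) = (i : ℝ) - 1 - j by
      rw [Nat.sub_sub, Nat.cast_sub (by omega)]; push_cast; ring]
    rw [abs_of_nonneg] <;> ring_nf
    positivity
  have h3 : ∏ j ∈ Finset.range k, g (i + 1 + j) = k.factorial := by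
    rw [← Finset.prod_range_add_one_eq_factorial]
    push_cast
    refine Finset.prod_congr rfl fun j _ => ?_
    have : i + 1 + j ≠ i := by omega
    simp only [hg, this, if_false]
    push_cast
    rw [abs_sub_comm, abs_of_nonneg] <;> ring_nf
    positivity
  rw [h2, h3]
  simp [hg]

/-- Since `(N + 1)^N / N! ≤ e^{N+1}`, the rate is `4e ≤ 11` with leftover factor `e ≤ 3`. -/
theorem four_pow_mul_le (N : ℕ) : (4 : ℝ) ^ N * (((N : ℝ) + 1) ^ N / N.factorial) ≤ 3 * 11 ^ N := by
  have h1 : ((N : ℝ) + 1) ^ N / N.factorial ≤ Real.exp (N + 1) :=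
    Real.pow_div_factorial_le_exp _ (by positivity) N
  have he : Real.exp 1 ≤ 2.75 := by linarith [Real.exp_one_lt_d9]
  calc (4 : ℝ) ^ N * (((N : ℝ) + 1) ^ N / N.factorial) ≤ 4 ^ N * Real.exp (N + 1) := by gcongr
    _ = 4 ^ N * (Real.exp 1 ^ N * Real.exp 1) := by rw [Real.exp_add, ← Real.exp_nat_mul, mul_one]
    _ ≤ 4 ^ N * (2.75 ^ N * 2.75) := by gcongr
    _ = (4 * 2.75) ^ N * 2.75 := by rw [mul_pow]; ring
    _ ≤ 3 * 11 ^ N := by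
      norm_num
      nlinarith [pow_pos (show (0 : ℝ) < 11 by norm_num) N]

/-- Lagrange interpolation at the nodes. Separation gives `|x i - x j| ≥ |i - j| d` with `d = s / (N
+ 1)`, so the `i`-th basis polynomial is at most `(2 (N + 1))^N / (i! (N - i)!)`. Summing the
binomial coefficients over `i` gives another `2^N`. -/
theorem norm_eval_le_of_separated {N : ℕ} {P : Polynomial ℂ} (hP : P.degree < ((N + 1 : ℕ) : WithBot ℕ))
    {c s m : ℝ} (hs : 0 < s) {x : ℕ → ℝ} (hx : ∀ i ≤ N, |x i - c| ≤ s)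
    (hsep : ∀ i < N, x i + s / (N + 1) ≤ x (i + 1)) (hm : ∀ i ≤ N, ‖P.eval (x i : ℂ)‖ ≤ m)
    {z : ℂ} (hz : ‖z - c‖ ≤ s) : ‖P.eval z‖ ≤ 3 * 11 ^ N * m := by
  have hm0 : 0 ≤ m := (norm_nonneg _).trans (hm 0 (Nat.zero_le _))
  set d : ℝ := s / (N + 1) with hd
  have hd0 : 0 < d := by positivity
  have hdist : ∀ i ≤ N, ∀ j ≤ N, |(i : ℝ) - j| * d ≤ |x i - x j| := by
    have key : ∀ i j, i ≤ j → j ≤ N → |(i : ℝ) - j| * d ≤ |x i - x j| := by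
      intro i j hij hj
      obtain ⟨k, rfl⟩ := Nat.exists_eq_add_of_le hij
      have := add_mul_le_of_separated hsep i k hj
      rw [abs_sub_comm (x i)]
      refine le_trans (le_of_eq ?_) (le_trans (show (k : ℝ) * d ≤ x (i + k) - x i by linarith)
        (le_abs_self _))
      push_cast
      rw [abs_sub_comm, abs_of_nonneg] <;> ring_nf
      positivity
    intro i hi j hj
    rcases le_total i j with h | h
    · exact key i j h hj
    · rw [abs_sub_comm, abs_sub_comm (x i)]; exact key j i h hi
  have hinj : Set.InjOn (fun i : ℕ => (x i : ℂ)) (Finset.range (N + 1) : Set ℕ) := by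
    intro i hi j hj hij
    have hi' : i ≤ N := by simpa [Nat.lt_succ_iff] using hi
    have hj' : j ≤ N := by simpa [Nat.lt_succ_iff] using hj
    have h := hdist i hi' j hj'
    have hij' : x i = x j := Complex.ofReal_injective hij
    rw [hij', sub_self, abs_zero] at h
    have h0 : |(i : ℝ) - j| ≤ 0 := by
      by_contra! hc
      nlinarith [mul_pos hc hd0]
    have := sub_eq_zero.1 (abs_nonpos_iff.1 h0)
    exact_mod_cast this
  have hrep := Lagrange.eq_interpolate (s := Finset.range (N + 1)) (v := fun i : ℕ => (x i : ℂ))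
    (f := P) hinj (by simpa using hP)
  rw [hrep, Lagrange.interpolate_apply, Polynomial.eval_finsetSum]
  have hterm : ∀ i ∈ Finset.range (N + 1),
      ‖Polynomial.eval z (Polynomial.C (Polynomial.eval (x i : ℂ) P) *
        Lagrange.basis (Finset.range (N + 1)) (fun i : ℕ => (x i : ℂ)) i)‖ ≤
      m * (2 ^ N * (((N : ℝ) + 1) ^ N / N.factorial) * N.choose i) := by
    intro i hi
    have hi' : i ≤ N := by simpa [Nat.lt_succ_iff] using hi
    rw [Polynomial.eval_mul, Polynomial.eval_C, norm_mul]
    refine mul_le_mul (hm i hi') ?_ (norm_nonneg _) hm0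
    rw [Lagrange.basis, Polynomial.eval_prod, norm_prod]
    have hfac : ∀ j ∈ (Finset.range (N + 1)).erase i,
        ‖Polynomial.eval z (Lagrange.basisDivisor (x i : ℂ) (x j : ℂ))‖ ≤
          (2 * s / d) * |(i : ℝ) - j|⁻¹ := by
      intro j hj
      have hj' : j ≤ N := by
        simpa [Nat.lt_succ_iff] using Finset.mem_of_mem_erase hj
      have hne : (i : ℝ) - j ≠ 0 := by
        have := Finset.ne_of_mem_erase hj
        intro h
        exact this (by exact_mod_cast (sub_eq_zero.1 h).symm)
      have hpos : 0 < |(i : ℝ) - j| := abs_pos.2 hne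
      have h1 := hdist i hi' j hj'
      have h2 : ‖z - (x j : ℂ)‖ ≤ 2 * s := by
        calc ‖z - (x j : ℂ)‖ = ‖(z - c) - ((x j - c : ℝ) : ℂ)‖ := by push_cast; ring_nf
          _ ≤ ‖z - c‖ + ‖((x j - c : ℝ) : ℂ)‖ := norm_sub_le _ _
          _ ≤ s + s := by
            gcongr
            rw [Complex.norm_real]; exact hx j hj'
          _ = 2 * s := by ring
      simp only [Lagrange.basisDivisor, Polynomial.eval_mul, Polynomial.eval_C, Polynomial.eval_sub,
        Polynomial.eval_X, norm_mul, norm_inv]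
      rw [← Complex.ofReal_sub, Complex.norm_real, Real.norm_eq_abs]
      calc |x i - x j|⁻¹ * ‖z - (x j : ℂ)‖ ≤ (|(i : ℝ) - j| * d)⁻¹ * (2 * s) := by gcongr
        _ = _ := by field_simp
    refine (Finset.prod_le_prod (fun _ _ => norm_nonneg _) hfac).trans (le_of_eq ?_)
    rw [Finset.prod_mul_distrib, Finset.prod_const, Finset.card_erase_of_mem hi, Finset.card_range,
      Nat.add_sub_cancel, Finset.prod_inv_distrib]
    obtain ⟨k, rfl⟩ := Nat.exists_eq_add_of_le hi'
    rw [prod_erase_abs_sub, Nat.cast_choose ℝ (Nat.le_add_right i k), Nat.add_sub_cancel_left, hd]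
    have h1 : ((i + k).factorial : ℝ) ≠ 0 := by exact_mod_cast (i + k).factorial_ne_zero
    have h2 : (i.factorial : ℝ) ≠ 0 := by exact_mod_cast i.factorial_ne_zero
    have h3 : (k.factorial : ℝ) ≠ 0 := by exact_mod_cast k.factorial_ne_zero
    have h4 : 2 * s / (s / ((((i + k : ℕ) : ℝ)) + 1)) = 2 * (((i + k : ℕ) : ℝ) + 1) := by
      field_simp
    rw [h4, mul_pow]
    field_simp
  refine (norm_sum_le_of_le _ hterm).trans ?_
  rw [← Finset.mul_sum, ← Finset.mul_sum]
  have hch : ∑ i ∈ Finset.range (N + 1), (N.choose i : ℝ) = 2 ^ N := by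
    exact_mod_cast Nat.sum_range_choose N
  rw [hch]
  calc m * (2 ^ N * (((N : ℝ) + 1) ^ N / N.factorial) * 2 ^ N)
      = (4 ^ N * (((N : ℝ) + 1) ^ N / N.factorial)) * m := by
        rw [show (4 : ℝ) = 2 * 2 by norm_num, mul_pow]; ring
    _ ≤ 3 * 11 ^ N * m := mul_le_mul_of_nonneg_right (four_pow_mul_le N) hm0

/-- Smallness on at least half of a real interval propagates to the complex disc. The Taylor
polynomial of degree `N` is small at `N + 1` separated points of `A`, hence on the disc; `N` stays
free, to balance the growth `11^N` against the Taylor error. -/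
theorem norm_le_of_small_on {f : ℂ → ℂ} {c R K s m : ℝ} (hs : 0 < s) (hsR : s ≤ R / 4)
    (hf : DifferentiableOn ℂ f (Metric.ball (c : ℂ) R)) (hK : ∀ z ∈ Metric.ball (c : ℂ) R, ‖f z‖ ≤ K)
    {A : Set ℝ} (hA : IsCompact A) (hAs : A ⊆ Icc (c - s) (c + s)) (hvol : ENNReal.ofReal s ≤ volume A)
    (hm : ∀ u ∈ A, ‖f u‖ ≤ m) (N : ℕ) {z : ℂ} (hz : ‖z - c‖ ≤ s) :
    ‖f z‖ ≤ 3 * 11 ^ N * (m + 4 * K * (2 * s / R) ^ (N + 1)) := by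
  have hR : 0 < R := by linarith
  have hK0 : 0 ≤ K := (norm_nonneg _).trans (hK c (Metric.mem_ball_self hR))
  have hlt : ENNReal.ofReal (N * (s / (N + 1))) < volume A := by
    refine lt_of_lt_of_le ?_ hvol
    rw [ENNReal.ofReal_lt_ofReal_iff hs, ← mul_div_assoc, div_lt_iff₀ (by positivity)]
    nlinarith
  obtain ⟨x, hxA, hsep⟩ := exists_separated (by positivity) N hA hlt
  set P : Polynomial ℂ := ∑ i ∈ Finset.range (N + 1),
    Polynomial.C ((i.factorial : ℂ)⁻¹ * iteratedDeriv i f c) * (Polynomial.X - Polynomial.C (c : ℂ)) ^ i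
    with hPdef
  have heval : ∀ w : ℂ, P.eval w =
      ∑ i ∈ Finset.range (N + 1), (i.factorial : ℂ)⁻¹ * iteratedDeriv i f c * (w - c) ^ i := by
    intro w
    simp [hPdef, Polynomial.eval_finsetSum]
  have hdeg : P.degree < ((N + 1 : ℕ) : WithBot ℕ) := by
    refine (Polynomial.degree_sum_le _ _).trans_lt ?_
    rw [Finset.sup_lt_iff (WithBot.bot_lt_coe _)]
    intro i hi
    refine (Polynomial.degree_mul_le _ _).trans_lt ?_
    rw [Polynomial.degree_pow, Polynomial.degree_X_sub_C]
    refine (add_le_add_left Polynomial.degree_C_le _).trans_lt ?_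
    rw [zero_add, nsmul_one]
    exact_mod_cast Finset.mem_range.1 hi
  have hrem : ∀ w : ℂ, ‖w - c‖ ≤ s → ‖f w - P.eval w‖ ≤ 2 * K * (2 * s / R) ^ (N + 1) := by
    intro w hw
    rw [heval]
    refine (norm_sub_taylor_le hR hf hK (N + 1) (hw.trans hsR)).trans ?_
    gcongr
  have hxs : ∀ i ≤ N, |x i - c| ≤ s := by
    intro i hi
    have := hAs (hxA i hi)
    rw [abs_le]; constructor <;> linarith [this.1, this.2]
  have hPx : ∀ i ≤ N, ‖P.eval (x i : ℂ)‖ ≤ m + 2 * K * (2 * s / R) ^ (N + 1) := by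
    intro i hi
    have h1 := hrem (x i) (by
      rw [← Complex.ofReal_sub, Complex.norm_real]; exact hxs i hi)
    have h2 := hm (x i) (hxA i hi)
    calc ‖P.eval (x i : ℂ)‖ = ‖f (x i) - (f (x i) - P.eval (x i : ℂ))‖ := by congr 1; ring
      _ ≤ _ := (norm_sub_le _ _).trans (add_le_add h2 h1)
  have hPz := norm_eval_le_of_separated hdeg hs hxs hsep hPx hz
  have hfz : ‖f z‖ ≤ ‖P.eval z‖ + 2 * K * (2 * s / R) ^ (N + 1) := by
    calc ‖f z‖ = ‖P.eval z + (f z - P.eval z)‖ := by congr 1; ring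
      _ ≤ _ := (norm_add_le _ _).trans (add_le_add le_rfl (hrem z hz))
  -- The factor is at least `1`, so the final Taylor error at `z` merges with the one made at the
  -- nodes; hence `4 * K` in place of `2 * K`.
  have h11 : (1 : ℝ) ≤ 3 * 11 ^ N := by
    nlinarith [one_le_pow₀ (M₀ := ℝ) (a := 11) (n := N) (by norm_num)]
  have hq : 0 ≤ 2 * K * (2 * s / R) ^ (N + 1) := by positivity
  nlinarith

/-! ### From pointwise to uniform expansions -/

/-- The sets where the pointwise bound holds with constant `n` are closed and increase to the whole
interval, so one of them fills more than half of it. The Remez-type bound then loses only `√ε` when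
the degree is of order `log (1 / ε)`. -/
theorem exists_uniform_bound_of_pointwise {r : ℝ → ℂ → ℂ} {c R ε₁ K : ℝ} (hR : 0 < R) (hε₁ : 0 < ε₁)
    (hf : ∀ ε ∈ Ioc 0 ε₁, DifferentiableOn ℂ (r ε) (Metric.ball (c : ℂ) R))
    (hK : ∀ ε ∈ Ioc 0 ε₁, ∀ z ∈ Metric.ball (c : ℂ) R, ‖r ε z‖ ≤ K)
    (hp : ∀ u : ℝ, |u - c| < R → (fun ε : ℝ => r ε u) =O[𝓝[>] 0] fun ε : ℝ => ε ^ 2) :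
    ∃ s ∈ Ioo 0 R, ∃ C ≥ 0, ∃ δ ∈ Ioc 0 ε₁, ∀ ε ∈ Ioc 0 δ, ∀ z : ℂ, ‖z - c‖ ≤ s →
      ‖r ε z‖ ≤ C * (ε * √ε) := by
  have hK0 : 0 ≤ K := (norm_nonneg _).trans
    (hK ε₁ ⟨hε₁, le_rfl⟩ c (Metric.mem_ball_self hR))
  -- `29282 = 2 * 121²`, so that `2 * s / R = 121⁻²`.
  set s : ℝ := R / 29282 with hs
  have hs0 : 0 < s := by positivity
  have hsR : s < R := by rw [hs]; linarith
  set A : ℕ → Set ℝ := fun n =>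
    {u | u ∈ Icc (c - s) (c + s) ∧ ∀ ε ∈ Ioc 0 ε₁, ε * (n + 1) ≤ 1 → ‖r ε u‖ ≤ n * ε ^ 2} with hA
  have hsub : ∀ u ∈ Icc (c - s) (c + s), |u - c| ≤ s := by
    intro u hu
    rw [abs_le]; constructor <;> linarith [hu.1, hu.2]
  have hmaps : MapsTo (fun u : ℝ => (u : ℂ)) (Icc (c - s) (c + s)) (Metric.ball (c : ℂ) R) := by
    intro u hu
    rw [mem_ball_iff_norm, ← Complex.ofReal_sub, Complex.norm_real]
    exact (hsub u hu).trans_lt hsR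
  have hAc : ∀ n, IsCompact (A n) := by
    intro n
    have : A n = Icc (c - s) (c + s) ∩ ⋂ ε : {ε : ℝ // ε ∈ Ioc 0 ε₁ ∧ ε * (n + 1) ≤ 1},
        (Icc (c - s) (c + s) ∩ (fun u : ℝ => ‖r ε u‖) ⁻¹' Iic (n * (ε : ℝ) ^ 2)) := by
      ext u
      simp only [hA, mem_ofPred_eq, mem_inter_iff, mem_iInter, mem_preimage, mem_Iic, Subtype.forall]
      constructor
      · rintro ⟨h1, h2⟩
        exact ⟨h1, fun ε hε => ⟨h1, h2 ε hε.1 hε.2⟩⟩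
      · rintro ⟨h1, h2⟩
        exact ⟨h1, fun ε hε hε' => (h2 ε ⟨hε, hε'⟩).2⟩
    rw [this]
    refine isCompact_Icc.inter_right (isClosed_iInter fun ε => ?_)
    refine ContinuousOn.preimage_isClosed_of_isClosed ?_ isClosed_Icc isClosed_Iic
    exact ((hf ε ε.2.1).continuousOn.comp Complex.continuous_ofReal.continuousOn hmaps).norm
  have hmono : Monotone A := by
    intro n m hnm u hu
    refine ⟨hu.1, fun ε hε h => ?_⟩
    have hnm' : (n : ℝ) ≤ m := by exact_mod_cast hnm
    refine (hu.2 ε hε (le_trans ?_ h)).trans ?_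
    · have := hε.1
      gcongr
    · gcongr
  have hunion : ⋃ n, A n = Icc (c - s) (c + s) := by
    refine Subset.antisymm (iUnion_subset fun n u hu => hu.1) fun u hu => ?_
    obtain ⟨C, hC⟩ := (hp u ((hsub u hu).trans_lt hsR)).bound
    obtain ⟨η, hη, hηC⟩ := (mem_nhdsGT_iff_exists_Ioc_subset.1 hC)
    obtain ⟨n, hn⟩ := exists_nat_ge (max C (1 / η))
    refine mem_iUnion.2 ⟨n, hu, fun ε hε h => ?_⟩
    have hη' : (0 : ℝ) < η := hη
    have h1 : ε ≤ η := by
      have h2 : 1 / η ≤ n := (le_max_right _ _).trans hn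
      rw [div_le_iff₀ hη'] at h2
      by_contra! h3
      have := hε.1
      nlinarith
    have h4 := hηC ⟨hε.1, h1⟩
    simp only [mem_ofPred_eq, norm_pow, Real.norm_eq_abs, sq_abs] at h4
    refine h4.trans ?_
    have : C ≤ n := (le_max_left _ _).trans hn
    gcongr
  have hlim := tendsto_measure_iUnion_atTop (μ := volume) hmono
  rw [hunion, Real.volume_Icc] at hlim
  have hlt : ENNReal.ofReal s < ENNReal.ofReal (c + s - (c - s)) := by
    rw [ENNReal.ofReal_lt_ofReal_iff (by linarith)]; linarith
  obtain ⟨n, hn⟩ := (hlim.eventually (lt_mem_nhds hlt)).exists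
  refine ⟨s, ⟨hs0, hsR⟩, 3 * (n + 4 * K), by positivity, min ε₁ (1 / (n + 1)),
    ⟨lt_min hε₁ (by positivity), min_le_left _ _⟩, fun ε hε z hz => ?_⟩
  have hε0 : 0 < ε := hε.1
  have hε1 : ε ≤ ε₁ := hε.2.trans (min_le_left _ _)
  have hεn : ε * (n + 1) ≤ 1 := by
    rw [← le_div_iff₀ (by positivity)]
    exact hε.2.trans (min_le_right _ _)
  have hεone : ε ≤ 1 := by nlinarith [(Nat.cast_nonneg n : (0 : ℝ) ≤ n)]
  -- With `121^N ≤ 1 / ε < 121^(N + 1)` the Taylor error `(121⁻²)^(N + 1)` is at most `ε²`, while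
  -- `11^N = √(121^N)` is at most `ε^{-1/2}`.
  obtain ⟨N, hN1, hN2⟩ := exists_nat_pow_near (x := 1 / ε) (y := (121 : ℝ))
    (by rw [le_div_iff₀ hε0]; linarith) (by norm_num)
  have key := norm_le_of_small_on (m := n * ε ^ 2) hs0 (by rw [hs]; linarith) (hf ε ⟨hε0, hε1⟩)
    (hK ε ⟨hε0, hε1⟩) (hAc n) (fun u hu => hu.1) hn.le (fun u hu => hu.2 ε ⟨hε0, hε1⟩ hεn) N hz
  have hθ : (2 * s / R) ^ (N + 1) ≤ ε ^ 2 := by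
    have h1 : 2 * s / R = (1 / 121) ^ 2 := by rw [hs]; field_simp; norm_num
    rw [h1, ← pow_mul, mul_comm, pow_mul]
    refine pow_le_pow_left₀ (by positivity) ?_ 2
    rw [div_pow, one_pow, div_le_iff₀ (by positivity)]
    rw [div_lt_iff₀ hε0] at hN2
    linarith
  have h11 : (11 : ℝ) ^ N ≤ 1 / √ε := by
    rw [← Real.sqrt_one, ← Real.sqrt_div (by norm_num)]
    refine Real.le_sqrt_of_sq_le ?_
    rw [← pow_mul, mul_comm, pow_mul]
    norm_num at hN1 ⊢
    exact hN1
  have hsq : 0 < √ε := Real.sqrt_pos.2 hε0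
  calc ‖r ε z‖ ≤ 3 * 11 ^ N * (n * ε ^ 2 + 4 * K * (2 * s / R) ^ (N + 1)) := key
    _ ≤ 3 * (1 / √ε) * (n * ε ^ 2 + 4 * K * ε ^ 2) := by gcongr
    _ = 3 * (n + 4 * K) * (ε * (ε / √ε)) := by ring
    _ = _ := by rw [Real.div_sqrt]

theorem eqOn_ball_of_eq_on_real {F G : ℂ → ℂ} {c s : ℝ} (hs : 0 < s)
    (hF : DifferentiableOn ℂ F (Metric.ball (c : ℂ) s)) (hG : DifferentiableOn ℂ G (Metric.ball (c : ℂ) s))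
    (h : ∀ u : ℝ, |u - c| < s → F u = G u) : EqOn F G (Metric.ball (c : ℂ) s) := by
  refine (hF.analyticOnNhd Metric.isOpen_ball).eqOn_of_preconnected_of_frequently_eq
    (hG.analyticOnNhd Metric.isOpen_ball) (convex_ball _ _).isPreconnected (Metric.mem_ball_self hs) ?_
  have ht : Tendsto (fun u : ℝ => (u : ℂ)) (𝓝[≠] c) (𝓝[≠] (c : ℂ)) := by
    refine tendsto_nhdsWithin_iff.2 ⟨(Complex.continuous_ofReal.tendsto c).mono_left nhdsWithin_le_nhds, ?_⟩
    filter_upwards [self_mem_nhdsWithin] with u hu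
    simpa using hu
  refine ht.frequently (Eventually.frequently ?_)
  filter_upwards [nhdsWithin_le_nhds (Metric.ball_mem_nhds c hs)] with u hu
  exact h u (by simpa [Real.dist_eq] using hu)

/-- No regularity of `a` and `b` is assumed, so they are eliminated by differences in `ε` before any
passage to complex `z`. The limit `F` is then rebuilt from the dyadic sequence `f (ε / 2ⁿ)`. -/
theorem exists_holomorphic_limit {f : ℝ → ℂ → ℂ} {c R ε₁ K : ℝ} (hR : 0 < R) (hε₁ : 0 < ε₁)
    (hf : ∀ ε ∈ Ioc 0 ε₁, DifferentiableOn ℂ (f ε) (Metric.ball (c : ℂ) R))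
    (hK : ∀ ε ∈ Ioc 0 ε₁, ∀ z ∈ Metric.ball (c : ℂ) R, ‖f ε z‖ ≤ K) {a b : ℝ → ℂ}
    (hp : ∀ u : ℝ, |u - c| < R →
      (fun ε : ℝ => f ε u - (a u + ε * b u)) =O[𝓝[>] 0] fun ε : ℝ => ε ^ 2) :
    ∃ s ∈ Ioo 0 R, ∃ F : ℂ → ℂ, DifferentiableOn ℂ F (Metric.ball (c : ℂ) s) ∧
      (∀ u : ℝ, |u - c| < s → F u = a u) ∧
      ∃ C ≥ 0, ∃ δ ∈ Ioc 0 ε₁, ∀ ε ∈ Ioc 0 δ, ∀ z ∈ Metric.ball (c : ℂ) s, ‖f ε z - F z‖ ≤ C * ε := by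
  have hK0 : 0 ≤ K := (norm_nonneg _).trans
    (hK ε₁ ⟨hε₁, le_rfl⟩ c (Metric.mem_ball_self hR))
  have hdiv : ∀ m : ℝ, 0 < m → Tendsto (fun ε : ℝ => ε / m) (𝓝[>] 0) (𝓝[>] 0) := by
    intro m hm
    refine tendsto_nhdsWithin_iff.2 ⟨?_, ?_⟩
    · have : Tendsto (fun ε : ℝ => ε / m) (𝓝 0) (𝓝 (0 / m)) := tendsto_id.div_const m
      rw [zero_div] at this
      exact this.mono_left nhdsWithin_le_nhds
    · filter_upwards [self_mem_nhdsWithin] with ε hε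
      exact div_pos hε hm
  have hscale : ∀ m : ℝ, 1 ≤ m → ∀ ε ∈ Ioc 0 ε₁, ε / m ∈ Ioc 0 ε₁ := by
    intro m hm ε hε
    exact ⟨div_pos hε.1 (by linarith), (div_le_self hε.1.le hm).trans hε.2⟩
  -- The weights `1, -3, 2` at `ε, ε/2, ε/4` annihilate both `a` and `ε b`, leaving `O(ε²)` at each
  -- real point.
  obtain ⟨s, hs, C, hC, δ, hδ, hr⟩ := exists_uniform_bound_of_pointwise
    (r := fun ε z => f ε z - 3 * f (ε / 2) z + 2 * f (ε / 4) z) (K := K + 3 * K + 2 * K) hR hε₁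
    (fun ε hε => ((hf ε hε).sub ((hf _ (hscale 2 (by norm_num) ε hε)).const_mul _)).add
      ((hf _ (hscale 4 (by norm_num) ε hε)).const_mul _))
    (by
      intro ε hε z hz
      refine (norm_add_le _ _).trans (add_le_add ((norm_sub_le _ _).trans (add_le_add ?_ ?_)) ?_)
      · exact hK ε hε z hz
      · rw [norm_mul]; norm_num
        exact hK _ (hscale 2 (by norm_num) ε hε) z hz
      · rw [norm_mul]; norm_num
        exact hK _ (hscale 4 (by norm_num) ε hε) z hz)
    (by
      intro u hu
      have h0 := hp u hu
      have hm : ∀ m : ℝ, 0 < m → (fun ε : ℝ => f (ε / m) u - (a u + (ε / m : ℝ) * b u)) =O[𝓝[>] 0]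
          fun ε : ℝ => ε ^ 2 := by
        intro m hm
        refine (h0.comp_tendsto (hdiv m hm)).trans ?_
        refine IsBigO.of_bound (m⁻¹ ^ 2) (Eventually.of_forall fun ε => ?_)
        simp only [Function.comp_apply, norm_pow, div_eq_mul_inv, norm_mul, norm_inv, mul_pow,
          Real.norm_eq_abs, sq_abs, inv_pow]
        rw [mul_comm]
      refine ((h0.sub ((hm 2 (by norm_num)).const_mul_left 3)).add
        ((hm 4 (by norm_num)).const_mul_left 2)).congr_left fun ε => ?_
      push_cast
      ring)
  have hδ0 : 0 < δ := hδ.1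
  -- first differences are of first order
  set E : ℝ := 4 * C with hE
  set D : ℝ := 4 * K / δ + E * √δ with hD
  have hD0 : 0 ≤ D := by positivity
  have hsball : ∀ z : ℂ, ‖z - c‖ ≤ s → z ∈ Metric.ball (c : ℂ) R := fun z hz => by
    rw [mem_ball_iff_norm]; exact hz.trans_lt hs.2
  -- With `g ε = f ε - f (ε / 2)`, the bound `hr` controls `g (2ε) - 2 g ε`, and the induction goes
  -- down one dyadic scale at a time. The term `-E √ε` makes the bound self-improving: the error is
  -- absorbed because `E √ε + C √(2ε) ≤ E √(2ε)` for `E = 4 C`, using `√2 ≥ 4/3`.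
  have hstep : ∀ n : ℕ, ∀ ε ≤ δ, δ / 2 ^ (n + 1) < ε → ∀ z : ℂ, ‖z - c‖ ≤ s →
      ‖f ε z - f (ε / 2) z‖ ≤ ε * (D - E * √ε) := by
    intro n
    induction n with
    | zero =>
      intro ε hε1 hε2 z hz
      norm_num at hε2
      have hε0 : 0 < ε := by linarith
      have hmem : ε ∈ Ioc 0 ε₁ := ⟨hε0, hε1.trans hδ.2⟩
      have h1 : ‖f ε z - f (ε / 2) z‖ ≤ K + K := (norm_sub_le _ _).trans
        (add_le_add (hK _ hmem z (hsball z hz)) (hK _ (hscale 2 (by norm_num) ε hmem) z (hsball z hz)))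
      have h2 : √ε ≤ √δ := Real.sqrt_le_sqrt hε1
      have h3 : 4 * K / δ ≤ D - E * √ε := by
        rw [hD]
        have : E * √ε ≤ E * √δ := by gcongr
        linarith
      have h4 : 2 * K ≤ ε * (4 * K / δ) := by
        rw [mul_div_assoc', le_div_iff₀ hδ0]
        nlinarith
      calc _ ≤ 2 * K := by linarith
        _ ≤ ε * (4 * K / δ) := h4
        _ ≤ _ := by gcongr
    | succ n ih =>
      intro ε hε1 hε2 z hz
      rcases lt_or_ge (δ / 2 ^ (n + 1)) ε with h | h
      · exact ih ε hε1 h z hz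
      · have hε0 : 0 < ε := lt_trans (by positivity) hε2
        have h2ε : 2 * ε ≤ δ := by
          have : δ / 2 ^ (n + 1) ≤ δ / 2 := by
            rw [pow_succ]
            refine div_le_div_of_nonneg_left hδ0.le (by norm_num) ?_
            nlinarith [one_le_pow₀ (M₀ := ℝ) (a := 2) (n := n) (by norm_num)]
          linarith
        have h1 := ih (2 * ε) h2ε (by
          rw [pow_succ, ← div_div, div_lt_iff₀ (by norm_num)] at hε2
          linarith) z hz
        have h2 := hr (2 * ε) ⟨by positivity, h2ε⟩ z hz
        rw [show 2 * ε / 2 = ε by ring] at h1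
        simp only [show 2 * ε / 2 = ε by ring, show 2 * ε / 4 = ε / 2 by ring] at h2
        have h3 : ‖(2 : ℂ) * (f ε z - f (ε / 2) z)‖ ≤
            2 * ε * (D - E * √(2 * ε)) + C * (2 * ε * √(2 * ε)) := by
          refine le_trans (le_of_eq ?_) ((norm_sub_le _ _).trans (add_le_add h1 h2))
          congr 1; ring
        rw [norm_mul, Complex.norm_ofNat] at h3
        have h4 : √(2 * ε) = √2 * √ε := Real.sqrt_mul (by norm_num) _
        have h5 : 4 / 3 ≤ √2 := Real.le_sqrt_of_sq_le (by norm_num)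
        have h6 : E * √ε + C * √(2 * ε) ≤ E * √(2 * ε) := by
          rw [h4, hE]
          have : 0 ≤ C * √ε := by positivity
          nlinarith
        nlinarith
  have hdiff : ∀ ε ∈ Ioc 0 δ, ∀ z : ℂ, ‖z - c‖ ≤ s → ‖f ε z - f (ε / 2) z‖ ≤ D * ε := by
    intro ε hε z hz
    obtain ⟨n, hn⟩ := exists_pow_lt_of_lt_one (div_pos hε.1 hδ0) (show (1 / 2 : ℝ) < 1 by norm_num)
    refine (hstep n ε hε.2 ?_ z hz).trans ?_
    · rw [lt_div_iff₀ hδ0] at hn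
      refine lt_of_le_of_lt ?_ hn
      rw [div_pow, one_pow, pow_succ, div_mul_eq_mul_div, one_mul]
      refine div_le_div_of_nonneg_left hδ0.le (by positivity) ?_
      nlinarith [pow_pos (show (0 : ℝ) < 2 by norm_num) n]
    · have : 0 ≤ E * √ε := by positivity
      nlinarith [hε.1]
  have hgeo : ∀ ε ∈ Ioc 0 δ, ∀ z : ℂ, ‖z - c‖ ≤ s → ∀ n : ℕ,
      dist (f (ε / 2 ^ n) z) (f (ε / 2 ^ (n + 1)) z) ≤ 2 * D * ε / 2 / 2 ^ n := by
    intro ε hε z hz n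
    have h := hdiff (ε / 2 ^ n) ⟨by have := hε.1; positivity,
      (div_le_self hε.1.le (one_le_pow₀ (by norm_num))).trans hε.2⟩ z hz
    rw [dist_eq_norm, pow_succ, ← div_div]
    refine h.trans (le_of_eq ?_)
    ring
  set G : ℝ → ℂ → ℂ := fun ε z => limUnder atTop fun n : ℕ => f (ε / 2 ^ n) z with hG
  have hGlim : ∀ ε ∈ Ioc 0 δ, ∀ z : ℂ, ‖z - c‖ ≤ s →
      Tendsto (fun n : ℕ => f (ε / 2 ^ n) z) atTop (𝓝 (G ε z)) := fun ε hε z hz =>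
    (cauchySeq_of_le_geometric_two (hgeo ε hε z hz)).tendsto_limUnder
  have hGdist : ∀ ε ∈ Ioc 0 δ, ∀ z : ℂ, ‖z - c‖ ≤ s → ∀ n : ℕ,
      dist (f (ε / 2 ^ n) z) (G ε z) ≤ 2 * D * ε / 2 ^ n := fun ε hε z hz n =>
    dist_le_of_le_geometric_two_of_tendsto (hgeo ε hε z hz) (hGlim ε hε z hz) n
  have hGdiff : ∀ ε ∈ Ioc 0 δ, DifferentiableOn ℂ (G ε) (Metric.ball (c : ℂ) s) := by
    intro ε hε
    have hu : TendstoUniformlyOn (fun (n : ℕ) z => f (ε / 2 ^ n) z) (G ε) atTop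
        (Metric.ball (c : ℂ) s) := by
      rw [Metric.tendstoUniformlyOn_iff]
      intro η hη
      have ht : Tendsto (fun n : ℕ => 2 * D * ε / 2 ^ n) atTop (𝓝 0) :=
        tendsto_const_nhds.div_atTop (tendsto_pow_atTop_atTop_of_one_lt (by norm_num))
      filter_upwards [ht.eventually (gt_mem_nhds hη)] with n hn z hz
      rw [dist_comm]
      exact (hGdist ε hε z (mem_ball_iff_norm.1 hz).le n).trans_lt hn
    refine hu.tendstoLocallyUniformlyOn.differentiableOn (Eventually.of_forall fun n => ?_)
      Metric.isOpen_ball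
    exact (hf _ (hscale (2 ^ n) (one_le_pow₀ (by norm_num)) ε ⟨hε.1, hε.2.trans hδ.2⟩)).mono
      (Metric.ball_subset_ball hs.2.le)
  have hGreal : ∀ ε ∈ Ioc 0 δ, ∀ u : ℝ, |u - c| < s → G ε u = a u := by
    intro ε hε u hu
    have hz : ‖(u : ℂ) - c‖ ≤ s := by
      rw [← Complex.ofReal_sub, Complex.norm_real]; exact hu.le
    refine tendsto_nhds_unique (hGlim ε hε u hz) ?_
    have hseq0 : Tendsto (fun n : ℕ => ε / 2 ^ n) atTop (𝓝 0) :=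
      tendsto_const_nhds.div_atTop (tendsto_pow_atTop_atTop_of_one_lt (by norm_num))
    have hseq : Tendsto (fun n : ℕ => ε / 2 ^ n) atTop (𝓝[>] 0) :=
      tendsto_nhdsWithin_iff.2 ⟨hseq0, Eventually.of_forall fun n => by
        have := hε.1
        exact mem_Ioi.2 (by positivity)⟩
    have h1 : Tendsto (fun ε : ℝ => f ε u - (a u + ε * b u)) (𝓝[>] 0) (𝓝 0) := by
      refine (hp u (hu.trans hs.2)).trans_tendsto ?_
      have : Tendsto (fun ε : ℝ => ε ^ 2) (𝓝 0) (𝓝 (0 ^ 2)) := tendsto_id.pow 2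
      norm_num at this
      exact this.mono_left nhdsWithin_le_nhds
    have h2 : Tendsto (fun ε : ℝ => a u + (ε : ℂ) * b u) (𝓝[>] 0) (𝓝 (a u)) := by
      have : Tendsto (fun ε : ℝ => a u + (ε : ℂ) * b u) (𝓝 0) (𝓝 (a u + ((0 : ℝ) : ℂ) * b u)) :=
        ((Complex.continuous_ofReal.tendsto 0).mul_const _).const_add _
      simp only [Complex.ofReal_zero, zero_mul, add_zero] at this
      exact this.mono_left nhdsWithin_le_nhds
    have h3 := (h1.add h2).comp hseq
    simpa [Function.comp_def] using h3
  refine ⟨s, hs, G δ, hGdiff δ ⟨hδ0, le_rfl⟩, hGreal δ ⟨hδ0, le_rfl⟩, 2 * D, by positivity, δ, hδ,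
    fun ε hε z hz => ?_⟩
  -- The limit along `ε / 2ⁿ` could depend on the starting `ε`. It equals `a` on the real axis for
  -- every `ε`, so the identity theorem makes it one function.
  have heq := eqOn_ball_of_eq_on_real hs.1 (hGdiff ε hε) (hGdiff δ ⟨hδ0, le_rfl⟩)
    (fun u hu => (hGreal ε hε u hu).trans (hGreal δ ⟨hδ0, le_rfl⟩ u hu).symm) hz
  have := hGdist ε hε z (mem_ball_iff_norm.1 hz).le 0
  rw [← heq]
  simpa [dist_eq_norm] using this

/-! ### Holomorphic functions on vertical strips -/

/-- A holomorphic function on a strip with real part bounded above grows at most exponentially on a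
narrower strip. -/
theorem exists_norm_le_exp_of_re_le {L : ℂ → ℂ} {c R K : ℝ} (hR : 0 < R) (hK : 0 < K)
    (hL : DifferentiableOn ℂ L {z | |z.re - c| < R}) (hre : ∀ z : ℂ, |z.re - c| < R → (L z).re ≤ K) :
    ∃ A ≥ 0, ∀ z : ℂ, |z.re - c| ≤ R / 2 → ‖L z‖ ≤ A * Real.exp (4 / R * |z.im|) := by
  -- Borel–Carathéodory on the disc of radius `R` about `c + iq`, used at distance at most `R / 2`,
  -- has constants `2K` and `3`.
  have hstep : ∀ (q : ℝ) (z : ℂ), ‖z - ⟨c, q⟩‖ ≤ R / 2 → ‖L z‖ ≤ 2 * K + 3 * ‖L ⟨c, q⟩‖ := by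
    intro q z hz
    set w : ℂ := ⟨c, q⟩ with hw
    have hmaps : ∀ y ∈ Metric.ball (0 : ℂ) R, |(y + w).re - c| < R := by
      intro y hy
      rw [mem_ball_zero_iff] at hy
      have : (y + w).re - c = y.re := by simp [hw]
      rw [this]
      exact (Complex.abs_re_le_norm y).trans_lt hy
    have hd : DifferentiableOn ℂ (fun y => L (y + w)) (Metric.ball 0 R) :=
      hL.comp (differentiable_id.add_const w).differentiableOn hmaps
    have h := Complex.borelCaratheodory hK hd (fun y hy => hre _ (hmaps y hy)) hR
      (z := z - w) (by rw [mem_ball_zero_iff]; linarith)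
    simp only [sub_add_cancel, zero_add] at h
    have hpos : 0 < R - ‖z - w‖ := by linarith
    refine h.trans (add_le_add ?_ ?_)
    · rw [div_le_iff₀ hpos]
      nlinarith
    · rw [div_le_iff₀ hpos]
      nlinarith [norm_nonneg (L w)]
  -- Steps of length at most `R / 2` iterate `x ↦ 2K + 3x`, whose fixed point is `-K`; this gives
  -- the closed form `3ⁿ (· + K) - K`.
  have haxis : ∀ n : ℕ, ∀ q : ℝ, |q| ≤ n * (R / 2) → ‖L ⟨c, q⟩‖ ≤ 3 ^ n * (‖L ⟨c, 0⟩‖ + K) - K := by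
    intro n
    induction n with
    | zero =>
      intro q hq
      have : q = 0 := by simpa using hq
      simp [this]
    | succ n ih =>
      intro q hq
      have hn : (0 : ℝ) < (n : ℝ) + 1 := by positivity
      push_cast at hq
      have h1 : |q * (n / (n + 1))| ≤ n * (R / 2) := by
        rw [abs_mul, abs_of_nonneg (show (0 : ℝ) ≤ n / (n + 1) by positivity), mul_div_assoc',
          div_le_iff₀ hn]
        calc |q| * n ≤ ((n + 1) * (R / 2)) * n := by gcongr
          _ = _ := by ring
      have h2 : ‖(⟨c, q⟩ : ℂ) - ⟨c, q * (n / (n + 1))⟩‖ ≤ R / 2 := by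
        have : (⟨c, q⟩ : ℂ) - ⟨c, q * (n / (n + 1))⟩ = ((q / (n + 1) : ℝ) : ℂ) * Complex.I := by
          apply Complex.ext
          · simp [-Complex.ofReal_div]
          · simp [-Complex.ofReal_div]
            field_simp
            ring
        rw [this, norm_mul, Complex.norm_I, mul_one, Complex.norm_real, Real.norm_eq_abs, abs_div,
          abs_of_pos hn, div_le_iff₀ hn]
        linarith
      have h3 := hstep _ _ h2
      have h4 := ih _ h1
      rw [pow_succ]
      linarith
  refine ⟨9 * (‖L ⟨c, 0⟩‖ + K), by positivity, fun z hz => ?_⟩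
  set n := ⌈2 * |z.im| / R⌉₊ with hn
  have h1 : |z.im| ≤ n * (R / 2) := by
    have := Nat.le_ceil (2 * |z.im| / R)
    rw [div_le_iff₀ hR] at this
    linarith
  have h2 := hstep z.im z (by
    have : z - ⟨c, z.im⟩ = ((z.re - c : ℝ) : ℂ) := by
      apply Complex.ext <;> simp
    rw [this, Complex.norm_real]
    exact hz)
  have h3 := haxis n z.im h1
  have h4 : (3 : ℝ) ^ n ≤ 3 * Real.exp (4 / R * |z.im|) := by
    have h5 : (n : ℝ) < 2 * |z.im| / R + 1 := Nat.ceil_lt_add_one (by positivity)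
    have h6 : Real.log 3 ≤ 2 := by
      rw [Real.log_le_iff_le_exp (by norm_num)]
      have := Real.add_one_le_exp (2 : ℝ)
      linarith
    have h7 : 0 ≤ Real.log 3 := Real.log_nonneg (by norm_num)
    calc (3 : ℝ) ^ n = Real.exp (n * Real.log 3) := by
          rw [← Real.log_pow, Real.exp_log (by positivity)]
      _ ≤ Real.exp (Real.log 3 + 4 / R * |z.im|) := by
          refine Real.exp_le_exp.2 ?_
          have h8 : 0 ≤ 2 * |z.im| / R := by positivity
          have h9 : 4 / R * |z.im| = 2 * (2 * |z.im| / R) := by ring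
          rw [h9]
          nlinarith
      _ = 3 * Real.exp (4 / R * |z.im|) := by rw [Real.exp_add, Real.exp_log (by norm_num)]
  have h10 : 0 ≤ ‖L ⟨c, 0⟩‖ + K := by positivity
  nlinarith [mul_le_mul_of_nonneg_right h4 h10]

/-- Three lines theorem for `M exp(-τ L)`, with `M` bounded and `re L` bounded above. -/
theorem norm_mul_exp_le_of_lines {L M : ℂ → ℂ} {c R K B C τ : ℝ} (hR : 0 < R) (hK : 0 < K)
    (hτ : 0 ≤ τ) (hL : DifferentiableOn ℂ L {z | |z.re - c| < R})
    (hM : DifferentiableOn ℂ M {z | |z.re - c| < R})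
    (hre : ∀ z : ℂ, |z.re - c| < R → (L z).re ≤ K)
    (hB : ∀ z : ℂ, |z.re - c| ≤ R / 4 → ‖M z‖ ≤ B)
    (hC : ∀ z : ℂ, |z.re - c| = R / 4 → ‖M z * Complex.exp (-τ * L z)‖ ≤ C)
    {z : ℂ} (hz : |z.re - c| ≤ R / 4) : ‖M z * Complex.exp (-τ * L z)‖ ≤ C := by
  obtain ⟨A, hA, hgrow⟩ := exists_norm_le_exp_of_re_le hR hK hL hre
  have hsub : ∀ w : ℂ, w.re ∈ Icc (c - R / 4) (c + R / 4) → |w.re - c| ≤ R / 4 := by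
    intro w hw
    rw [abs_le]; constructor <;> linarith [hw.1, hw.2]
  have hd : DifferentiableOn ℂ (fun w => M w * Complex.exp (-τ * L w)) {z | |z.re - c| < R} :=
    hM.mul ((hL.const_mul _).cexp)
  have hz' := abs_le.1 hz
  refine PhragmenLindelof.vertical_strip (a := c - R / 4) (b := c + R / 4)
    (f := fun w => M w * Complex.exp (-τ * L w)) ?_
    ⟨4 / R, ?_, τ * A, ?_⟩ ?_ ?_ (by linarith) (by linarith)
  · refine DifferentiableOn.diffContOnCl (hd.mono fun w hw => ?_)
    rw [Complex.closure_preimage_re, closure_Ioo (by linarith)] at hw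
    have := hsub w hw
    rw [mem_ofPred_eq]
    linarith
  -- The strip has width `R / 2`, so the admissible growth rate is below `2π / R`; the rate `4 / R`
  -- qualifies.
  · rw [div_lt_div_iff₀ hR (by linarith)]
    nlinarith [Real.pi_gt_three]
  · refine IsBigO.of_bound B ?_
    refine eventually_inf_principal.2 (Eventually.of_forall fun w hw => ?_)
    have hw' := hsub w ⟨hw.1.le, hw.2.le⟩
    rw [norm_mul, Complex.norm_exp, Real.norm_eq_abs, abs_of_pos (Real.exp_pos _)]
    refine mul_le_mul (hB w hw') (Real.exp_le_exp.2 ?_) (Real.exp_pos _).le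
      ((norm_nonneg _).trans (hB w hw'))
    refine (Complex.re_le_norm _).trans ?_
    rw [norm_mul, norm_neg, Complex.norm_real, Real.norm_eq_abs, abs_of_nonneg hτ, mul_assoc]
    exact mul_le_mul_of_nonneg_left (hgrow w (by linarith)) hτ
  · intro w hw
    refine hC w ?_
    rw [hw, abs_sub_comm, abs_of_nonneg] <;> linarith
  · intro w hw
    refine hC w ?_
    rw [hw, abs_of_nonneg] <;> linarith

/-! ### Fourier representation of payoffs -/

theorem integral_Iic_const_mul_exp {a s : ℂ} (h : a = 0 ∨ 0 < s.re) :
    IntegrableOn (fun y : ℝ => a * Complex.exp (s * y)) (Iic 0) ∧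
      ∫ y in Iic (0 : ℝ), a * Complex.exp (s * y) = a / s := by
  rcases h with rfl | h
  · simp
  · refine ⟨(integrableOn_exp_mul_complex_Iic h 0).const_mul a, ?_⟩
    rw [integral_const_mul, integral_exp_mul_complex_Iic h]
    simp [div_eq_mul_inv]

theorem integral_Ioi_const_mul_exp {a s : ℂ} (h : a = 0 ∨ s.re < 0) :
    IntegrableOn (fun y : ℝ => a * Complex.exp (s * y)) (Ioi 0) ∧
      ∫ y in Ioi (0 : ℝ), a * Complex.exp (s * y) = -a / s := by
  rcases h with rfl | h
  · simp
  · refine ⟨(integrableOn_exp_mul_complex_Ioi h 0).const_mul a, ?_⟩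
    rw [integral_const_mul, integral_exp_mul_complex_Ioi h]
    simp [div_eq_mul_inv]

/-- A payoff that is affine in `exp y` on either side of the origin, with the jumps of its
coefficients normalised so that it is continuous and its bilateral Laplace transform is
`1 / (z (z - 1))`. -/
noncomputable def kinkPayoff (a b y : ℝ) : ℝ :=
  if y ≤ 0 then a * Real.exp y + b else (a + 1) * Real.exp y + (b - 1)

theorem continuous_kinkPayoff (a b : ℝ) : Continuous (kinkPayoff a b) := by
  unfold kinkPayoff
  refine Continuous.if_le (by fun_prop) (by fun_prop) continuous_id continuous_const ?_
  rintro y rfl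
  simp

/-- The abscissae at which the bilateral Laplace transform of `kinkPayoff a b` converges. -/
def KinkDomain (a b c : ℝ) : Prop :=
  (a = 0 ∨ c < 1) ∧ (b = 0 ∨ c < 0) ∧ (a + 1 = 0 ∨ 1 < c) ∧ (b - 1 = 0 ∨ 0 < c)

/-- The four half-line integrals add up to `1 / (z - 1) - 1 / z`: `a` and `b` cancel, and only the
unit jumps of the coefficients at the origin remain. Hence payoffs with different domains of
convergence share one transform. -/
theorem laplace_kinkPayoff {a b : ℝ} {z : ℂ} (h : KinkDomain a b z.re) (h0 : z ≠ 0) (h1 : z ≠ 1) :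
    Integrable (fun y : ℝ => Complex.exp (-z * y) * kinkPayoff a b y) ∧
      ∫ y : ℝ, Complex.exp (-z * y) * kinkPayoff a b y = 1 / (z * (z - 1)) := by
  obtain ⟨ha1, hb1, ha2, hb2⟩ := h
  have hre : (1 - z).re = 1 - z.re := by simp
  have hre' : (-z).re = -z.re := by simp
  obtain ⟨i1, e1⟩ := integral_Iic_const_mul_exp (a := (a : ℂ)) (s := 1 - z)
    (by rw [hre]; exact ha1.imp (by simp) (by intro h; linarith))
  obtain ⟨i2, e2⟩ := integral_Iic_const_mul_exp (a := (b : ℂ)) (s := -z)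
    (by rw [hre']; exact hb1.imp (by simp) (by intro h; linarith))
  obtain ⟨i3, e3⟩ := integral_Ioi_const_mul_exp (a := ((a + 1 : ℝ) : ℂ)) (s := 1 - z)
    (by rw [hre, Complex.ofReal_eq_zero]; exact ha2.imp id (by intro h; linarith))
  obtain ⟨i4, e4⟩ := integral_Ioi_const_mul_exp (a := ((b - 1 : ℝ) : ℂ)) (s := -z)
    (by rw [hre', Complex.ofReal_eq_zero]; exact hb2.imp id (by intro h; linarith))
  have hexp : ∀ y : ℝ, Complex.exp ((1 - z) * y) = Complex.exp (-z * y) * Complex.exp y := by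
    intro y
    rw [← Complex.exp_add]; ring_nf
  have hl : EqOn (fun y : ℝ => (a : ℂ) * Complex.exp ((1 - z) * y) + b * Complex.exp (-z * y))
      (fun y : ℝ => Complex.exp (-z * y) * kinkPayoff a b y) (Iic 0) := by
    intro y hy
    simp only [kinkPayoff, if_pos (mem_Iic.1 hy), hexp]
    push_cast
    ring
  have hr : EqOn (fun y : ℝ => ((a + 1 : ℝ) : ℂ) * Complex.exp ((1 - z) * y) +
      ((b - 1 : ℝ) : ℂ) * Complex.exp (-z * y))
      (fun y : ℝ => Complex.exp (-z * y) * kinkPayoff a b y) (Ioi 0) := by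
    intro y hy
    simp only [kinkPayoff, if_neg (not_le.2 (mem_Ioi.1 hy)), hexp]
    push_cast
    ring
  have hil := (i1.add i2).congr_fun hl measurableSet_Iic
  have hir := (i3.add i4).congr_fun hr measurableSet_Ioi
  refine ⟨?_, ?_⟩
  · rw [← integrableOn_univ, ← Iic_union_Ioi (a := (0 : ℝ))]
    exact hil.union hir
  · rw [← intervalIntegral.integral_Iic_add_Ioi hil hir, ← setIntegral_congr_fun measurableSet_Iic hl,
      ← setIntegral_congr_fun measurableSet_Ioi hr, integral_add i1 i2, integral_add i3 i4,
      e1, e2, e3, e4]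
    have h2 : 1 - z ≠ 0 := sub_ne_zero.2 h1.symm
    have h3 : z - 1 ≠ 0 := sub_ne_zero.2 h1
    rw [show 1 - z = -(z - 1) by ring]
    field_simp
    push_cast
    ring

theorem line_ne_zero {c : ℝ} (hc : c ≠ 0) (q : ℝ) : (c : ℂ) + q * Complex.I ≠ 0 := by
  intro h
  have := congrArg Complex.re h
  simp at this
  exact hc this

theorem line_ne_one {c : ℝ} (hc : c ≠ 1) (q : ℝ) : (c : ℂ) + q * Complex.I ≠ 1 := by
  intro h
  have := congrArg Complex.re h
  simp at this
  exact hc this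

theorem integrable_inv_sq_add_sq {c : ℝ} (hc : c ≠ 0) : Integrable fun q : ℝ => (c ^ 2 + q ^ 2)⁻¹ := by
  have hc2 : 0 < c ^ 2 := by positivity
  refine (integrable_inv_one_add_sq.const_mul (1 / c ^ 2 + 1)).mono' ?_ (Eventually.of_forall fun q => ?_)
  · exact Measurable.aestronglyMeasurable (by fun_prop)
  · rw [Real.norm_eq_abs, abs_of_nonneg (by positivity), ← div_eq_mul_inv,
      inv_le_comm₀ (by positivity) (by positivity), inv_div, div_le_iff₀ (by positivity)]
    have : (c ^ 2 + q ^ 2) * (1 / c ^ 2 + 1) = 1 + q ^ 2 + (c ^ 2 + q ^ 2 / c ^ 2) := by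
      field_simp; ring
    rw [this]
    have : 0 ≤ c ^ 2 + q ^ 2 / c ^ 2 := by positivity
    linarith

/-- By `1 / (xy) ≤ 1 / x² + 1 / y²`, each factor supplies an integrable bound of Cauchy type. -/
theorem integrable_kernel {c : ℝ} (h0 : c ≠ 0) (h1 : c ≠ 1) :
    Integrable fun q : ℝ => 1 / (((c : ℂ) + q * Complex.I) * ((c : ℂ) + q * Complex.I - 1)) := by
  refine ((integrable_inv_sq_add_sq h0).add (integrable_inv_sq_add_sq (sub_ne_zero.2 h1))).mono' ?_
    (Eventually.of_forall fun q => ?_)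
  · refine Continuous.aestronglyMeasurable (Continuous.div continuous_const (by fun_prop) fun q => ?_)
    exact mul_ne_zero (line_ne_zero h0 q) (sub_ne_zero.2 (line_ne_one h1 q))
  · have e1 : ‖(c : ℂ) + q * Complex.I‖ ^ 2 = c ^ 2 + q ^ 2 := by
      rw [← Complex.normSq_eq_norm_sq, Complex.normSq_add_mul_I]
    have e2 : ‖(c : ℂ) + q * Complex.I - 1‖ ^ 2 = (c - 1) ^ 2 + q ^ 2 := by
      rw [← Complex.normSq_eq_norm_sq, show (c : ℂ) + q * Complex.I - 1 = ((c - 1 : ℝ) : ℂ) + q * Complex.I by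
        push_cast; ring, Complex.normSq_add_mul_I]
    have p1 : 0 < ‖(c : ℂ) + q * Complex.I‖ := norm_pos_iff.2 (line_ne_zero h0 q)
    have p2 : 0 < ‖(c : ℂ) + q * Complex.I - 1‖ := norm_pos_iff.2 (sub_ne_zero.2 (line_ne_one h1 q))
    simp only [Pi.add_apply]
    rw [← e1, ← e2, norm_div, norm_one, norm_mul]
    generalize ‖(c : ℂ) + q * Complex.I‖ = x at p1
    generalize ‖(c : ℂ) + q * Complex.I - 1‖ = y at p2
    rw [one_div, mul_inv, ← inv_pow, ← inv_pow]
    nlinarith [sq_nonneg (x⁻¹ - y⁻¹), inv_pos.2 p1, inv_pos.2 p2, sq_nonneg (x⁻¹ + y⁻¹)]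

/-- Fourier inversion for the damped payoff `exp(-cy) kinkPayoff a b y`. It is continuous and
integrable, and its transform is integrable, so inversion holds at every `y`, the kink included. The
factor `2π` comes from the substitution `q = 2πv`. -/
theorem integral_kernel_mul_exp {a b c : ℝ} (h : KinkDomain a b c) (h0 : c ≠ 0) (h1 : c ≠ 1) (y : ℝ) :
    ∫ q : ℝ, Complex.exp (((c : ℂ) + q * Complex.I) * y) *
      (1 / (((c : ℂ) + q * Complex.I) * ((c : ℂ) + q * Complex.I - 1))) =
      2 * Real.pi * kinkPayoff a b y := by
  set k : ℝ → ℂ := fun q => 1 / (((c : ℂ) + q * Complex.I) * ((c : ℂ) + q * Complex.I - 1)) with hk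
  set g : ℝ → ℂ := fun y => Complex.exp (-(c : ℂ) * y) * kinkPayoff a b y with hg
  have hline : ∀ q : ℝ, ((c : ℂ) + q * Complex.I).re = c := by intro q; simp
  have hgi : Integrable g := (laplace_kinkPayoff (z := (c : ℂ)) (by simpa using h)
    (by simpa using h0) (by simpa using h1)).1
  have hgc : Continuous g :=
    (by fun_prop : Continuous fun y : ℝ => Complex.exp (-(c : ℂ) * y)).mul
      (Complex.continuous_ofReal.comp (continuous_kinkPayoff a b))
  have hF : FourierTransform.fourier g = fun v : ℝ => k (2 * Real.pi * v) := by
    funext v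
    rw [Real.fourier_real_eq_integral_exp_smul]
    have := (laplace_kinkPayoff (a := a) (b := b)
      (z := (c : ℂ) + ((2 * Real.pi * v : ℝ) : ℂ) * Complex.I) (by rw [hline]; exact h)
      (line_ne_zero h0 _) (line_ne_one h1 _)).2
    simp only [hk]
    rw [← this]
    refine integral_congr_ae (Eventually.of_forall fun y => ?_)
    simp only [hg, smul_eq_mul]
    rw [← mul_assoc, ← Complex.exp_add]
    push_cast
    ring_nf
  have hFi : Integrable (FourierTransform.fourier g) := by
    rw [hF]
    exact (integrable_kernel h0 h1).comp_mul_left' (by positivity)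
  have hinv := hgi.fourierInv_fourier_eq hFi (v := y) hgc.continuousAt
  rw [hF, Real.fourierInv_eq'] at hinv
  have hsub : ∫ v : ℝ, Complex.exp (((2 * Real.pi * inner ℝ v y : ℝ) : ℂ) * Complex.I) • k (2 * Real.pi * v) =
      ∫ v : ℝ, (fun q : ℝ => Complex.exp ((q * y : ℝ) * Complex.I) * k q) (2 * Real.pi * v) := by
    refine integral_congr_ae (Eventually.of_forall fun v => ?_)
    simp only [smul_eq_mul, RCLike.inner_apply, conj_trivial]
    congr 4
    ring
  rw [hsub, Measure.integral_comp_mul_left (fun q : ℝ => Complex.exp ((q * y : ℝ) * Complex.I) * k q)] at hinv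
  have h2 : ∫ q : ℝ, Complex.exp (((c : ℂ) + q * Complex.I) * y) * k q =
      Complex.exp ((c : ℂ) * y) * ∫ q : ℝ, Complex.exp ((q * y : ℝ) * Complex.I) * k q := by
    rw [← integral_const_mul]
    refine integral_congr_ae (Eventually.of_forall fun q => ?_)
    simp only
    rw [← mul_assoc, ← Complex.exp_add]
    push_cast
    ring_nf
  have h3 : ∫ q : ℝ, Complex.exp ((q * y : ℝ) * Complex.I) * k q = 2 * Real.pi * g y := by
    rw [← hinv, abs_of_pos (by positivity), Complex.real_smul]
    push_cast
    have : (2 * Real.pi : ℂ) ≠ 0 := mul_ne_zero two_ne_zero (by exact_mod_cast Real.pi_ne_zero)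
    rw [← mul_assoc, mul_inv_cancel₀ this, one_mul]
  rw [h2, h3, hg]
  have : Complex.exp ((c : ℂ) * y) * Complex.exp (-(c : ℂ) * y) = 1 := by
    rw [← Complex.exp_add]; simp
  linear_combination (2 * Real.pi * kinkPayoff a b y : ℂ) * this

/-- Average the inversion formula over `Z` and exchange the integrals; the modulus of the integrand
is `exp(cZ)` times an integrable kernel and a constant. -/
theorem integral_kinkPayoff_eq {Ω : Type*} [MeasurableSpace Ω] {P : Measure Ω} [IsProbabilityMeasure P]
    {Z : Ω → ℝ} (hZ : AEMeasurable Z P) {a b c : ℝ} (h : KinkDomain a b c) (h0 : c ≠ 0) (h1 : c ≠ 1)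
    (hint : Integrable (fun ω => Real.exp (c * Z ω)) P) (κ : ℝ) :
    ((2 * Real.pi * ∫ ω, kinkPayoff a b (Z ω - κ) ∂P : ℝ) : ℂ) =
      ∫ q : ℝ, complexMGF Z P ((c : ℂ) + q * Complex.I) *
        Complex.exp (-((c : ℂ) + q * Complex.I) * κ) *
        (1 / (((c : ℂ) + q * Complex.I) * ((c : ℂ) + q * Complex.I - 1))) := by
  set k : ℝ → ℂ := fun q => 1 / (((c : ℂ) + q * Complex.I) * ((c : ℂ) + q * Complex.I - 1)) with hk
  have hki : Integrable k := integrable_kernel h0 h1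
  have hprod : Integrable (fun p : Ω × ℝ =>
      Complex.exp (((c : ℂ) + p.2 * Complex.I) * ((Z p.1 - κ : ℝ) : ℂ)) * k p.2) (P.prod volume) := by
    have hbig : Integrable (fun p : Ω × ℝ => Real.exp (c * Z p.1) * (Real.exp (-(c * κ)) * ‖k p.2‖))
        (P.prod volume) := hint.mul_prod (hki.norm.const_mul _)
    refine hbig.mono' ?_ (Eventually.of_forall fun p => ?_)
    · have hZ1 : AEMeasurable (fun p : Ω × ℝ => Z p.1) (P.prod volume) := hZ.comp_fst
      have hk1 : AEStronglyMeasurable (fun p : Ω × ℝ => k p.2) (P.prod volume) :=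
        hki.aestronglyMeasurable.comp_snd
      refine AEStronglyMeasurable.mul (AEMeasurable.aestronglyMeasurable ?_) hk1
      refine Complex.measurable_exp.comp_aemeasurable (AEMeasurable.mul ?_ ?_)
      · exact Measurable.aemeasurable (by fun_prop)
      · exact Complex.measurable_ofReal.comp_aemeasurable (hZ1.sub_const κ)
    · rw [norm_mul, Complex.norm_exp, Complex.re_mul_ofReal, ← mul_assoc, ← Real.exp_add]
      refine le_of_eq ?_
      congr 2
      simp
      ring
  have hswap := integral_integral_swap (μ := P) (ν := (volume : Measure ℝ))
    (f := fun ω q => Complex.exp (((c : ℂ) + q * Complex.I) * ((Z ω - κ : ℝ) : ℂ)) * k q) hprod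
  have hl : ∀ ω, ∫ q : ℝ, Complex.exp (((c : ℂ) + q * Complex.I) * ((Z ω - κ : ℝ) : ℂ)) * k q =
      ((2 * Real.pi * kinkPayoff a b (Z ω - κ) : ℝ) : ℂ) := by
    intro ω
    rw [hk, integral_kernel_mul_exp h h0 h1]
    push_cast
    ring
  simp_rw [hl] at hswap
  rw [integral_complex_ofReal, integral_const_mul] at hswap
  rw [hswap]
  refine integral_congr_ae (Eventually.of_forall fun q => ?_)
  simp only
  rw [integral_mul_const]
  congr 1
  rw [complexMGF, ← integral_mul_const]
  refine integral_congr_ae (Eventually.of_forall fun ω => ?_)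
  simp only
  rw [← Complex.exp_add]
  push_cast
  ring_nf

/-! ### Laplace's method with a second-order term -/

theorem integrable_pow_mul_gaussian (n : ℕ) {b : ℝ} (hb : 0 < b) :
    Integrable fun x : ℝ => x ^ n * Real.exp (-b * x ^ 2) := by
  have := integrable_rpow_mul_exp_neg_mul_sq hb (s := (n : ℝ))
    (by have : (0 : ℝ) ≤ n := n.cast_nonneg
        linarith)
  simpa only [Real.rpow_natCast] using this

theorem integrable_abs_pow_mul_gaussian (n : ℕ) {b : ℝ} (hb : 0 < b) :
    Integrable fun x : ℝ => |x| ^ n * Real.exp (-b * x ^ 2) := by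
  refine (integrable_pow_mul_gaussian n hb).abs.congr (Eventually.of_forall fun x => ?_)
  simp only [abs_mul, abs_pow, Real.abs_exp]

theorem integral_abs_pow_mul_gaussian (n : ℕ) {b : ℝ} (hb : 0 < b) :
    ∫ x : ℝ, |x| ^ n * Real.exp (-b * x ^ 2) = b ^ (-((n : ℝ) + 1) / 2) * Real.Gamma (((n : ℝ) + 1) / 2) := by
  have h1 : ∫ x : ℝ, |x| ^ n * Real.exp (-b * x ^ 2) =
      ∫ x : ℝ, (fun y : ℝ => y ^ n * Real.exp (-b * y ^ 2)) |x| := by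
    simp only [sq_abs]
  have h2 := integral_rpow_mul_exp_neg_mul_rpow (p := 2) (q := n) two_pos
    (by have : (0 : ℝ) ≤ n := n.cast_nonneg
        linarith) hb
  rw [h1, integral_comp_abs (f := fun y : ℝ => y ^ n * Real.exp (-b * y ^ 2))]
  simp only [Real.rpow_natCast, Real.rpow_two] at h2
  rw [h2]
  ring

theorem integral_even_pow_mul_gaussian (m : ℕ) {b : ℝ} (hb : 0 < b) :
    ∫ x : ℝ, x ^ (2 * m) * Real.exp (-b * x ^ 2) =
      √(Real.pi / b) * ((2 * m - 1).doubleFactorial / (2 * b) ^ m) := by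
  have h1 : ∫ x : ℝ, x ^ (2 * m) * Real.exp (-b * x ^ 2) =
      ∫ x : ℝ, |x| ^ (2 * m) * Real.exp (-b * x ^ 2) := by
    simp only [pow_mul, sq_abs]
  rw [h1, integral_abs_pow_mul_gaussian _ hb]
  have h2 : (((2 * m : ℕ) : ℝ) + 1) / 2 = m + 1 / 2 := by push_cast; ring
  rw [neg_div, h2, Real.Gamma_nat_add_half, Real.rpow_neg hb.le, Real.rpow_add hb, Real.rpow_natCast,
    ← Real.sqrt_eq_rpow, Real.sqrt_div Real.pi_pos.le, mul_pow]
  field_simp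

theorem integral_odd_pow_mul_gaussian (m : ℕ) (b : ℝ) :
    ∫ x : ℝ, x ^ (2 * m + 1) * Real.exp (-b * x ^ 2) = 0 := by
  have h := integral_neg_eq_self (fun x : ℝ => x ^ (2 * m + 1) * Real.exp (-b * x ^ 2)) volume
  have h2 : ∀ x : ℝ, (-x) ^ (2 * m + 1) * Real.exp (-b * (-x) ^ 2) =
      -(x ^ (2 * m + 1) * Real.exp (-b * x ^ 2)) := by
    intro x
    rw [Odd.neg_pow ⟨m, rfl⟩, neg_sq]; ring
  simp_rw [h2] at h
  rw [integral_neg] at h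
  linarith

theorem exists_abs_moment_le (n : ℕ) {s : ℝ} (hs : 0 < s) :
    ∃ C ≥ 0, ∀ τ > 0, ∫ x : ℝ, |x| ^ n * Real.exp (-(s * τ) * x ^ 2) = C / √τ ^ (n + 1) := by
  refine ⟨s ^ (-((n : ℝ) + 1) / 2) * Real.Gamma (((n : ℝ) + 1) / 2), by positivity, fun τ hτ => ?_⟩
  rw [integral_abs_pow_mul_gaussian n (mul_pos hs hτ), Real.mul_rpow hs.le hτ.le]
  have : √τ ^ (n + 1) = τ ^ (((n : ℝ) + 1) / 2) := by
    rw [Real.sqrt_eq_rpow, ← Real.rpow_natCast, ← Real.rpow_mul hτ.le]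
    push_cast; ring_nf
  rw [this, neg_div, Real.rpow_neg hτ.le]
  field_simp

/-- Replacing a bounded holomorphic amplitude by a Taylor polynomial in a Gaussian integral. -/
theorem exists_gaussian_taylor_bound {ρ h K s : ℝ} (hh : 0 < h) (hhρ : h ≤ ρ / 4) (hs : 0 < s) (hK : 0 ≤ K)
    (m n : ℕ) :
    ∃ C ≥ 0, ∀ B : ℂ → ℂ, DifferentiableOn ℂ B (Metric.ball 0 ρ) →
      (∀ z ∈ Metric.ball (0 : ℂ) ρ, ‖B z‖ ≤ K) → ∀ τ > 0,
      ‖(∫ q in Icc (-h) h, B q * q ^ m * Real.exp (-(s * τ) * q ^ 2)) -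
        ∑ i ∈ Finset.range n, (i.factorial : ℂ)⁻¹ * iteratedDeriv i B 0 *
          ((∫ q : ℝ, q ^ (m + i) * Real.exp (-(s * τ) * q ^ 2) : ℝ) : ℂ)‖ ≤ C / √τ ^ (m + n + 1) := by
  have hρ : 0 < ρ := by linarith
  obtain ⟨Cm, hCm, hmom⟩ := exists_abs_moment_le (m + n) hs
  -- One constant serves two errors. On `[-h, h]` it is the Taylor remainder. Outside, the
  -- polynomial itself is the error, and each power `|q|ⁱ` is raised to `|q|ⁿ` through `|q| / h ≥
  -- 1`.
  set D : ℝ := 2 * K * (2 / ρ) ^ n + ∑ i ∈ Finset.range n, K * (2 / ρ) ^ i * (1 / h) ^ (n - i) with hD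
  have hD0 : 0 ≤ D := by positivity
  refine ⟨D * Cm, by positivity, fun B hB hBK τ hτ => ?_⟩
  have hcoef : ∀ i, ‖(i.factorial : ℂ)⁻¹ * iteratedDeriv i B 0‖ ≤ K * (2 / ρ) ^ i := by
    intro i
    have h1 := norm_iteratedDeriv_le_of_ball hρ hB hBK i
    have hfac : (0 : ℝ) < i.factorial := by exact_mod_cast i.factorial_pos
    rw [norm_mul, norm_inv, Complex.norm_natCast, inv_mul_le_iff₀ hfac]
    refine h1.trans (le_of_eq ?_)
    rw [div_pow, div_pow]
    field_simp
  set T : ℝ → ℂ := fun q => ∑ i ∈ Finset.range n, (i.factorial : ℂ)⁻¹ * iteratedDeriv i B 0 * (q : ℂ) ^ i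
    with hT
  set w : ℝ → ℝ := fun q => Real.exp (-(s * τ) * q ^ 2) with hw
  set N : ℝ → ℂ := (Icc (-h) h).indicator fun q : ℝ => B q * q ^ m * w q with hN
  have hpt : ∀ q : ℝ, ‖N q - T q * q ^ m * w q‖ ≤ D * (|q| ^ (m + n) * w q) := by
    intro q
    have hw0 : 0 ≤ w q := (Real.exp_pos _).le
    have hsum0 : 0 ≤ ∑ i ∈ Finset.range n, K * (2 / ρ) ^ i * (1 / h) ^ (n - i) :=
      Finset.sum_nonneg fun i _ => by positivity
    by_cases hq : q ∈ Icc (-h) h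
    · rw [hN, indicator_of_mem hq, ← sub_mul, ← sub_mul, norm_mul, norm_mul, norm_pow, Complex.norm_real,
        Complex.norm_real, Real.norm_eq_abs, Real.norm_eq_abs, abs_of_nonneg hw0]
      have hq' : |q| ≤ h := abs_le.2 hq
      have ht := norm_sub_taylor_le hρ hB hBK n (z := (q : ℂ))
        (by rw [sub_zero, Complex.norm_real, Real.norm_eq_abs]; linarith)
      simp only [sub_zero, Complex.norm_real, Real.norm_eq_abs] at ht
      have h1 : ‖B q - T q‖ ≤ D * |q| ^ n := by
        refine ht.trans ?_
        rw [show 2 * |q| / ρ = 2 / ρ * |q| by ring, mul_pow, ← mul_assoc]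
        gcongr
        rw [hD]
        linarith
      calc ‖B q - T q‖ * |q| ^ m * w q ≤ D * |q| ^ n * |q| ^ m * w q := by gcongr
        _ = _ := by rw [pow_add]; ring
    · rw [hN, indicator_of_notMem hq, zero_sub, norm_neg, norm_mul, norm_mul, norm_pow, Complex.norm_real,
        Complex.norm_real, Real.norm_eq_abs, Real.norm_eq_abs, abs_of_nonneg hw0]
      have hq' : h ≤ |q| := by
        by_contra! hcon
        exact hq (abs_le.1 hcon.le)
      have h1 : ‖T q‖ ≤ D * |q| ^ n := by
        have h2 : ‖T q‖ ≤ ∑ i ∈ Finset.range n, K * (2 / ρ) ^ i * (1 / h) ^ (n - i) * |q| ^ n := by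
          refine norm_sum_le_of_le _ fun i hi => ?_
          rw [norm_mul, norm_pow, Complex.norm_real, Real.norm_eq_abs, mul_assoc]
          refine mul_le_mul (hcoef i) ?_ (by positivity) (by positivity)
          have hin : i < n := Finset.mem_range.1 hi
          calc |q| ^ i = 1 ^ (n - i) * |q| ^ i := by rw [one_pow, one_mul]
            _ ≤ (1 / h * |q|) ^ (n - i) * |q| ^ i := by
              gcongr
              rw [one_div, inv_mul_eq_div, le_div_iff₀ hh]
              linarith
            _ = (1 / h) ^ (n - i) * |q| ^ n := by
              rw [mul_pow, mul_assoc, ← pow_add, Nat.sub_add_cancel hin.le]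
        refine h2.trans ?_
        rw [← Finset.sum_mul]
        gcongr
        rw [hD]
        have : 0 ≤ 2 * K * (2 / ρ) ^ n := by positivity
        linarith
      calc ‖T q‖ * |q| ^ m * w q ≤ D * |q| ^ n * |q| ^ m * w q := by gcongr
        _ = _ := by rw [pow_add]; ring
  have hsτ : 0 < s * τ := mul_pos hs hτ
  have hTint : ∀ i ∈ Finset.range n, Integrable fun q : ℝ =>
      (i.factorial : ℂ)⁻¹ * iteratedDeriv i B 0 * ((q ^ (m + i) * w q : ℝ) : ℂ) := fun i _ =>
    ((integrable_pow_mul_gaussian (m + i) hsτ).ofReal).const_mul _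
  have hTeq : (fun q : ℝ => T q * q ^ m * w q) = fun q : ℝ => ∑ i ∈ Finset.range n,
      (i.factorial : ℂ)⁻¹ * iteratedDeriv i B 0 * ((q ^ (m + i) * w q : ℝ) : ℂ) := by
    funext q
    rw [hT]
    simp only [Finset.sum_mul]
    refine Finset.sum_congr rfl fun i _ => ?_
    push_cast
    rw [pow_add]
    ring
  have hTI : Integrable fun q : ℝ => T q * q ^ m * w q := by
    rw [hTeq]; exact integrable_finsetSum _ hTint
  have hmaps : MapsTo (fun q : ℝ => (q : ℂ)) (Icc (-h) h) (Metric.ball (0 : ℂ) ρ) := by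
    intro q hq
    rw [mem_ball_zero_iff, Complex.norm_real, Real.norm_eq_abs]
    have := abs_le.2 hq
    linarith
  have hBc : ContinuousOn (fun q : ℝ => B q * q ^ m * w q) (Icc (-h) h) := by
    refine ((hB.continuousOn.comp Complex.continuous_ofReal.continuousOn hmaps).mul ?_).mul ?_ <;>
    exact Continuous.continuousOn (by fun_prop)
  have hNI : Integrable N := (integrable_indicator_iff measurableSet_Icc).2
    (hBc.integrableOn_compact isCompact_Icc)
  have hTval : ∫ q : ℝ, T q * q ^ m * w q = ∑ i ∈ Finset.range n,
      (i.factorial : ℂ)⁻¹ * iteratedDeriv i B 0 * ((∫ q : ℝ, q ^ (m + i) * w q : ℝ) : ℂ) := by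
    rw [hTeq, integral_finsetSum _ hTint]
    refine Finset.sum_congr rfl fun i _ => ?_
    rw [integral_const_mul, integral_complex_ofReal]
  rw [← hTval, ← integral_indicator measurableSet_Icc, ← integral_sub hNI hTI]
  refine (norm_integral_le_of_norm_le
    ((integrable_abs_pow_mul_gaussian (m + n) hsτ).const_mul D) (Eventually.of_forall hpt)).trans ?_
  rw [integral_const_mul, hmom τ hτ, mul_div_assoc]

/-- Expand `exp(τ q³ χ)` to third order against the Gaussian and Taylor-expand each amplitude `G
χ^j`. The constant depends on `G` only through `K`, since the amplitude will vary with `τ`. -/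
theorem exists_laplace_bound {ρ K X v : ℝ} (hρ : 0 < ρ) (hv : 0 < v) (hK : 0 ≤ K) {χ : ℂ → ℂ}
    (hχ : DifferentiableOn ℂ χ (Metric.ball 0 ρ)) (hX : ∀ z ∈ Metric.ball (0 : ℂ) ρ, ‖χ z‖ ≤ X) :
    ∃ h, 0 < h ∧ h ≤ ρ / 4 ∧ ∃ C ≥ 0, ∀ G : ℂ → ℂ, DifferentiableOn ℂ G (Metric.ball 0 ρ) →
      (∀ z ∈ Metric.ball (0 : ℂ) ρ, ‖G z‖ ≤ K) → ∀ τ : ℝ, 0 < τ →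
      ‖(∫ q in Icc (-h) h, G q * Complex.exp (τ * (-(v / 2) * q ^ 2 + q ^ 3 * χ q))) -
        √(2 * Real.pi / (v * τ)) * (G 0 + 1 / τ * (iteratedDeriv 2 G 0 / (2 * v) +
          3 * deriv (fun z => G z * χ z) 0 / v ^ 2 + 15 / 2 * (G 0 * χ 0 ^ 2) / v ^ 3))‖ ≤
        C / √τ ^ 5 := by
  have hX0 : 0 ≤ X := (norm_nonneg _).trans (hX 0 (Metric.mem_ball_self hρ))
  -- On `[-h, h]` this makes `|q³ χ| ≤ (v / 4) q²`, so at least half of the Gaussian exponent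
  -- survives the cubic term.
  set h : ℝ := min (ρ / 4) (v / (4 * (X + 1))) with hh
  have hh0 : 0 < h := lt_min (by positivity) (by positivity)
  have hhρ : h ≤ ρ / 4 := min_le_left _ _
  have hhX : h * X ≤ v / 4 := by
    have : h ≤ v / (4 * (X + 1)) := min_le_right _ _
    rw [le_div_iff₀ (by positivity)] at this
    nlinarith
  have hb : 0 < v / 2 := by positivity
  -- The `j`-th term carries `τ^j q^{3j}`; expanding its amplitude to order `4 - j` leaves `τ^j /
  -- √τ^{2j+5} = τ^{-5/2}` for every `j`.
  have hT : ∀ j : ℕ, _ := fun j => exists_gaussian_taylor_bound (ρ := ρ) (K := K * X ^ j) (s := v / 2)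
    hh0 hhρ hb (by positivity) (3 * j) (4 - j)
  choose Cj hCj hTj using hT
  obtain ⟨C12, hC12, hmom12⟩ := exists_abs_moment_le 12 (show 0 < v / 4 by positivity)
  refine ⟨h, hh0, hhρ, ∑ j ∈ Finset.range 4, Cj j / j.factorial + K * X ^ 4 * C12,
    add_nonneg (Finset.sum_nonneg fun j _ => div_nonneg (hCj j) (by positivity)) (by positivity),
    fun G hG hGK τ hτ => ?_⟩
  set w : ℝ → ℝ := fun q => Real.exp (-(v / 2 * τ) * q ^ 2) with hw
  set B : ℕ → ℂ → ℂ := fun j z => G z * χ z ^ j with hB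
  have hBd : ∀ j, DifferentiableOn ℂ (B j) (Metric.ball 0 ρ) := fun j => hG.mul (hχ.pow j)
  have hBK : ∀ j, ∀ z ∈ Metric.ball (0 : ℂ) ρ, ‖B j z‖ ≤ K * X ^ j := by
    intro j z hz
    rw [norm_mul, norm_pow]
    exact mul_le_mul (hGK z hz) (pow_le_pow_left₀ (norm_nonneg _) (hX z hz) j) (by positivity) hK
  set I : ℕ → ℂ := fun j => ∫ q in Icc (-h) h, B j q * q ^ (3 * j) * w q with hI
  set M : ℕ → ℝ := fun k => ∫ q : ℝ, q ^ k * w q with hM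
  set S : ℕ → ℂ := fun j => ∑ i ∈ Finset.range (4 - j),
    (i.factorial : ℂ)⁻¹ * iteratedDeriv i (B j) 0 * (M (3 * j + i) : ℂ) with hS
  have hIS : ∀ j ≤ 3, ‖I j - S j‖ ≤ Cj j / √τ ^ (2 * j + 5) := by
    intro j hj
    have := hTj j (B j) (hBd j) (hBK j) τ hτ
    rwa [show 3 * j + (4 - j) + 1 = 2 * j + 5 by omega] at this
  have hmaps : MapsTo (fun q : ℝ => (q : ℂ)) (Icc (-h) h) (Metric.ball (0 : ℂ) ρ) := by
    intro q hq
    rw [mem_ball_zero_iff, Complex.norm_real, Real.norm_eq_abs]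
    have := abs_le.2 hq
    linarith
  have hGc : ContinuousOn (fun q : ℝ => G q) (Icc (-h) h) :=
    hG.continuousOn.comp Complex.continuous_ofReal.continuousOn hmaps
  have hχc : ContinuousOn (fun q : ℝ => χ q) (Icc (-h) h) :=
    hχ.continuousOn.comp Complex.continuous_ofReal.continuousOn hmaps
  have hterm : ∀ j ∈ Finset.range 4, IntegrableOn
      (fun q : ℝ => ((τ : ℂ) ^ j / j.factorial) * (B j q * q ^ (3 * j) * w q)) (Icc (-h) h) := by
    intro j _
    refine ContinuousOn.integrableOn_compact isCompact_Icc (ContinuousOn.mul continuousOn_const ?_)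
    refine ((hGc.mul (hχc.pow j)).mul ?_).mul ?_ <;> exact Continuous.continuousOn (by fun_prop)
  have hfull : IntegrableOn (fun q : ℝ => G q * Complex.exp (τ * (-(v / 2) * q ^ 2 + q ^ 3 * χ q)))
      (Icc (-h) h) := by
    refine ContinuousOn.integrableOn_compact isCompact_Icc (hGc.mul (ContinuousOn.cexp ?_))
    refine continuousOn_const.mul (ContinuousOn.add ?_ (ContinuousOn.mul ?_ hχc)) <;>
    exact Continuous.continuousOn (by fun_prop)
  -- The fourth-order remainder of the exponential is of size `τ⁴ q¹²`, which integrates to `τ⁴ /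
  -- √τ^{13} = τ^{-5/2}`.
  have hpt : ∀ q ∈ Icc (-h) h,
      ‖G q * Complex.exp (τ * (-(v / 2) * q ^ 2 + q ^ 3 * χ q)) -
        ∑ j ∈ Finset.range 4, ((τ : ℂ) ^ j / j.factorial) * (B j q * q ^ (3 * j) * w q)‖ ≤
      K * X ^ 4 * τ ^ 4 * (|q| ^ 12 * Real.exp (-(v / 4 * τ) * q ^ 2)) := by
    intro q hq
    have hqb := hmaps hq
    have hqh : |q| ≤ h := abs_le.2 hq
    set W : ℂ := τ * (q ^ 3 * χ q) with hW
    have hWn : ‖W‖ ≤ τ * (|q| ^ 3 * X) := by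
      rw [hW, norm_mul, norm_mul, norm_pow, Complex.norm_real, Complex.norm_real, Real.norm_eq_abs,
        Real.norm_eq_abs, abs_of_pos hτ]
      gcongr
      exact hX _ hqb
    have hWn' : ‖W‖ ≤ v / 4 * τ * q ^ 2 := by
      refine hWn.trans ?_
      calc τ * (|q| ^ 3 * X) = τ * |q| ^ 2 * (|q| * X) := by ring
        _ ≤ τ * |q| ^ 2 * (v / 4) := by
          gcongr
          exact (mul_le_mul_of_nonneg_right hqh hX0).trans hhX
        _ = _ := by rw [sq_abs]; ring
    have hexp : Complex.exp (τ * (-(v / 2) * q ^ 2 + q ^ 3 * χ q)) = w q * Complex.exp W := by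
      rw [hw, Complex.ofReal_exp, ← Complex.exp_add]
      congr 1
      rw [hW]; push_cast; ring
    have hsum : ∑ j ∈ Finset.range 4, ((τ : ℂ) ^ j / j.factorial) * (B j q * q ^ (3 * j) * w q) =
        G q * w q * ∑ j ∈ Finset.range 4, W ^ j / j.factorial := by
      rw [Finset.mul_sum]
      refine Finset.sum_congr rfl fun j _ => ?_
      simp only [hB, hW]
      rw [pow_mul]
      ring
    rw [hexp, hsum, ← mul_assoc, ← mul_sub, norm_mul, norm_mul]
    have h1 := Complex.norm_exp_sub_sum_le_norm_mul_exp W 4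
    have hwn : ‖(w q : ℂ)‖ = w q := by
      rw [Complex.norm_real, Real.norm_eq_abs, abs_of_pos (Real.exp_pos _)]
    rw [hwn]
    have hw0 : 0 < w q := Real.exp_pos _
    calc ‖G q‖ * w q * ‖Complex.exp W - ∑ j ∈ Finset.range 4, W ^ j / j.factorial‖
        ≤ K * w q * ((τ * (|q| ^ 3 * X)) ^ 4 * Real.exp (v / 4 * τ * q ^ 2)) := by
          refine mul_le_mul (mul_le_mul_of_nonneg_right (hGK _ hqb) hw0.le) (h1.trans ?_)
            (norm_nonneg _) (by positivity)
          gcongr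
      _ = K * X ^ 4 * τ ^ 4 * (|q| ^ 12 * (w q * Real.exp (v / 4 * τ * q ^ 2))) := by ring
      _ = _ := by
          rw [hw]
          simp only
          rw [← Real.exp_add]
          ring_nf
  have hv4 : 0 < v / 4 * τ := by positivity
  have hrem : ‖(∫ q in Icc (-h) h, G q * Complex.exp (τ * (-(v / 2) * q ^ 2 + q ^ 3 * χ q))) -
      ∑ j ∈ Finset.range 4, ((τ : ℂ) ^ j / j.factorial) * I j‖ ≤ K * X ^ 4 * C12 / √τ ^ 5 := by
    have hsumI : ∑ j ∈ Finset.range 4, ((τ : ℂ) ^ j / j.factorial) * I j =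
        ∫ q in Icc (-h) h, ∑ j ∈ Finset.range 4,
          ((τ : ℂ) ^ j / j.factorial) * (B j q * q ^ (3 * j) * w q) := by
      rw [integral_finsetSum _ hterm]
      exact Finset.sum_congr rfl fun j _ => (integral_const_mul _ _).symm
    rw [hsumI, ← integral_sub hfull (integrable_finsetSum _ hterm)]
    have hdom := (integrable_abs_pow_mul_gaussian 12 hv4).const_mul (K * X ^ 4 * τ ^ 4)
    refine (norm_integral_le_of_norm_le hdom.integrableOn
      ((ae_restrict_iff' measurableSet_Icc).2 (Eventually.of_forall hpt))).trans ?_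
    refine (setIntegral_le_integral hdom (Eventually.of_forall fun q => by positivity)).trans ?_
    rw [integral_const_mul, hmom12 τ hτ]
    have hsq : τ ^ 4 = √τ ^ 8 := by
      rw [show 8 = 2 * 4 by norm_num, pow_mul, Real.sq_sqrt hτ.le]
    have : 0 < √τ := Real.sqrt_pos.2 hτ
    rw [hsq]
    refine le_of_eq ?_
    field_simp
    ring
  -- Odd moments vanish. The survivors are `q⁰` and `q²` for `j = 0`, `q⁴` for `j = 1` and `q⁶` for
  -- `j = 2`; the term `j = 3` contributes only `q⁹`, hence nothing.
  have hmain : ∑ j ∈ Finset.range 4, ((τ : ℂ) ^ j / j.factorial) * S j =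
      √(2 * Real.pi / (v * τ)) * (G 0 + 1 / τ * (iteratedDeriv 2 G 0 / (2 * v) +
          3 * deriv (fun z => G z * χ z) 0 / v ^ 2 + 15 / 2 * (G 0 * χ 0 ^ 2) / v ^ 3)) := by
    have hpos : 0 < v / 2 * τ := by positivity
    have hodd : ∀ m, M (2 * m + 1) = 0 := fun m => integral_odd_pow_mul_gaussian m _
    have heven : ∀ m, M (2 * m) = √(2 * Real.pi / (v * τ)) * ((2 * m - 1).doubleFactorial / (v * τ) ^ m) := by
      intro m
      have := integral_even_pow_mul_gaussian m hpos
      rw [show 2 * (v / 2 * τ) = v * τ by ring, show Real.pi / (v / 2 * τ) = 2 * Real.pi / (v * τ) by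
        field_simp] at this
      exact this
    have m0 := heven 0
    have m2 := heven 1
    have m4 := heven 2
    have m6 := heven 3
    have m1 := hodd 0
    have m3 := hodd 1
    have m5 := hodd 2
    have m7 := hodd 3
    have m9 := hodd 4
    norm_num [Nat.doubleFactorial] at m0 m2 m4 m6 m1 m3 m5 m7 m9
    have hB1 : (fun z => G z * χ z) = B 1 := by simp [hB]
    have hB0 : G = B 0 := by simp [hB]
    have hv' : (v : ℂ) ≠ 0 := by exact_mod_cast hv.ne'
    have hτ' : (τ : ℂ) ≠ 0 := by exact_mod_cast hτ.ne'
    have e2 : B 2 0 = G 0 * χ 0 ^ 2 := rfl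
    have e0 : B 0 0 = G 0 := by simp [hB]
    rw [hB1, ← e2, ← e0]
    conv_rhs => rw [hB0]
    simp only [hS, Finset.sum_range_succ, Finset.sum_range_zero, Nat.factorial, m0, m1, m2, m3, m4, m5, m6,
      m7, m9, iteratedDeriv_zero, iteratedDeriv_one, zero_add, add_zero]
    norm_num [m0, m1, m2, m3, m4, m5, m6, m7, m9, Nat.factorial, e0, e2, Finset.sum_range_succ, iteratedDeriv_one]
    field_simp
    ring
  rw [← hmain]
  have hsqτ : 0 < √τ := Real.sqrt_pos.2 hτ
  have hdiff : ‖∑ j ∈ Finset.range 4, ((τ : ℂ) ^ j / j.factorial) * I j -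
      ∑ j ∈ Finset.range 4, ((τ : ℂ) ^ j / j.factorial) * S j‖ ≤
      ∑ j ∈ Finset.range 4, Cj j / j.factorial / √τ ^ 5 := by
    rw [← Finset.sum_sub_distrib]
    refine norm_sum_le_of_le _ fun j hj => ?_
    rw [← mul_sub, norm_mul, norm_div, norm_pow, Complex.norm_natCast, Complex.norm_real,
      Real.norm_eq_abs, abs_of_pos hτ]
    have hj3 : j ≤ 3 := by have := Finset.mem_range.1 hj; omega
    have hfac : (0 : ℝ) < j.factorial := by exact_mod_cast j.factorial_pos
    calc τ ^ j / j.factorial * ‖I j - S j‖ ≤ τ ^ j / j.factorial * (Cj j / √τ ^ (2 * j + 5)) := by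
          gcongr
          exact hIS j hj3
      _ = _ := by
          have : τ ^ j = √τ ^ (2 * j) := by rw [pow_mul, Real.sq_sqrt hτ.le]
          rw [this, pow_add]
          field_simp
  refine (norm_sub_le_norm_sub_add_norm_sub _ (∑ j ∈ Finset.range 4, ((τ : ℂ) ^ j / j.factorial) * I j) _).trans ?_
  rw [add_div, Finset.sum_div]
  linarith

/-! ### Third-order Taylor expansion and restriction to the real line -/

/-- The third iterated slope: the remainder of the second-order Taylor expansion is
`(z - c) ^ 3 * taylorRemainder F c z`. -/
noncomputable def taylorRemainder (F : ℂ → ℂ) (c : ℂ) : ℂ → ℂ :=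
  (Function.swap dslope c)^[3] F

/-- Each `dslope` at `c` shifts the Taylor coefficients at `c` down by one place. -/
theorem iteratedDeriv_dslope {F : ℂ → ℂ} {c : ℂ} (hF : AnalyticAt ℂ F c) (k n : ℕ) :
    iteratedDeriv n ((Function.swap dslope c)^[k] F) c / n.factorial =
      iteratedDeriv (n + k) F c / (n + k).factorial := by
  have h1 := HasFPowerSeriesAt.has_fpower_series_iterate_dslope_fslope k hF.hasFPowerSeriesAt
  have h2 := h1.eq_formalMultilinearSeries (AnalyticAt.hasFPowerSeriesAt ⟨_, h1⟩)
  have h3 := congrArg (fun p => FormalMultilinearSeries.coeff p n) h2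
  simp only [FormalMultilinearSeries.coeff_iterate_fslope, FormalMultilinearSeries.coeff_ofScalars] at h3
  exact h3.symm

theorem differentiableOn_taylorRemainder {F : ℂ → ℂ} {c : ℂ} {s : Set ℂ} (hs : s ∈ 𝓝 c)
    (hF : DifferentiableOn ℂ F s) : DifferentiableOn ℂ (taylorRemainder F c) s := by
  simp only [taylorRemainder, Function.iterate_succ, Function.iterate_zero, Function.comp_apply, id,
    Function.swap]
  rw [Complex.differentiableOn_dslope hs, Complex.differentiableOn_dslope hs,
    Complex.differentiableOn_dslope hs]
  exact hF

theorem eq_taylor_add_remainder {F : ℂ → ℂ} {c : ℂ} (hF : AnalyticAt ℂ F c) (z : ℂ) :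
    F z = F c + deriv F c * (z - c) + iteratedDeriv 2 F c / 2 * (z - c) ^ 2 +
      (z - c) ^ 3 * taylorRemainder F c z := by
  set D := Function.swap (dslope (𝕜 := ℂ) (E := ℂ)) c with hD
  have e0 : F z = F c + (z - c) * D F z := by
    have := sub_smul_dslope F c z
    rw [smul_eq_mul] at this
    simp only [hD, Function.swap, this]; ring
  have e1 : D F z = D F c + (z - c) * D (D F) z := by
    have := sub_smul_dslope (D F) c z
    rw [smul_eq_mul] at this
    simp only [hD, Function.swap] at this ⊢
    rw [this]; ring
  have e2 : D (D F) z = D (D F) c + (z - c) * D (D (D F)) z := by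
    have := sub_smul_dslope (D (D F)) c z
    rw [smul_eq_mul] at this
    simp only [hD, Function.swap] at this ⊢
    rw [this]; ring
  have d1 : D F c = deriv F c := by simp [hD]
  have d2 : D (D F) c = iteratedDeriv 2 F c / 2 := by
    have := iteratedDeriv_dslope hF 2 0
    simpa [Function.iterate_succ, hD] using this
  have d3 : taylorRemainder F c z = D (D (D F)) z := rfl
  rw [d3, e0, e1, e2, d1, d2]
  ring

theorem taylorRemainder_self {F : ℂ → ℂ} {c : ℂ} (hF : AnalyticAt ℂ F c) :
    taylorRemainder F c c = iteratedDeriv 3 F c / 6 := by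
  have : iteratedDeriv 0 (taylorRemainder F c) c / _ = _ := iteratedDeriv_dslope hF 3 0
  simpa [Nat.factorial] using this

theorem deriv_taylorRemainder {F : ℂ → ℂ} {c : ℂ} (hF : AnalyticAt ℂ F c) :
    deriv (taylorRemainder F c) c = iteratedDeriv 4 F c / 24 := by
  have : iteratedDeriv 1 (taylorRemainder F c) c / _ = _ := iteratedDeriv_dslope hF 3 1
  simpa [Nat.factorial, iteratedDeriv_one] using this

/-- Transfers derivatives of the holomorphic extension to the real coefficient functions. -/
theorem iteratedDeriv_eq_ofReal {F : ℂ → ℂ} {g : ℝ → ℝ} {c ρ : ℝ}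
    (hF : DifferentiableOn ℂ F (Metric.ball (c : ℂ) ρ)) (hg : ∀ u : ℝ, |u - c| < ρ → F u = g u) (n : ℕ) :
    ∀ u : ℝ, |u - c| < ρ → iteratedDeriv n F u = ((iteratedDeriv n g u : ℝ) : ℂ) := by
  induction n with
  | zero => simpa using hg
  | succ n ih =>
    intro u hu
    rw [iteratedDeriv_succ, iteratedDeriv_succ]
    have hmem : (u : ℂ) ∈ Metric.ball (c : ℂ) ρ := by
      rwa [mem_ball_iff_norm, ← Complex.ofReal_sub, Complex.norm_real]
    have han : AnalyticAt ℂ (iteratedDeriv n F) u := by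
      have h1 := (hF.analyticOnNhd Metric.isOpen_ball) u hmem
      rw [iteratedDeriv_eq_iterate]
      exact h1.iterated_deriv n
    have hd := han.differentiableAt.hasDerivAt
    have hev : (fun x : ℝ => iteratedDeriv n F x) =ᶠ[𝓝 u] fun x : ℝ => ((iteratedDeriv n g x : ℝ) : ℂ) := by
      have : Metric.ball c ρ ∈ 𝓝 u := Metric.isOpen_ball.mem_nhds (by simpa [Real.dist_eq] using hu)
      filter_upwards [this] with x hx
      exact ih x (by simpa [Real.dist_eq] using hx)
    have h1 : HasDerivAt (fun x : ℝ => ((iteratedDeriv n g x : ℝ) : ℂ)) (deriv (iteratedDeriv n F) u) u :=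
      hd.comp_ofReal.congr_of_eventuallyEq hev.symm
    have h2 : HasDerivAt (iteratedDeriv n g) (deriv (iteratedDeriv n F) u).re u := by
      have := hd.real_of_complex
      refine this.congr_of_eventuallyEq ?_
      filter_upwards [hev] with x hx
      rw [hx, Complex.ofReal_re]
    rw [h2.deriv]
    exact h1.unique h2.ofReal_comp

theorem contDiffAt_of_eq_ofReal {F : ℂ → ℂ} {g : ℝ → ℝ} {c ρ : ℝ} (hρ : 0 < ρ)
    (hF : DifferentiableOn ℂ F (Metric.ball (c : ℂ) ρ)) (hg : ∀ u : ℝ, |u - c| < ρ → F u = g u)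
    (n : WithTop ℕ∞) : ContDiffAt ℝ n g c := by
  have h1 : ContDiffAt ℂ n F c :=
    ((hF.analyticOnNhd Metric.isOpen_ball) c (Metric.mem_ball_self hρ)).contDiffAt
  refine h1.real_of_complex.congr_of_eventuallyEq ?_
  filter_upwards [Metric.ball_mem_nhds c hρ] with x hx
  rw [hg x (by simpa [Real.dist_eq] using hx), Complex.ofReal_re]

/-! ### Nondegeneracy of the saddlepoint -/

/-- If the second derivative vanished, the first term beyond the affine part would be `κ (z - c)ⁿ`
with `n ≥ 3` and `κ` real. The inequality `Re L(z) ≤ g(Re z)` along the direction `e^{iθ}` would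
force `κ cos(nθ) ≤ κ (cos θ)ⁿ`, which fails for a suitable `θ`. -/
theorem second_deriv_pos_of_vertical_max {L : ℂ → ℂ} {g : ℝ → ℝ} {c ρ : ℝ} (hρ : 0 < ρ)
    (hL : DifferentiableOn ℂ L (Metric.ball (c : ℂ) ρ)) (hg : ∀ u : ℝ, |u - c| < ρ → L u = g u)
    (hmax : ∀ z ∈ Metric.ball (c : ℂ) ρ, (L z).re ≤ g z.re)
    (hstrict : ∀ q : ℝ, q ≠ 0 → |q| < ρ → (L (c + q * Complex.I)).re < g c) :
    0 < iteratedDeriv 2 g c := by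
  have hnhds : Metric.ball (c : ℂ) ρ ∈ 𝓝 (c : ℂ) := Metric.ball_mem_nhds _ hρ
  have hLan : AnalyticAt ℂ L c := (hL.analyticOnNhd Metric.isOpen_ball) c (Metric.mem_ball_self hρ)
  set χ := taylorRemainder L c with hχdef
  have hχ : DifferentiableOn ℂ χ (Metric.ball (c : ℂ) ρ) := differentiableOn_taylorRemainder hnhds hL
  have hχan : AnalyticAt ℂ χ c := (hχ.analyticOnNhd Metric.isOpen_ball) c (Metric.mem_ball_self hρ)
  have hcc : |c - c| < ρ := by simpa using hρ
  set a := iteratedDeriv 2 g c with ha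
  set b := deriv g c with hb
  have hexp : ∀ z : ℂ, L z = g c + b * (z - c) + a / 2 * (z - c) ^ 2 + (z - c) ^ 3 * χ z := by
    intro z
    have h1 := eq_taylor_add_remainder hLan z
    have h2 := iteratedDeriv_eq_ofReal hL hg 1 c hcc
    have h3 := iteratedDeriv_eq_ofReal hL hg 2 c hcc
    rw [iteratedDeriv_one, iteratedDeriv_one] at h2
    rw [hg c hcc, h2, h3] at h1
    exact h1
  have hmem : ∀ x : ℝ, |x| < ρ → ((c : ℂ) + x) ∈ Metric.ball (c : ℂ) ρ := by
    intro x hx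
    rw [mem_ball_iff_norm, add_sub_cancel_left, Complex.norm_real]
    exact hx
  have hgexp : ∀ x : ℝ, |x| < ρ →
      (g (c + x) : ℂ) = g c + b * x + a / 2 * x ^ 2 + x ^ 3 * χ (c + x) := by
    intro x hx
    have h1 := hexp (c + x)
    have h2 := hg (c + x) (by simpa using hx)
    push_cast at h2
    rw [← h2, h1, add_sub_cancel_left]
  -- real part of the maximum property, with first-order terms removed
  have hineq : ∀ w : ℂ, ‖w‖ < ρ → (a / 2 * w ^ 2 + w ^ 3 * χ (c + w)).re ≤
      ((a / 2 * w.re ^ 2 + w.re ^ 3 * χ (c + w.re) : ℂ)).re := by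
    intro w hw
    have h1 := hmax (c + w) (by rw [mem_ball_iff_norm, add_sub_cancel_left]; exact hw)
    have h2 := congrArg Complex.re (hgexp w.re ((Complex.abs_re_le_norm w).trans_lt hw))
    rw [hexp, add_sub_cancel_left] at h1
    rw [Complex.add_re (c : ℂ), Complex.ofReal_re] at h1
    simp only [Complex.ofReal_re] at h2
    rw [h2] at h1
    simp only [Complex.add_re, Complex.ofReal_re, Complex.re_ofReal_mul] at h1 ⊢
    linarith
  have hray : ∀ e : ℂ, Tendsto (fun r : ℝ => (c : ℂ) + r * e) (𝓝[>] 0) (𝓝 c) := by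
    intro e
    have : Tendsto (fun r : ℝ => (c : ℂ) + r * e) (𝓝 0) (𝓝 ((c : ℂ) + ((0 : ℝ) : ℂ) * e)) :=
      ((Complex.continuous_ofReal.tendsto 0).mul_const _).const_add _
    rw [Complex.ofReal_zero, zero_mul, add_zero] at this
    exact this.mono_left nhdsWithin_le_nhds
  have hsmall : ∀ᶠ r : ℝ in 𝓝[>] 0, 0 < r ∧ r < ρ := by
    filter_upwards [self_mem_nhdsWithin, nhdsWithin_le_nhds (gt_mem_nhds hρ)] with r h1 h2
    exact ⟨h1, h2⟩
  -- The vertical direction: to second order the real part changes by `-(a / 2) r²`, which the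
  -- maximum property makes nonpositive.
  have ha0 : 0 ≤ a := by
    have hlim : Tendsto (fun r : ℝ => -(a / 2) + ((-(r * Complex.I)) * χ (c + r * Complex.I)).re)
        (𝓝[>] 0) (𝓝 (-(a / 2) + 0)) := by
      refine Tendsto.const_add _ ?_
      have h1 := hχan.continuousAt.tendsto.comp (hray Complex.I)
      have h2 := (hray Complex.I).sub_const (c : ℂ)
      simp only [add_sub_cancel_left, sub_self] at h2
      have h3 := (h2.neg.mul h1)
      have h4 := (Complex.continuous_re.tendsto _).comp h3
      simpa [Function.comp_def] using h4
    have hle : -(a / 2) + 0 ≤ 0 := by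
      refine le_of_tendsto hlim ?_
      filter_upwards [hsmall] with r hr
      have h1 := hineq (r * Complex.I) (by
        rw [norm_mul, Complex.norm_I, mul_one, Complex.norm_real, Real.norm_eq_abs, abs_of_pos hr.1]
        exact hr.2)
      have h2 : (a / 2 * ((r : ℂ) * Complex.I) ^ 2 + ((r : ℂ) * Complex.I) ^ 3 * χ (c + r * Complex.I)) =
          ((r ^ 2 : ℝ) : ℂ) * (((-(a / 2) : ℝ) : ℂ) + (-(r * Complex.I)) * χ (c + r * Complex.I)) := by
        rw [mul_pow, mul_pow, Complex.I_sq, Complex.I_pow_three]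
        push_cast
        ring
      have h3 : ((r : ℂ) * Complex.I).re = 0 := by simp
      rw [h2, h3, Complex.re_ofReal_mul, Complex.add_re, Complex.ofReal_re] at h1
      simp only [Complex.ofReal_zero, ne_eq, OfNat.ofNat_ne_zero, not_false_eq_true, zero_pow, mul_zero,
        zero_mul, add_zero, Complex.zero_re] at h1
      have h4 : 0 < r ^ 2 := pow_pos hr.1 2
      exact nonpos_of_mul_nonpos_right h1 h4
    linarith
  refine lt_of_le_of_ne ha0 fun hazero => ?_
  -- Otherwise `L` is affine near `c` with real slope, so its real part is constant on the vertical
  -- line, against strictness.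
  have hχne : ¬ ∀ᶠ z in 𝓝 (c : ℂ), χ z = 0 := by
    intro hz
    have h1 := (hray Complex.I).eventually hz
    obtain ⟨r, hr, hr0⟩ := (h1.and hsmall).exists
    have h2 := hstrict r hr0.1.ne' (by rw [abs_of_pos hr0.1]; exact hr0.2)
    rw [hexp, hr, ← hazero] at h2
    simp at h2
  obtain ⟨m, G, hGan, hG0, hGeq⟩ := hχan.exists_eventuallyEq_pow_smul_nonzero_iff.2 hχne
  have hGray : ∀ e : ℂ, Tendsto (fun r : ℝ => G (c + r * e)) (𝓝[>] 0) (𝓝 (G c)) := fun e =>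
    hGan.continuousAt.tendsto.comp (hray e)
  -- `L` is real on the real axis, so its leading coefficient beyond the affine part is real.
  have hGreal : (G c).im = 0 := by
    have h1 := (Complex.continuous_im.tendsto _).comp (hGray 1)
    refine tendsto_nhds_unique h1 (tendsto_const_nhds.congr' ?_)
    filter_upwards [hsmall, (hray 1).eventually hGeq] with r hr hr2
    have h2 := hgexp r (by rw [abs_of_pos hr.1]; exact hr.2)
    rw [mul_one] at hr2
    rw [hr2, add_sub_cancel_left, smul_eq_mul, ← mul_assoc, ← pow_add] at h2
    have h3 := congrArg Complex.im h2
    have h4 : ((r : ℂ) ^ (3 + m) * G (c + r)) = ((r ^ (3 + m) : ℝ) : ℂ) * G (c + r) := by push_cast; ring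
    have h5 : ((g c : ℂ) + b * r + a / 2 * r ^ 2) = ((g c + b * r + a / 2 * r ^ 2 : ℝ) : ℂ) := by
      push_cast; ring
    rw [h4, h5, Complex.add_im, Complex.ofReal_im, Complex.ofReal_im, Complex.im_ofReal_mul, zero_add] at h3
    simp only [Function.comp_apply, mul_one]
    have := pow_pos hr.1 (3 + m)
    rcases mul_eq_zero.1 h3.symm with h6 | h6
    · exact absurd h6 this.ne'
    · exact h6.symm
  set κ := (G c).re with hκ
  have hGκ : G c = κ := Complex.ext rfl (by simp [hGreal])
  have hκ0 : κ ≠ 0 := by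
    intro h; rw [h] at hGκ; exact hG0 (by simpa using hGκ)
  set n := 3 + m with hn
  have hn0 : (0 : ℝ) < n := by rw [hn]; positivity
  have hn3 : (3 : ℝ) ≤ n := by rw [hn]; push_cast; linarith [(Nat.cast_nonneg m : (0 : ℝ) ≤ m)]
  -- comparison along rays
  have hdir : ∀ θ : ℝ, (Complex.exp (θ * Complex.I) ^ n * κ).re ≤ Real.cos θ ^ n * κ := by
    intro θ
    set e := Complex.exp (θ * Complex.I) with he
    have hre : e.re = Real.cos θ := Complex.exp_ofReal_mul_I_re θ
    have hl : Tendsto (fun r : ℝ => (e ^ n * G (c + r * e)).re) (𝓝[>] 0) (𝓝 (e ^ n * κ).re) := by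
      rw [← hGκ]
      exact (Complex.continuous_re.tendsto _).comp ((hGray e).const_mul _)
    have hr : Tendsto (fun r : ℝ => Real.cos θ ^ n * (G (c + r * (Real.cos θ : ℂ))).re) (𝓝[>] 0)
        (𝓝 (Real.cos θ ^ n * κ)) :=
      ((Complex.continuous_re.tendsto _).comp (hGray (Real.cos θ))).const_mul _
    refine le_of_tendsto_of_tendsto hl hr ?_
    filter_upwards [hsmall, (hray e).eventually hGeq, (hray (Real.cos θ)).eventually hGeq] with r hr h1 h2
    have hnorm : ‖(r : ℂ) * e‖ = r := by
      rw [norm_mul, he, Complex.norm_exp_ofReal_mul_I, mul_one, Complex.norm_real, Real.norm_eq_abs,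
        abs_of_pos hr.1]
    have h3 := hineq (r * e) (by rw [hnorm]; exact hr.2)
    have hre2 : ((r : ℂ) * e).re = r * Real.cos θ := by rw [Complex.re_ofReal_mul, hre]
    rw [hre2, ← hazero] at h3
    push_cast at h3 h2
    rw [h1, h2, add_sub_cancel_left, add_sub_cancel_left] at h3
    simp only [zero_div, zero_mul, zero_add, smul_eq_mul] at h3
    have hpos := pow_pos hr.1 n
    have h4 : ((r : ℂ) * e) ^ 3 * (((r : ℂ) * e) ^ m * G (c + r * e)) =
        ((r ^ n : ℝ) : ℂ) * (e ^ n * G (c + r * e)) := by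
      push_cast; rw [hn, pow_add, pow_add]; ring
    have h5 : ((r : ℂ) * Complex.cos θ) ^ 3 * (((r : ℂ) * Complex.cos θ) ^ m * G (c + r * Complex.cos θ)) =
        ((r ^ n : ℝ) : ℂ) * (((Real.cos θ ^ n : ℝ) : ℂ) * G (c + r * Complex.cos θ)) := by
      push_cast; rw [hn, pow_add, pow_add]; ring
    rw [h4, h5, Complex.re_ofReal_mul, Complex.re_ofReal_mul, Complex.re_ofReal_mul] at h3
    push_cast
    exact le_of_mul_le_mul_left h3 hpos
  have habs : ∀ θ : ℝ, 0 < θ → θ < Real.pi → |Real.cos θ ^ n| < 1 := by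
    intro θ h1 h2
    rw [abs_pow]
    refine pow_lt_one₀ (abs_nonneg _) ?_ (by omega)
    have hs := Real.sin_pos_of_pos_of_lt_pi h1 h2
    rw [← sq_lt_one_iff_abs_lt_one]
    nlinarith [Real.sin_sq_add_cos_sq θ]
  have hexpn : ∀ θ : ℝ, Complex.exp (θ * Complex.I) ^ n = Complex.exp ((n * θ : ℝ) * Complex.I) := by
    intro θ
    rw [← Complex.exp_nat_mul]; push_cast; ring_nf
  -- For `κ < 0` the angle `π / n` gives `cos(nθ) = -1`; for `κ > 0` the angle `2π / n` gives `1`.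
  -- Both contradict `|cos θ|ⁿ < 1`, the angles lying in `(0, π)` because `n ≥ 3`.
  rcases lt_or_gt_of_ne hκ0 with hneg | hpos
  · have h1 := hdir (Real.pi / n)
    have h2 := habs (Real.pi / n) (by positivity) (by
      rw [div_lt_iff₀ hn0]; nlinarith [Real.pi_pos])
    rw [hexpn, mul_div_cancel₀ _ hn0.ne', Complex.exp_pi_mul_I] at h1
    simp only [neg_mul, one_mul, Complex.neg_re, Complex.ofReal_re] at h1
    have := (abs_lt.1 h2)
    nlinarith
  · have h1 := hdir (2 * Real.pi / n)
    have h2 := habs (2 * Real.pi / n) (by positivity) (by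
      rw [div_lt_iff₀ hn0]; nlinarith [Real.pi_pos])
    rw [hexpn, mul_div_cancel₀ _ hn0.ne'] at h1
    push_cast at h1
    rw [Complex.exp_two_pi_mul_I, one_mul, Complex.ofReal_re] at h1
    have := (abs_lt.1 h2)
    nlinarith

/-! ### Convex duality at the saddlepoint -/

/-- The tangent of slope `k` at `u` lies below the convex function. -/
theorem isGreatest_legendre {U : Set ℝ} {g : ℝ → ℝ} {u k : ℝ} (hg : ConvexOn ℝ U g) (hu : u ∈ U)
    (hd : HasDerivAt g k u) : IsGreatest ((fun v => v * k - g v) '' U) (u * k - g u) := by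
  refine ⟨⟨u, hu, rfl⟩, ?_⟩
  rintro _ ⟨v, hv, rfl⟩
  rcases lt_trichotomy v u with h | rfl | h
  · have := hg.slope_le_of_hasDerivAt hv hu h hd
    rw [slope_def_field, div_le_iff₀ (by linarith)] at this
    simp only
    nlinarith
  · exact le_rfl
  · have := hg.le_slope_of_hasDerivAt hu hv h hd
    rw [slope_def_field, le_div_iff₀ (by linarith)] at this
    simp only
    nlinarith

/-! ### The tilted moment generating function -/

/-- The ratio `E[exp(z Y_ε / ε)] exp(-Λ₀(z) / ε)`. -/
noncomputable def tilted {Ω : Type*} [MeasurableSpace Ω] (P : Measure Ω) (Y : ℝ → Ω → ℝ) (L₀ : ℂ → ℂ)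
    (ε : ℝ) (z : ℂ) : ℂ :=
  cmgf P Y ε z * Complex.exp (-(ε⁻¹ : ℝ) * L₀ z)

section

variable {Ω : Type*} [MeasurableSpace Ω] {P : Measure Ω} {Y : ℝ → Ω → ℝ} {Λ : Fin 3 → ℝ → ℝ} {L₀ : ℂ → ℂ}

/-- `ε log |f_ε| = Re Λ_ε - Re Λ₀`, so an upper bound `B ε` on the right is a bound on `f_ε` free of
`ε`; zeros of the transform are harmless. -/
theorem norm_tilted_le {ε B : ℝ} (hε : 0 < ε) {z : ℂ}
    (h : cmgf P Y ε z ≠ 0 → reLmgf P Y ε z - (L₀ z).re ≤ B * ε) :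
    ‖tilted P Y L₀ ε z‖ ≤ Real.exp B := by
  by_cases h0 : cmgf P Y ε z = 0
  · simp [tilted, h0, Real.exp_nonneg]
  · have h1 := h h0
    have hn : 0 < ‖cmgf P Y ε z‖ := norm_pos_iff.2 h0
    have h2 : (-((ε⁻¹ : ℝ) : ℂ) * L₀ z).re = -ε⁻¹ * (L₀ z).re := by
      rw [← Complex.ofReal_neg, Complex.re_ofReal_mul]
    rw [tilted, norm_mul, Complex.norm_exp, h2, ← Real.exp_log hn, ← Real.exp_add, Real.exp_le_exp]
    rw [reLmgf] at h1
    have h3 : ε * (Real.log ‖cmgf P Y ε z‖ + -ε⁻¹ * (L₀ z).re) ≤ ε * B := by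
      have : ε * (-ε⁻¹ * (L₀ z).re) = -(L₀ z).re := by field_simp
      rw [mul_add, this]
      linarith
    exact le_of_mul_le_mul_left h3 hε

theorem SharpLDAssumption.exists_norm_tilted_le_line (hY : SharpLDAssumption P Y Λ L₀) {c : ℝ}
    (hc : c ∈ interior (limDomain P Y)) (hc0 : c ≠ 0) :
    ∃ C, ∃ ε₁ > 0, ∀ ε ∈ Ioc 0 ε₁, ∀ z : ℂ, z.re = c → ‖tilted P Y L₀ ε z‖ ≤ C := by
  obtain ⟨ε₂, hε₂, p, hp, M, hfar⟩ := hY.tail_far c hc hc0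
  obtain ⟨C, ε₃, hε₃, hcomp⟩ := hY.tail_compact c hc hc0 p
  refine ⟨Real.exp (max C M), min ε₂ ε₃, lt_min hε₂ hε₃, fun ε hε z hz => ?_⟩
  obtain ⟨x, q⟩ := z
  obtain rfl : x = c := hz
  have hε2 : ε ∈ Ioc 0 ε₂ := ⟨hε.1, hε.2.trans (min_le_left _ _)⟩
  have hε3 : ε ∈ Ioc 0 ε₃ := ⟨hε.1, hε.2.trans (min_le_right _ _)⟩
  refine norm_tilted_le hε.1 fun h0 => ?_
  rcases le_total |q| p with h | h
  · refine (le_abs_self _).trans ((hcomp ε hε3 q h).2.trans ?_)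
    exact mul_le_mul_of_nonneg_right (le_max_left _ _) hε.1.le
  · refine (hfar ε hε2 q h h0).trans ?_
    exact mul_le_mul_of_nonneg_right (le_max_right _ _) hε.1.le

theorem SharpLDAssumption.re_ext_le (hY : SharpLDAssumption P Y Λ L₀) {z : ℂ}
    (hz : z.re ∈ interior (limDomain P Y)) (hz0 : z.re ≠ 0) : (L₀ z).re ≤ Λ 0 z.re := by
  obtain ⟨x, q⟩ := z
  have h1 : (L₀ ⟨x, 0⟩).re = Λ 0 x := by
    have := hY.ext_eq x hz
    rw [show (⟨x, 0⟩ : ℂ) = (x : ℂ) from rfl, this, Complex.ofReal_re]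
  rcases eq_or_ne q 0 with rfl | hq
  · exact h1.le
  · rw [← h1]
    exact ((hY.tail_max x hz hz0).1 q hq).le

theorem SharpLDAssumption.exists_domain (hY : SharpLDAssumption P Y Λ L₀) :
    ∃ ε₀ > 0, ∀ ε ∈ Ioc 0 ε₀, interior (limDomain P Y) ⊆ interior (effDomain P Y ε) := by
  obtain ⟨ε₀, hε₀, h, -⟩ := hY.smooth
  refine ⟨ε₀ / 2, by positivity, fun ε hε => ?_⟩
  exact interior_maximal (h ε ⟨hε.1, by linarith [hε.2]⟩) isOpen_interior

theorem differentiableOn_tilted {ε : ℝ} {S : Set ℂ} (hL : DifferentiableOn ℂ L₀ S)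
    (hS : ∀ z ∈ S, z.re ∈ interior (effDomain P Y ε)) : DifferentiableOn ℂ (tilted P Y L₀ ε) S :=
  (differentiableOn_complexMGF.mono hS).mul ((hL.const_mul _).cexp)

/-- The tail assumptions are used only on two vertical lines, at abscissae `c ± R / 4` chosen away
from `0`. The three lines theorem fills the strip between them. -/
theorem SharpLDAssumption.exists_norm_tilted_le_strip (hY : SharpLDAssumption P Y Λ L₀)
    {c : ℝ} (hc : c ∈ interior (limDomain P Y)) (hc0 : c ≠ 0) :
    ∃ R > 0, ∃ ε₁ > 0, ∃ C, (∀ x, |x - c| ≤ R → x ∈ interior (limDomain P Y) ∧ x ≠ 0) ∧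
      ∀ ε ∈ Ioc 0 ε₁, interior (limDomain P Y) ⊆ interior (effDomain P Y ε) ∧
        ∀ z : ℂ, |z.re - c| ≤ R → ‖tilted P Y L₀ ε z‖ ≤ C := by
  have hopen : IsOpen (interior (limDomain P Y) ∩ {0}ᶜ) := isOpen_interior.inter isOpen_compl_singleton
  obtain ⟨R₀, hR₀, hsub⟩ := Metric.isOpen_iff.1 hopen c ⟨hc, hc0⟩
  set R := R₀ / 2 with hR
  have hRpos : 0 < R := by positivity
  have hgood : ∀ x, |x - c| ≤ R → x ∈ interior (limDomain P Y) ∧ x ≠ 0 := by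
    intro x hx
    have := hsub (show x ∈ Metric.ball c R₀ by
      rw [Metric.mem_ball, Real.dist_eq]; linarith)
    exact ⟨this.1, this.2⟩
  have hIcc : ∀ x ∈ Icc (c - R) (c + R), |x - c| ≤ R := fun x hx => by
    rw [abs_le]; constructor <;> linarith [hx.1, hx.2]
  obtain ⟨K, hK⟩ := isCompact_Icc.exists_bound_of_continuousOn (s := Icc (c - R) (c + R)) (f := Λ 0)
    (hY.essSmooth.differentiableOn.continuousOn.mono fun x hx => (hgood x (hIcc x hx)).1)
  obtain ⟨C₁, ε₁, hε₁, h₁⟩ := hY.exists_norm_tilted_le_line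
    (hgood (c - R / 4) (by rw [sub_sub_cancel_left, abs_neg, abs_of_pos] <;> linarith)).1
    (hgood (c - R / 4) (by rw [sub_sub_cancel_left, abs_neg, abs_of_pos] <;> linarith)).2
  obtain ⟨C₂, ε₂, hε₂, h₂⟩ := hY.exists_norm_tilted_le_line
    (hgood (c + R / 4) (by rw [add_sub_cancel_left, abs_of_pos] <;> linarith)).1
    (hgood (c + R / 4) (by rw [add_sub_cancel_left, abs_of_pos] <;> linarith)).2
  obtain ⟨ε₀, hε₀, h₀⟩ := hY.exists_domain
  refine ⟨R / 4, by positivity, min ε₀ (min ε₁ ε₂), by positivity, max C₁ C₂,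
    fun x hx => hgood x (by linarith), fun ε hε => ?_⟩
  have he0 : ε ∈ Ioc 0 ε₀ := ⟨hε.1, hε.2.trans (min_le_left _ _)⟩
  have he1 : ε ∈ Ioc 0 ε₁ := ⟨hε.1, hε.2.trans ((min_le_right _ _).trans (min_le_left _ _))⟩
  have he2 : ε ∈ Ioc 0 ε₂ := ⟨hε.1, hε.2.trans ((min_le_right _ _).trans (min_le_right _ _))⟩
  refine ⟨h₀ ε he0, fun z hz => ?_⟩
  have hmgf : ContinuousOn (mgf (fun ω => Y ε ω / ε) P) (Icc (c - R) (c + R)) :=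
    continuousOn_mgf.mono fun x hx => h₀ ε he0 (hgood x (hIcc x hx)).1
  -- This `B` depends on `ε`, but it enters only the growth condition of Phragmén–Lindelöf, not the
  -- final bound.
  obtain ⟨B, hB⟩ := isCompact_Icc.exists_bound_of_continuousOn hmgf
  have hmemIcc : ∀ x, |x - c| ≤ R → x ∈ Icc (c - R) (c + R) := fun x hx => by
    have := abs_le.1 hx
    constructor <;> linarith
  refine norm_mul_exp_le_of_lines (M := cmgf P Y ε) (L := L₀) (c := c) (R := R) (K := |K| + 1) (B := B)
    (τ := ε⁻¹) hRpos (by positivity) (inv_nonneg.2 hε.1.le)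
    (hY.ext_analytic.mono fun w hw => (hgood _ (le_of_lt hw)).1)
    (differentiableOn_complexMGF.mono fun w hw => h₀ ε he0 (hgood _ (le_of_lt hw)).1) ?_ ?_ ?_ hz
  · intro w hw
    have h3 := hgood _ hw.le
    refine (hY.re_ext_le h3.1 h3.2).trans ((le_abs_self _).trans ((hK _ (hmemIcc _ hw.le)).trans ?_))
    linarith [le_abs_self K]
  · intro w hw
    refine norm_complexMGF_le_mgf.trans ((le_abs_self _).trans (hB _ (hmemIcc _ ?_)))
    linarith
  · intro w hw
    rcases abs_choice (w.re - c) with h | h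
    · rw [h] at hw
      exact (h₂ ε he2 w (by linarith)).trans (le_max_right _ _)
    · rw [h] at hw
      exact (h₁ ε he1 w (by linarith)).trans (le_max_left _ _)

theorem tilted_ofReal [IsProbabilityMeasure P] (hY : SharpLDAssumption P Y Λ L₀) {ε u : ℝ} (hε : 0 < ε)
    (hu : u ∈ interior (limDomain P Y)) (hdom : u ∈ effDomain P Y ε) :
    tilted P Y L₀ ε u = (Real.exp ((lmgf P Y ε u - Λ 0 u) / ε) : ℂ) := by
  have h1 : cmgf P Y ε u = (Real.exp (lmgf P Y ε u / ε) : ℂ) := by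
    rw [cmgf, complexMGF_ofReal, lmgf, mul_div_cancel_left₀ _ hε.ne', exp_cgf hdom]
  rw [tilted, h1, hY.ext_eq u hu, Complex.ofReal_exp, Complex.ofReal_exp, ← Complex.exp_add]
  congr 1
  push_cast
  field_simp
  ring

/-- Dividing the expansion by `ε` and exponentiating: the exponent is `Λ₁ + x` with `x = Λ₂ ε +
O(ε²)`, and `|e^x - 1 - x| ≤ x²`. The order `ε³` in the hypothesis is exactly what leaves `O(ε²)`
here. -/
theorem tilted_expansion [IsProbabilityMeasure P] (hY : SharpLDAssumption P Y Λ L₀) {u : ℝ}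
    (hu : u ∈ interior (limDomain P Y)) :
    (fun ε : ℝ => tilted P Y L₀ ε u -
      ((Real.exp (Λ 1 u) : ℂ) + ε * ((Real.exp (Λ 1 u) * Λ 2 u : ℝ) : ℂ))) =O[𝓝[>] 0] fun ε : ℝ => ε ^ 2 := by
  obtain ⟨ε₀, hε₀, hdom⟩ := hY.exists_domain
  obtain ⟨C, hC0, hC⟩ := (hY.expansion u hu).exists_nonneg
  set D : ℝ := |Λ 2 u| + C with hD
  have hD0 : 0 ≤ D := by positivity
  refine IsBigO.of_bound (Real.exp (Λ 1 u) * (D ^ 2 + C)) ?_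
  have hpos : ∀ m : ℝ, 0 < m → ∀ᶠ ε : ℝ in 𝓝[>] 0, 0 < ε ∧ ε ≤ m := by
    intro m hm
    filter_upwards [self_mem_nhdsWithin, nhdsWithin_le_nhds (gt_mem_nhds hm)] with r h1 h2
    exact ⟨h1, h2.le⟩
  filter_upwards [hC.bound, hpos ε₀ hε₀, hpos 1 one_pos, hpos (1 / (D + 1)) (by positivity)]
    with ε h1 h2 h3 h4
  have hε : 0 < ε := h2.1
  set ρ : ℝ := lmgf P Y ε u - ∑ i : Fin 3, Λ i u * ε ^ (i : ℕ) with hρ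
  have hsum : lmgf P Y ε u = Λ 0 u + Λ 1 u * ε + Λ 2 u * ε ^ 2 + ρ := by
    rw [hρ, Fin.sum_univ_three]; simp
  rw [Real.norm_eq_abs, Real.norm_eq_abs, abs_of_pos (pow_pos hε 3)] at h1
  set x : ℝ := Λ 2 u * ε + ρ / ε with hx
  have hρε : |ρ / ε| ≤ C * ε ^ 2 := by
    rw [abs_div, abs_of_pos hε, div_le_iff₀ hε]
    calc |ρ| ≤ C * ε ^ 3 := h1
      _ = _ := by ring
  have hxle : |x| ≤ D * ε := by
    calc |x| ≤ |Λ 2 u * ε| + |ρ / ε| := abs_add_le _ _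
      _ ≤ |Λ 2 u| * ε + C * ε ^ 2 := by rw [abs_mul, abs_of_pos hε]; gcongr
      _ ≤ |Λ 2 u| * ε + C * ε := by
        gcongr
        nlinarith [h3.2]
      _ = _ := by rw [hD]; ring
  have hx1 : |x| ≤ 1 := by
    refine hxle.trans ?_
    have := h4.2
    rw [le_div_iff₀ (by positivity)] at this
    nlinarith
  have hval : tilted P Y L₀ ε u -
      ((Real.exp (Λ 1 u) : ℂ) + ε * ((Real.exp (Λ 1 u) * Λ 2 u : ℝ) : ℂ)) =
      ((Real.exp (Λ 1 u) * ((Real.exp x - 1 - x) + ρ / ε) : ℝ) : ℂ) := by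
    rw [tilted_ofReal hY hε hu (interior_subset (hdom ε h2 hu))]
    have : (lmgf P Y ε u - Λ 0 u) / ε = Λ 1 u + x := by
      rw [hsum, hx]; field_simp; ring
    rw [this, Real.exp_add, hx]
    push_cast
    ring
  rw [hval, Complex.norm_real, Real.norm_eq_abs, abs_mul, abs_of_pos (Real.exp_pos _), Real.norm_eq_abs,
    abs_of_pos (pow_pos hε 2), mul_assoc]
  gcongr
  have h5 : |Real.exp x - 1 - x| ≤ x ^ 2 := Real.abs_exp_sub_one_sub_id_le hx1
  have h6 : x ^ 2 ≤ (D * ε) ^ 2 := by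
    rw [← sq_abs]; gcongr
  calc |Real.exp x - 1 - x + ρ / ε| ≤ |Real.exp x - 1 - x| + |ρ / ε| := abs_add_le _ _
    _ ≤ (D * ε) ^ 2 + C * ε ^ 2 := add_le_add (h5.trans h6) hρε
    _ = _ := by ring

end

/-! ### The second-order coefficient -/

/-- The coefficient of `1 / τ` in the Laplace expansion with amplitude `G`, quadratic coefficient `v`
and cubic remainder `χ`. -/
noncomputable def laplaceCoeff (v : ℝ) (χ G : ℂ → ℂ) : ℂ :=
  iteratedDeriv 2 G 0 / (2 * v) + 3 * deriv (fun z => G z * χ z) 0 / v ^ 2 +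
    15 / 2 * (G 0 * χ 0 ^ 2) / v ^ 3

/-- The coefficient is linear in the amplitude and Cauchy's estimates bound its derivatives by the
sup norm. Hence an `O(ε)` error in the amplitude moves the coefficient by `O(ε)`. -/
theorem exists_norm_laplaceCoeff_sub_le {ρ X v : ℝ} (hρ : 0 < ρ) (hv : 0 < v) {χ : ℂ → ℂ}
    (hχ : DifferentiableOn ℂ χ (Metric.ball 0 ρ)) (hX : ∀ z ∈ Metric.ball (0 : ℂ) ρ, ‖χ z‖ ≤ X) :
    ∃ C ≥ 0, ∀ (G H : ℂ → ℂ) (δ : ℝ), DifferentiableOn ℂ G (Metric.ball 0 ρ) →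
      DifferentiableOn ℂ H (Metric.ball 0 ρ) → (∀ z ∈ Metric.ball (0 : ℂ) ρ, ‖G z - H z‖ ≤ δ) →
      ‖laplaceCoeff v χ G - laplaceCoeff v χ H‖ ≤ C * δ := by
  have h0 : (0 : ℂ) ∈ Metric.ball (0 : ℂ) ρ := Metric.mem_ball_self hρ
  have hX0 : 0 ≤ X := (norm_nonneg _).trans (hX 0 h0)
  refine ⟨2 / (ρ / 2) ^ 2 / (2 * v) + 3 * (X / (ρ / 2)) / v ^ 2 + 15 / 2 * X ^ 2 / v ^ 3, by positivity,
    fun G H δ hG hH hδ => ?_⟩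
  have hδ0 : 0 ≤ δ := (norm_nonneg _).trans (hδ 0 h0)
  have hGa : AnalyticAt ℂ G 0 := (hG.analyticOnNhd Metric.isOpen_ball) 0 h0
  have hHa : AnalyticAt ℂ H 0 := (hH.analyticOnNhd Metric.isOpen_ball) 0 h0
  have hχa : AnalyticAt ℂ χ 0 := (hχ.analyticOnNhd Metric.isOpen_ball) 0 h0
  have e1 : iteratedDeriv 2 (fun z => G z - H z) 0 = iteratedDeriv 2 G 0 - iteratedDeriv 2 H 0 :=
    iteratedDeriv_fun_sub hGa.contDiffAt hHa.contDiffAt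
  have e2 : deriv (fun z => (G z - H z) * χ z) 0 =
      deriv (fun z => G z * χ z) 0 - deriv (fun z => H z * χ z) 0 := by
    rw [← deriv_fun_sub (hGa.fun_mul hχa).differentiableAt (hHa.fun_mul hχa).differentiableAt]
    congr 1
    funext z
    ring
  have b1 := norm_iteratedDeriv_le_of_ball hρ (hG.sub hH) hδ 2
  have b2 := norm_iteratedDeriv_le_of_ball (K := δ * X) hρ ((hG.sub hH).mul hχ) (fun z hz => by
    simp only [Pi.mul_apply, Pi.sub_apply]
    rw [norm_mul]
    exact mul_le_mul (hδ z hz) (hX z hz) (norm_nonneg _) hδ0) 1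
  have b1' : ‖iteratedDeriv 2 (fun z => G z - H z) 0‖ ≤ 2 * δ / (ρ / 2) ^ 2 := by
    simpa using! b1
  have b2' : ‖deriv (fun z => (G z - H z) * χ z) 0‖ ≤ δ * X / (ρ / 2) := by
    rw [iteratedDeriv_one] at b2
    simpa using! b2
  have hsplit : laplaceCoeff v χ G - laplaceCoeff v χ H =
      iteratedDeriv 2 (fun z => G z - H z) 0 / (2 * v) +
      3 * deriv (fun z => (G z - H z) * χ z) 0 / v ^ 2 + 15 / 2 * ((G 0 - H 0) * χ 0 ^ 2) / v ^ 3 := by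
    rw [e1, e2, laplaceCoeff, laplaceCoeff]; ring
  rw [hsplit]
  refine (norm_add_le _ _).trans ((add_le_add (norm_add_le _ _) le_rfl).trans ?_)
  simp only [norm_div, norm_mul, norm_pow, Complex.norm_real, Real.norm_eq_abs, abs_of_pos hv,
    Complex.norm_ofNat]
  have b3 : ‖G 0 - H 0‖ * ‖χ 0‖ ^ 2 ≤ δ * X ^ 2 :=
    mul_le_mul (hδ 0 h0) (pow_le_pow_left₀ (norm_nonneg _) (hX 0 h0) 2) (by positivity) hδ0
  calc _ ≤ 2 * δ / (ρ / 2) ^ 2 / (2 * v) + 3 * (δ * X / (ρ / 2)) / v ^ 2 +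
        15 / 2 * (δ * X ^ 2) / v ^ 3 := by gcongr
    _ = _ := by ring

theorem deriv_comp_vertical {N : ℂ → ℂ} {c w : ℂ} (hN : DifferentiableAt ℂ N (c + w * Complex.I)) :
    deriv (fun w => N (c + w * Complex.I)) w = deriv N (c + w * Complex.I) * Complex.I := by
  have h1 : HasDerivAt (fun w : ℂ => c + w * Complex.I) Complex.I w := by
    simpa using ((hasDerivAt_id w).mul_const Complex.I).const_add c
  exact (hN.hasDerivAt.comp w h1).deriv

theorem iteratedDeriv_two_comp_vertical {N : ℂ → ℂ} {c : ℂ} (hN : AnalyticAt ℂ N c) :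
    iteratedDeriv 2 (fun w => N (c + w * Complex.I)) 0 = -iteratedDeriv 2 N c := by
  have ht : Tendsto (fun w : ℂ => c + w * Complex.I) (𝓝 0) (𝓝 c) := by
    have : Continuous fun w : ℂ => c + w * Complex.I := by fun_prop
    simpa using this.tendsto 0
  have hev : deriv (fun w => N (c + w * Complex.I)) =ᶠ[𝓝 0]
      fun w => deriv N (c + w * Complex.I) * Complex.I := by
    filter_upwards [ht.eventually hN.eventually_analyticAt] with w hw
    exact deriv_comp_vertical hw.differentiableAt
  rw [iteratedDeriv_succ, iteratedDeriv_one, hev.deriv_eq, deriv_mul_const_field]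
  have hd : DifferentiableAt ℂ (deriv N) (c + 0 * Complex.I) := by
    simpa using hN.deriv.differentiableAt
  rw [deriv_comp_vertical (N := deriv N) hd, iteratedDeriv_succ, iteratedDeriv_one]
  rw [mul_assoc, Complex.I_mul_I]
  simp

theorem deriv_div_kernel {F : ℂ → ℂ} {z : ℂ} (hF : DifferentiableAt ℂ F z) (h0 : z ≠ 0) (h1 : z ≠ 1) :
    deriv (fun z => F z * (1 / (z * (z - 1)))) z =
      deriv F z * (1 / (z * (z - 1))) - F z * (2 * z - 1) * (1 / (z * (z - 1))) ^ 2 := by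
  have h1' : z - 1 ≠ 0 := sub_ne_zero.2 h1
  have hk : HasDerivAt (fun z : ℂ => 1 / (z * (z - 1))) (-(2 * z - 1) * (1 / (z * (z - 1))) ^ 2) z := by
    have h2 : HasDerivAt (fun z : ℂ => z * (z - 1)) (1 * (z - 1) + z * 1) z :=
      (hasDerivAt_id z).mul ((hasDerivAt_id z).sub_const 1)
    have h3 := h2.inv (mul_ne_zero h0 h1')
    simp only [one_div]
    refine h3.congr_deriv ?_
    field_simp
    ring
  rw [(hF.hasDerivAt.fun_mul hk).deriv]
  ring

theorem iteratedDeriv_two_div_kernel {F : ℂ → ℂ} {c : ℂ} (hF : AnalyticAt ℂ F c) (h0 : c ≠ 0) (h1 : c ≠ 1) :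
    iteratedDeriv 2 (fun z => F z * (1 / (z * (z - 1)))) c =
      iteratedDeriv 2 F c * (1 / (c * (c - 1))) -
        2 * (deriv F c * (2 * c - 1) * (1 / (c * (c - 1))) ^ 2) +
        F c * (2 * (2 * c - 1) ^ 2 * (1 / (c * (c - 1))) ^ 3 - 2 * (1 / (c * (c - 1))) ^ 2) := by
  have hev : deriv (fun z => F z * (1 / (z * (z - 1)))) =ᶠ[𝓝 c] fun z =>
      deriv F z * (1 / (z * (z - 1))) -
        (F z * (1 / (z * (z - 1)))) * (2 * z - 1) * (1 / (z * (z - 1))) := by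
    filter_upwards [hF.eventually_analyticAt, isOpen_compl_singleton.mem_nhds h0,
      isOpen_compl_singleton.mem_nhds h1] with z hz hz0 hz1
    rw [deriv_div_kernel hz.differentiableAt hz0 hz1]; ring
  have h1' : c - 1 ≠ 0 := sub_ne_zero.2 h1
  have hka : AnalyticAt ℂ (fun z : ℂ => 1 / (z * (z - 1))) c :=
    analyticAt_const.div (analyticAt_id.mul (analyticAt_id.sub analyticAt_const)) (mul_ne_zero h0 h1')
  have hlin : HasDerivAt (fun z : ℂ => 2 * z - 1) 2 c := by
    simpa using ((hasDerivAt_id c).const_mul (2 : ℂ)).sub_const 1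
  have hk' : deriv (fun z : ℂ => 1 / (z * (z - 1))) c = -(2 * c - 1) * (1 / (c * (c - 1))) ^ 2 := by
    have := deriv_div_kernel (F := fun _ => 1) (differentiableAt_const _) h0 h1
    simp only [deriv_const, zero_mul, one_mul, zero_sub] at this
    rw [this]; ring
  have d1 : deriv (fun z => deriv F z * (1 / (z * (z - 1)))) c =
      iteratedDeriv 2 F c * (1 / (c * (c - 1))) - deriv F c * (2 * c - 1) * (1 / (c * (c - 1))) ^ 2 := by
    rw [deriv_div_kernel hF.deriv.differentiableAt h0 h1, iteratedDeriv_succ, iteratedDeriv_one]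
  have d2 : HasDerivAt (fun z => (F z * (1 / (z * (z - 1)))) * (2 * z - 1) * (1 / (z * (z - 1))))
      (((deriv F c * (1 / (c * (c - 1))) - F c * (2 * c - 1) * (1 / (c * (c - 1))) ^ 2) * (2 * c - 1) +
        F c * (1 / (c * (c - 1))) * 2) * (1 / (c * (c - 1))) +
        F c * (1 / (c * (c - 1))) * (2 * c - 1) * (-(2 * c - 1) * (1 / (c * (c - 1))) ^ 2)) c := by
    have e1 := (hF.mul hka).differentiableAt.hasDerivAt
    have e1' : deriv (fun z => F z * (1 / (z * (z - 1)))) c = _ :=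
      deriv_div_kernel hF.differentiableAt h0 h1
    have e2 := hka.differentiableAt.hasDerivAt
    rw [hk'] at e2
    have e3 : HasDerivAt (fun z => F z * (1 / (z * (z - 1))))
        (deriv F c * (1 / (c * (c - 1))) - F c * (2 * c - 1) * (1 / (c * (c - 1))) ^ 2) c := by
      rw [← e1']; exact e1
    exact (e3.mul hlin).mul e2
  rw [iteratedDeriv_succ, iteratedDeriv_one, hev.deriv_eq,
    deriv_fun_sub (hF.deriv.fun_mul hka).differentiableAt d2.differentiableAt, d1, d2.deriv]
  ring

theorem iteratedDeriv_two_exp_comp {l : ℝ → ℝ} {u : ℝ} (hl : ContDiffAt ℝ 2 l u) :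
    deriv (fun x => Real.exp (l x)) u = Real.exp (l u) * deriv l u ∧
    iteratedDeriv 2 (fun x => Real.exp (l x)) u =
      Real.exp (l u) * (deriv l u ^ 2 + iteratedDeriv 2 l u) := by
  have hev : ∀ᶠ x in 𝓝 u, deriv (fun x => Real.exp (l x)) x = Real.exp (l x) * deriv l x := by
    filter_upwards [hl.eventually (by simp)] with x hx
    exact deriv_exp (hx.differentiableAt (by norm_num))
  refine ⟨hev.self_of_nhds, ?_⟩
  have hd : DifferentiableAt ℝ (deriv l) u := by
    exact (hl.derivWithin (m := 1) (by norm_num)).differentiableAt (by norm_num)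
  have hl1 : DifferentiableAt ℝ l u := hl.differentiableAt (by norm_num)
  rw [iteratedDeriv_succ, iteratedDeriv_one, EventuallyEq.deriv_eq hev, deriv_fun_mul hl1.exp hd,
    deriv_exp hl1, iteratedDeriv_succ, iteratedDeriv_one]
  ring

/-- On the vertical line the cubic term `(iw)³ T` is `w³ (-iT)`. Thus `χ² = -T²`, the second
derivative changes sign, and in the mixed term `i * (-i) = 1`. -/
theorem laplaceCoeff_vertical {N T : ℂ → ℂ} {c : ℂ} (hN : AnalyticAt ℂ N c) (hT : AnalyticAt ℂ T c) (v : ℝ) :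
    laplaceCoeff v (fun w => -Complex.I * T (c + w * Complex.I)) (fun w => N (c + w * Complex.I)) =
      -iteratedDeriv 2 N c / (2 * v) + 3 * (deriv N c * T c + N c * deriv T c) / v ^ 2 -
        15 / 2 * (N c * T c ^ 2) / v ^ 3 := by
  have hd : DifferentiableAt ℂ (fun z => N z * T z) (c + 0 * Complex.I) := by
    rw [zero_mul, add_zero]; exact hN.differentiableAt.mul hT.differentiableAt
  have e1 : (fun w : ℂ => N (c + w * Complex.I) * (-Complex.I * T (c + w * Complex.I))) =
      fun w => -Complex.I * (fun z => N z * T z) (c + w * Complex.I) := by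
    funext w; ring
  have e2 : deriv (fun w : ℂ => N (c + w * Complex.I) * (-Complex.I * T (c + w * Complex.I))) 0 =
      deriv N c * T c + N c * deriv T c := by
    rw [e1, deriv_const_mul_field, deriv_comp_vertical hd, zero_mul, add_zero,
      deriv_fun_mul hN.differentiableAt hT.differentiableAt, mul_comm _ Complex.I, ← mul_assoc, neg_mul,
      Complex.I_mul_I, neg_neg, one_mul]
  rw [laplaceCoeff, iteratedDeriv_two_comp_vertical hN, e2, zero_mul, add_zero, mul_pow, neg_sq,
    Complex.I_sq]
  ring

/-- With limiting amplitude `exp(Λ₁) / (z (z - 1))` the correction is all of `Υ` but `Λ₂`, which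
comes instead from the `ε`-term of `f_ε` at the saddle itself. -/
theorem laplaceCoeff_eq {F L : ℂ → ℂ} {Λ : Fin 3 → ℝ → ℝ} {u ρ : ℝ} (hρ : 0 < ρ)
    (hF : DifferentiableOn ℂ F (Metric.ball (u : ℂ) ρ))
    (hFl : ∀ x : ℝ, |x - u| < ρ → F x = ((Real.exp (Λ 1 x) : ℝ) : ℂ)) (hl : ContDiffAt ℝ 2 (Λ 1) u)
    (hL : DifferentiableOn ℂ L (Metric.ball (u : ℂ) ρ)) (hLg : ∀ x : ℝ, |x - u| < ρ → L x = Λ 0 x)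
    (h0 : u ≠ 0) (h1 : u ≠ 1) (hv : coeffDeriv Λ 0 2 u ≠ 0) :
    laplaceCoeff (coeffDeriv Λ 0 2 u)
      (fun w => -Complex.I * taylorRemainder L u (u + w * Complex.I))
      (fun w => F (u + w * Complex.I) *
        (1 / (((u : ℂ) + w * Complex.I) * ((u : ℂ) + w * Complex.I - 1)))) =
      ((Real.exp (Λ 1 u) / (u * (u - 1)) * (upsilon Λ 1 u - Λ 2 u) : ℝ) : ℂ) := by
  have huu : |u - u| < ρ := by simpa using hρ
  have hnhds : Metric.ball (u : ℂ) ρ ∈ 𝓝 (u : ℂ) := Metric.ball_mem_nhds _ hρ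
  have hself : (u : ℂ) ∈ Metric.ball (u : ℂ) ρ := Metric.mem_ball_self hρ
  have hFa : AnalyticAt ℂ F u := (hF.analyticOnNhd Metric.isOpen_ball) u hself
  have hLa : AnalyticAt ℂ L u := (hL.analyticOnNhd Metric.isOpen_ball) u hself
  have hTa : AnalyticAt ℂ (taylorRemainder L u) u :=
    ((differentiableOn_taylorRemainder hnhds hL).analyticOnNhd Metric.isOpen_ball) u hself
  have h0' : (u : ℂ) ≠ 0 := by exact_mod_cast h0
  have h1' : (u : ℂ) ≠ 1 := by exact_mod_cast h1
  have h1'' : (u : ℂ) - 1 ≠ 0 := sub_ne_zero.2 h1'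
  have hka : AnalyticAt ℂ (fun z : ℂ => 1 / (z * (z - 1))) u :=
    analyticAt_const.div (analyticAt_id.mul (analyticAt_id.sub analyticAt_const)) (mul_ne_zero h0' h1'')
  obtain ⟨x1, x2⟩ := iteratedDeriv_two_exp_comp hl
  have f0 : F u = ((Real.exp (Λ 1 u) : ℝ) : ℂ) := hFl u huu
  have f1 : deriv F u = ((Real.exp (Λ 1 u) * deriv (Λ 1) u : ℝ) : ℂ) := by
    have := iteratedDeriv_eq_ofReal hF hFl 1 u huu
    rwa [iteratedDeriv_one, iteratedDeriv_one, x1] at this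
  have f2 : iteratedDeriv 2 F u =
      ((Real.exp (Λ 1 u) * (deriv (Λ 1) u ^ 2 + iteratedDeriv 2 (Λ 1) u) : ℝ) : ℂ) := by
    have := iteratedDeriv_eq_ofReal hF hFl 2 u huu
    rwa [x2] at this
  have t0 : taylorRemainder L u u = ((iteratedDeriv 3 (Λ 0) u / 6 : ℝ) : ℂ) := by
    rw [taylorRemainder_self hLa, iteratedDeriv_eq_ofReal hL hLg 3 u huu]; push_cast; ring
  have t1 : deriv (taylorRemainder L u) u = ((iteratedDeriv 4 (Λ 0) u / 24 : ℝ) : ℂ) := by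
    rw [deriv_taylorRemainder hLa, iteratedDeriv_eq_ofReal hL hLg 4 u huu]; push_cast; ring
  refine (laplaceCoeff_vertical (N := fun z => F z * (1 / (z * (z - 1)))) (T := taylorRemainder L u)
    (hFa.fun_mul hka) hTa _).trans ?_
  rw [deriv_div_kernel hFa.differentiableAt h0' h1', iteratedDeriv_two_div_kernel hFa h0' h1',
    f0, f1, f2, t0, t1]
  have h1r : u - 1 ≠ 0 := sub_ne_zero.2 h1
  simp only [upsilon, coeffDeriv, iteratedDeriv_one] at hv ⊢
  generalize iteratedDeriv 2 (Λ 0) u = v at hv ⊢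
  generalize iteratedDeriv 3 (Λ 0) u = a3
  generalize iteratedDeriv 4 (Λ 0) u = a4
  generalize iteratedDeriv 2 (Λ 1) u = l2
  generalize deriv (Λ 1) u = l1
  generalize Real.exp (Λ 1 u) = E
  have hv' : (v : ℂ) ≠ 0 := by exact_mod_cast hv
  push_cast
  field_simp
  ring

/-! ### Expansion of the inversion integral at the saddlepoint -/

theorem norm_kernel_le {u : ℝ} {z : ℂ} (h0 : u ≠ 0) (h1 : u ≠ 1) (hz0 : ‖z - u‖ ≤ |u| / 2)
    (hz1 : ‖z - u‖ ≤ |u - 1| / 2) :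
    z ≠ 0 ∧ z ≠ 1 ∧ ‖1 / (z * (z - 1))‖ ≤ 4 / (|u| * |u - 1|) := by
  have hu0 : 0 < |u| := abs_pos.2 h0
  have hu1 : 0 < |u - 1| := abs_pos.2 (sub_ne_zero.2 h1)
  have a0 : |u| / 2 ≤ ‖z‖ := by
    have : ‖(u : ℂ)‖ ≤ ‖z‖ + ‖z - u‖ := by
      calc ‖(u : ℂ)‖ = ‖z - (z - u)‖ := by rw [sub_sub_cancel]
        _ ≤ _ := norm_sub_le _ _
    rw [Complex.norm_real, Real.norm_eq_abs] at this
    linarith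
  have a1 : |u - 1| / 2 ≤ ‖z - 1‖ := by
    have : ‖((u - 1 : ℝ) : ℂ)‖ ≤ ‖z - 1‖ + ‖z - u‖ := by
      calc ‖((u - 1 : ℝ) : ℂ)‖ = ‖(z - 1) - (z - u)‖ := by congr 1; push_cast; ring
        _ ≤ _ := norm_sub_le _ _
    rw [Complex.norm_real, Real.norm_eq_abs] at this
    linarith
  refine ⟨norm_pos_iff.1 (by linarith), sub_ne_zero.1 (norm_pos_iff.1 (by linarith)), ?_⟩
  rw [norm_div, norm_one, norm_mul]
  calc 1 / (‖z‖ * ‖z - 1‖) ≤ 1 / ((|u| / 2) * (|u - 1| / 2)) := by gcongr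
    _ = _ := by field_simp; norm_num

theorem vertical_mem_ball {u ρ : ℝ} {w : ℂ} (hw : w ∈ Metric.ball (0 : ℂ) ρ) :
    (u : ℂ) + w * Complex.I ∈ Metric.ball (u : ℂ) ρ := by
  simpa [Metric.mem_ball, Complex.dist_eq] using hw

theorem exists_near_saddle_bound {f : ℝ → ℂ → ℂ} {F L : ℂ → ℂ} {Λ : Fin 3 → ℝ → ℝ} {u k ρ δ K C : ℝ}
    (hρ : 0 < ρ) (hδ : 0 < δ)
    (hf : ∀ ε ∈ Ioc 0 δ, DifferentiableOn ℂ (f ε) (Metric.ball (u : ℂ) ρ))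
    (hK : ∀ ε ∈ Ioc 0 δ, ∀ z ∈ Metric.ball (u : ℂ) ρ, ‖f ε z‖ ≤ K)
    (hF : DifferentiableOn ℂ F (Metric.ball (u : ℂ) ρ))
    (hfF : ∀ ε ∈ Ioc 0 δ, ∀ z ∈ Metric.ball (u : ℂ) ρ, ‖f ε z - F z‖ ≤ C * ε)
    (hFl : ∀ x : ℝ, |x - u| < ρ → F x = ((Real.exp (Λ 1 x) : ℝ) : ℂ)) (hl : ContDiffAt ℝ 2 (Λ 1) u)
    (hexp : ∀ ε ∈ Ioc 0 δ, ‖f ε u - ((Real.exp (Λ 1 u) : ℂ) + ε * ((Real.exp (Λ 1 u) * Λ 2 u : ℝ) : ℂ))‖ ≤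
      C * ε ^ 2)
    (hL : DifferentiableOn ℂ L (Metric.ball (u : ℂ) ρ)) (hLg : ∀ x : ℝ, |x - u| < ρ → L x = Λ 0 x)
    (hk : coeffDeriv Λ 0 1 u = k) (h0 : u ≠ 0) (h1 : u ≠ 1) (hv : 0 < coeffDeriv Λ 0 2 u) :
    ∃ h > 0, ∃ B, ∀ τ : ℝ, δ⁻¹ ≤ τ →
      ‖(∫ q : ℝ in Icc (-h) h, f τ⁻¹ ((u : ℂ) + q * Complex.I) *
          Complex.exp (τ * (L ((u : ℂ) + q * Complex.I) - L u - k * (q * Complex.I))) *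
          (1 / (((u : ℂ) + q * Complex.I) * ((u : ℂ) + q * Complex.I - 1)))) -
        ((√(2 * Real.pi / (coeffDeriv Λ 0 2 u * τ)) *
          (Real.exp (Λ 1 u) / (u * (u - 1)) * (1 + upsilon Λ 1 u / τ)) : ℝ) : ℂ)‖ ≤ B / √τ ^ 5 := by
  set v := coeffDeriv Λ 0 2 u with hvdef
  have hu0 : 0 < |u| := abs_pos.2 h0
  have hu1 : 0 < |u - 1| := abs_pos.2 (sub_ne_zero.2 h1)
  -- A disc on which the poles `0` and `1` of the kernel stay at a distance.
  obtain ⟨σ, hσ, hσρ, hσ0, hσ1⟩ : ∃ σ > 0, σ < ρ ∧ σ ≤ |u| / 2 ∧ σ ≤ |u - 1| / 2 :=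
    ⟨min (ρ / 2) (min (|u| / 2) (|u - 1| / 2)), by positivity,
      (min_le_left _ _).trans_lt (by linarith), (min_le_right _ _).trans (min_le_left _ _),
      (min_le_right _ _).trans (min_le_right _ _)⟩
  have hnhds : Metric.ball (u : ℂ) ρ ∈ 𝓝 (u : ℂ) := Metric.ball_mem_nhds _ hρ
  have hself : (u : ℂ) ∈ Metric.ball (u : ℂ) ρ := Metric.mem_ball_self hρ
  have hσs : Metric.ball (u : ℂ) σ ⊆ Metric.ball (u : ℂ) ρ := Metric.ball_subset_ball hσρ.le
  have hLa : AnalyticAt ℂ L u := (hL.analyticOnNhd Metric.isOpen_ball) u hself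
  have hT := differentiableOn_taylorRemainder hnhds hL
  have hpol : MapsTo (fun w : ℂ => (u : ℂ) + w * Complex.I) (Metric.ball 0 σ) (Metric.ball (u : ℂ) σ) :=
    fun w hw => vertical_mem_ball hw
  have hpolρ : MapsTo (fun w : ℂ => (u : ℂ) + w * Complex.I) (Metric.ball 0 σ) (Metric.ball (u : ℂ) ρ) :=
    fun w hw => hσs (hpol hw)
  have hpold : DifferentiableOn ℂ (fun w : ℂ => (u : ℂ) + w * Complex.I) (Metric.ball 0 σ) := by fun_prop
  set χ : ℂ → ℂ := fun w => -Complex.I * taylorRemainder L u (u + w * Complex.I) with hχdef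
  have hχ : DifferentiableOn ℂ χ (Metric.ball 0 σ) := (hT.comp hpold hpolρ).const_mul _
  obtain ⟨X, hX⟩ := (isCompact_closedBall (u : ℂ) σ).exists_bound_of_continuousOn
    (hT.continuousOn.mono (Metric.closedBall_subset_ball hσρ))
  have hχX : ∀ w ∈ Metric.ball (0 : ℂ) σ, ‖χ w‖ ≤ X := fun w hw => by
    rw [hχdef]
    simp only [norm_mul, norm_neg, Complex.norm_I, one_mul]
    exact hX _ (Metric.ball_subset_closedBall (hpol hw))
  have hker : ∀ w ∈ Metric.ball (0 : ℂ) σ, (u : ℂ) + w * Complex.I ≠ 0 ∧ (u : ℂ) + w * Complex.I ≠ 1 ∧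
      ‖1 / (((u : ℂ) + w * Complex.I) * ((u : ℂ) + w * Complex.I - 1))‖ ≤ 4 / (|u| * |u - 1|) :=
    fun w hw => by
      have := mem_ball_iff_norm.1 (hpol hw)
      exact norm_kernel_le h0 h1 (by linarith) (by linarith)
  have hkerd : DifferentiableOn ℂ
      (fun w : ℂ => 1 / (((u : ℂ) + w * Complex.I) * ((u : ℂ) + w * Complex.I - 1)))
      (Metric.ball 0 σ) :=
    (differentiableOn_const _).div (hpold.mul (hpold.sub_const _)) fun w hw =>
      mul_ne_zero (hker w hw).1 (sub_ne_zero.2 (hker w hw).2.1)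
  set A : ℝ := 4 / (|u| * |u - 1|) with hA
  have hA0 : 0 < A := by positivity
  have hK0 : 0 ≤ K := (norm_nonneg _).trans (hK δ ⟨hδ, le_rfl⟩ u hself)
  obtain ⟨h, hh, -, C₁, hC₁, hlap⟩ := exists_laplace_bound (K := K * A) hσ hv (by positivity) hχ hχX
  obtain ⟨C₂, hC₂, hcoef⟩ := exists_norm_laplaceCoeff_sub_le hσ hv hχ hχX
  have hC : 0 ≤ C := by
    have := (norm_nonneg _).trans (hfF δ ⟨hδ, le_rfl⟩ u hself)
    exact nonneg_of_mul_nonneg_left this hδ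
  set p : ℝ := u * (u - 1) with hp
  have hp0 : p ≠ 0 := mul_ne_zero h0 (sub_ne_zero.2 h1)
  refine ⟨h, hh, C₁ + √(2 * Real.pi / v) * (C / |p| + C₂ * (C * A)), fun τ hτ => ?_⟩
  have hτ0 : 0 < τ := (inv_pos.2 hδ).trans_le hτ
  have hε : τ⁻¹ ∈ Ioc 0 δ := ⟨inv_pos.2 hτ0, inv_le_of_inv_le₀ hδ hτ⟩
  set G : ℂ → ℂ := fun w => f τ⁻¹ (u + w * Complex.I) *
    (1 / (((u : ℂ) + w * Complex.I) * ((u : ℂ) + w * Complex.I - 1))) with hG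
  set H : ℂ → ℂ := fun w => F (u + w * Complex.I) *
    (1 / (((u : ℂ) + w * Complex.I) * ((u : ℂ) + w * Complex.I - 1))) with hH
  have hGd : DifferentiableOn ℂ G (Metric.ball 0 σ) := ((hf _ hε).comp hpold hpolρ).mul hkerd
  have hHd : DifferentiableOn ℂ H (Metric.ball 0 σ) := (hF.comp hpold hpolρ).mul hkerd
  have hGK : ∀ w ∈ Metric.ball (0 : ℂ) σ, ‖G w‖ ≤ K * A := fun w hw => by
    simp only [hG]
    rw [norm_mul]
    exact mul_le_mul (hK _ hε _ (hpolρ hw)) (hker w hw).2.2 (norm_nonneg _) hK0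
  have hGH : ∀ w ∈ Metric.ball (0 : ℂ) σ, ‖G w - H w‖ ≤ C * τ⁻¹ * A := fun w hw => by
    simp only [hG, hH, ← sub_mul]
    rw [norm_mul _ (1 / _)]
    exact mul_le_mul (hfF _ hε _ (hpolρ hw)) (hker w hw).2.2 (norm_nonneg _)
      (mul_nonneg hC hε.1.le)
  have hlap' := hlap G hGd hGK τ hτ0
  have hcoef' := hcoef G H _ hGd hHd hGH
  have hHeq : laplaceCoeff v χ H = ((Real.exp (Λ 1 u) / p * (upsilon Λ 1 u - Λ 2 u) : ℝ) : ℂ) :=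
    laplaceCoeff_eq hρ hF hFl hl hL hLg h0 h1 hv.ne'
  change ‖_ - _ * (G 0 + 1 / τ * laplaceCoeff v χ G)‖ ≤ _ at hlap'
  have hd1 : deriv L u = k := by
    have := iteratedDeriv_eq_ofReal hL hLg 1 u (by simpa using hρ)
    rw [iteratedDeriv_one] at this
    rw [this, ← hk, coeffDeriv]
  have hd2 : iteratedDeriv 2 L u = v := iteratedDeriv_eq_ofReal hL hLg 2 u (by simpa using hρ)
  have hint : (∫ q : ℝ in Icc (-h) h, f τ⁻¹ ((u : ℂ) + q * Complex.I) *
          Complex.exp (τ * (L ((u : ℂ) + q * Complex.I) - L u - k * (q * Complex.I))) *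
          (1 / (((u : ℂ) + q * Complex.I) * ((u : ℂ) + q * Complex.I - 1)))) =
      ∫ q : ℝ in Icc (-h) h, G q * Complex.exp (τ * (-(v / 2) * q ^ 2 + q ^ 3 * χ q)) := by
    congr 1
    funext q
    have hphase : L ((u : ℂ) + q * Complex.I) - L u - k * (q * Complex.I) =
        -(v / 2) * q ^ 2 + q ^ 3 * χ q := by
      rw [eq_taylor_add_remainder hLa, hd1, hd2, hχdef]
      simp only [add_sub_cancel_left, mul_pow, Complex.I_sq, Complex.I_pow_three]
      ring
    rw [hphase, hG]
    ring
  rw [hint]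
  have hsqrt : √(2 * Real.pi / (v * τ)) = √(2 * Real.pi / v) / √τ := by
    rw [← div_div, Real.sqrt_div (by positivity)]
  have hG0 : G 0 = f τ⁻¹ u / p := by
    simp only [hG, zero_mul, add_zero, hp]
    push_cast
    ring
  -- Two precisions meet: `G 0` uses the `O(ε²)` expansion at the real point `u`, while the
  -- coefficient, already multiplied by `1 / τ`, needs `f_ε` only up to `O(ε)`.
  have hbr : ‖(G 0 + 1 / τ * laplaceCoeff v χ G) -
      ((Real.exp (Λ 1 u) / p * (1 + upsilon Λ 1 u / τ) : ℝ) : ℂ)‖ ≤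
      (C / |p| + C₂ * (C * A)) / τ ^ 2 := by
    have e : (G 0 + 1 / τ * laplaceCoeff v χ G) -
        ((Real.exp (Λ 1 u) / p * (1 + upsilon Λ 1 u / τ) : ℝ) : ℂ) =
        (f τ⁻¹ u - ((Real.exp (Λ 1 u) : ℂ) + (τ⁻¹ : ℝ) * ((Real.exp (Λ 1 u) * Λ 2 u : ℝ) : ℂ))) / p +
        1 / τ * (laplaceCoeff v χ G - laplaceCoeff v χ H) := by
      rw [hG0, hHeq]
      have : (p : ℂ) ≠ 0 := by exact_mod_cast hp0
      have : (τ : ℂ) ≠ 0 := by exact_mod_cast hτ0.ne'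
      push_cast
      field_simp
      ring
    rw [e]
    refine (norm_add_le _ _).trans ?_
    rw [norm_div, norm_mul, norm_div, norm_one, Complex.norm_real, Complex.norm_real, Real.norm_eq_abs,
      Real.norm_eq_abs, abs_of_pos hτ0]
    calc _ ≤ C * τ⁻¹ ^ 2 / |p| + 1 / τ * (C₂ * (C * τ⁻¹ * A)) := by
          gcongr
          exact hexp _ hε
      _ = _ := by field_simp
  have hsq : τ ^ 2 = √τ ^ 4 := by
    rw [show √τ ^ 4 = (√τ ^ 2) ^ 2 by ring, Real.sq_sqrt hτ0.le]
  have hsτ : 0 < √τ := Real.sqrt_pos.2 hτ0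
  set I₁ := ∫ q : ℝ in Icc (-h) h, G q * Complex.exp (τ * (-(v / 2) * q ^ 2 + q ^ 3 * χ q))
  have e2 : I₁ - ((√(2 * Real.pi / (v * τ)) * (Real.exp (Λ 1 u) / p * (1 + upsilon Λ 1 u / τ)) : ℝ) : ℂ) =
      (I₁ - √(2 * Real.pi / (v * τ)) * (G 0 + 1 / τ * laplaceCoeff v χ G)) +
      √(2 * Real.pi / (v * τ)) * ((G 0 + 1 / τ * laplaceCoeff v χ G) -
      ((Real.exp (Λ 1 u) / p * (1 + upsilon Λ 1 u / τ) : ℝ) : ℂ)) := by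
    rw [Complex.ofReal_mul]
    ring
  rw [e2]
  refine (norm_add_le _ _).trans ?_
  rw [norm_mul, Complex.norm_real, Real.norm_of_nonneg (Real.sqrt_nonneg _)]
  calc _ ≤ C₁ / √τ ^ 5 + √(2 * Real.pi / v) / √τ * ((C / |p| + C₂ * (C * A)) / √τ ^ 4) := by
        rw [← hsqrt, ← hsq]
        gcongr
    _ = _ := by field_simp

/-! ### The inversion integral over a vertical line -/

section

variable {Ω : Type*} [MeasurableSpace Ω] {P : Measure Ω} {Y : ℝ → Ω → ℝ} {Λ : Fin 3 → ℝ → ℝ} {L₀ : ℂ → ℂ}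

theorem exp_neg_mul_le {η τ : ℝ} (hη : 0 < η) (hτ : 1 ≤ τ) :
    Real.exp (-(η * τ)) ≤ 6 / η ^ 3 / √τ ^ 5 := by
  have hτ0 : 0 < τ := by linarith
  have h1 : (η * τ) ^ 3 / 6 ≤ Real.exp (η * τ) := by
    simpa [Nat.factorial] using Real.pow_div_factorial_le_exp (η * τ) (by positivity) 3
  have hs : 1 ≤ √τ := Real.one_le_sqrt.2 hτ
  have h2 : √τ ^ 5 ≤ τ ^ 3 := by
    calc √τ ^ 5 ≤ √τ ^ 6 := pow_le_pow_right₀ hs (by norm_num)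
      _ = (√τ ^ 2) ^ 3 := by ring
      _ = τ ^ 3 := by rw [Real.sq_sqrt hτ0.le]
  rw [Real.exp_neg, div_div, inv_le_comm₀ (Real.exp_pos _) (by positivity)]
  refine le_trans ?_ h1
  rw [inv_div, mul_pow]
  gcongr

theorem SharpLDAssumption.re_ext_add_mul_I (hY : SharpLDAssumption P Y Λ L₀) {u : ℝ}
    (hu : u ∈ interior (limDomain P Y)) (hu0 : u ≠ 0) :
    (∀ q : ℝ, q ≠ 0 → (L₀ ((u : ℂ) + q * Complex.I)).re < Λ 0 u) ∧
    ∃ δ > 0, ∃ R : ℝ, ∀ q : ℝ, R ≤ |q| → (L₀ ((u : ℂ) + q * Complex.I)).re ≤ Λ 0 u - δ := by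
  have h := hY.tail_max u hu hu0
  have h1 : (L₀ ⟨u, 0⟩).re = Λ 0 u := by
    rw [show (⟨u, 0⟩ : ℂ) = (u : ℂ) from rfl, hY.ext_eq u hu, Complex.ofReal_re]
  rw [h1] at h
  simpa only [Complex.mk_eq_add_mul_I] using h

/-- Compactness turns the strict inequality into a uniform gap for `h ≤ |q| ≤ R`; beyond `R` the
tail assumption supplies it. -/
theorem SharpLDAssumption.exists_vertical_gap (hY : SharpLDAssumption P Y Λ L₀) {u h : ℝ}
    (hu : u ∈ interior (limDomain P Y)) (hu0 : u ≠ 0) (hh : 0 < h) :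
    ∃ η > 0, ∀ q : ℝ, h ≤ |q| → (L₀ ((u : ℂ) + q * Complex.I)).re ≤ Λ 0 u - η := by
  obtain ⟨hlt, δ, hδ, R, hfar⟩ := hY.re_ext_add_mul_I hu hu0
  have hcont : Continuous fun q : ℝ => (L₀ ((u : ℂ) + q * Complex.I)).re := by
    refine Complex.continuous_re.comp (hY.ext_analytic.continuousOn.comp_continuous (by fun_prop) ?_)
    intro q
    simpa using hu
  set S : Set ℝ := Icc (-R) R ∩ {q | h ≤ |q|} with hS
  have hSc : IsCompact S := isCompact_Icc.inter_right (isClosed_le continuous_const continuous_abs)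
  have hmemS : ∀ q, h ≤ |q| → |q| ≤ R → q ∈ S := fun q h1 h2 => ⟨abs_le.1 h2, h1⟩
  rcases S.eq_empty_or_nonempty with he | hne
  · refine ⟨δ, hδ, fun q hq => hfar q ?_⟩
    by_contra hlt'
    have := hmemS q hq (not_le.1 hlt').le
    rw [he] at this
    exact this
  · obtain ⟨q₀, hq₀, hmax⟩ := hSc.exists_isMaxOn hne hcont.continuousOn
    have hq₀0 : q₀ ≠ 0 := by
      rintro rfl
      have : h ≤ |(0 : ℝ)| := hq₀.2
      rw [abs_zero] at this
      linarith
    refine ⟨min δ (Λ 0 u - (L₀ ((u : ℂ) + q₀ * Complex.I)).re), lt_min hδ (sub_pos.2 (hlt q₀ hq₀0)),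
      fun q hq => ?_⟩
    rcases le_total R |q| with h1 | h1
    · linarith [hfar q h1, min_le_left δ (Λ 0 u - (L₀ ((u : ℂ) + q₀ * Complex.I)).re)]
    · have h2 : (L₀ ((u : ℂ) + q * Complex.I)).re ≤ (L₀ ((u : ℂ) + q₀ * Complex.I)).re :=
        hmax (hmemS q hq h1)
      linarith [min_le_right δ (Λ 0 u - (L₀ ((u : ℂ) + q₀ * Complex.I)).re)]

theorem SharpLDAssumption.exists_inversion_expansion [IsProbabilityMeasure P]
    (hY : SharpLDAssumption P Y Λ L₀) {u k : ℝ} (hu : u ∈ interior (limDomain P Y)) (h0 : u ≠ 0)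
    (h1 : u ≠ 1) (hk : coeffDeriv Λ 0 1 u = k) :
    ContDiffAt ℝ 4 (Λ 0) u ∧ ContDiffAt ℝ 2 (Λ 1) u ∧ 0 < coeffDeriv Λ 0 2 u ∧
    ∃ T > 0, ∃ B, ∀ τ : ℝ, T ≤ τ → interior (limDomain P Y) ⊆ interior (effDomain P Y τ⁻¹) ∧
      ‖(∫ q : ℝ, tilted P Y L₀ τ⁻¹ ((u : ℂ) + q * Complex.I) *
          Complex.exp (τ * (L₀ ((u : ℂ) + q * Complex.I) - L₀ u - k * (q * Complex.I))) *
          (1 / (((u : ℂ) + q * Complex.I) * ((u : ℂ) + q * Complex.I - 1)))) -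
        ((√(2 * Real.pi / (coeffDeriv Λ 0 2 u * τ)) *
          (Real.exp (Λ 1 u) / (u * (u - 1)) * (1 + upsilon Λ 1 u / τ)) : ℝ) : ℂ)‖ ≤ B / √τ ^ 5 := by
  obtain ⟨R, hR, ε₁, hε₁, K, hgood, hst⟩ := hY.exists_norm_tilted_le_strip hu h0
  have hball : ∀ z ∈ Metric.ball (u : ℂ) R, |z.re - u| ≤ R := fun z hz => by
    have h2 := Complex.abs_re_le_norm (z - u)
    rw [Complex.sub_re, Complex.ofReal_re] at h2
    exact h2.trans (mem_ball_iff_norm.1 hz).le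
  have hLball : DifferentiableOn ℂ L₀ (Metric.ball (u : ℂ) R) :=
    hY.ext_analytic.mono fun z hz => (hgood _ (hball z hz)).1
  have hLeq : ∀ x : ℝ, |x - u| < R → L₀ x = Λ 0 x := fun x hx => hY.ext_eq x (hgood x hx.le).1
  have hv : 0 < coeffDeriv Λ 0 2 u := by
    refine second_deriv_pos_of_vertical_max hR hLball hLeq (fun z hz => ?_) fun q hq _ =>
      (hY.re_ext_add_mul_I hu h0).1 q hq
    exact hY.re_ext_le (hgood _ (hball z hz)).1 (hgood _ (hball z hz)).2
  have hfd : ∀ ε ∈ Ioc 0 ε₁, DifferentiableOn ℂ (tilted P Y L₀ ε) {z | z.re ∈ interior (limDomain P Y)} :=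
    fun ε hε => differentiableOn_tilted hY.ext_analytic fun z hz => (hst ε hε).1 hz
  obtain ⟨s, ⟨hs, hsR⟩, F, hF, hFl, C₁, hC₁, δ₁, ⟨hδ₁, hδε⟩, hfF⟩ :=
    exists_holomorphic_limit (f := tilted P Y L₀) (K := K)
      (a := fun x => ((Real.exp (Λ 1 x) : ℝ) : ℂ))
      (b := fun x => ((Real.exp (Λ 1 x) * Λ 2 x : ℝ) : ℂ)) hR hε₁
      (fun ε hε => (hfd ε hε).mono fun z hz => (hgood _ (hball z hz)).1)
      (fun ε hε z hz => (hst ε hε).2 z (hball z hz)) fun x hx => by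
        simpa only [Complex.ofReal_exp] using tilted_expansion hY (hgood x hx.le).1
  -- `Λ₁` is the logarithm of the restriction of the holomorphic limit `F` to the real axis.
  have hl : ContDiffAt ℝ 2 (Λ 1) u := by
    have := (contDiffAt_of_eq_ofReal (g := fun x => Real.exp (Λ 1 x)) hs hF hFl 2).log
      (Real.exp_ne_zero _)
    simpa only [Real.log_exp] using this
  refine ⟨contDiffAt_of_eq_ofReal hR hLball hLeq 4, hl, hv, ?_⟩
  obtain ⟨C₂, hC₂⟩ := (tilted_expansion hY hu).bound
  obtain ⟨δ₂, hδ₂, hexp⟩ := mem_nhdsGT_iff_exists_Ioc_subset.1 hC₂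
  set δ := min δ₁ δ₂ with hδdef
  have hδ : 0 < δ := lt_min hδ₁ hδ₂
  have hδle : ∀ ε ∈ Ioc 0 δ, ε ∈ Ioc 0 δ₁ ∧ ε ∈ Ioc 0 δ₂ ∧ ε ∈ Ioc 0 ε₁ := fun ε hε =>
    ⟨⟨hε.1, hε.2.trans (min_le_left _ _)⟩, ⟨hε.1, hε.2.trans (min_le_right _ _)⟩,
      ⟨hε.1, (hε.2.trans (min_le_left _ _)).trans hδε⟩⟩
  have hss : Metric.ball (u : ℂ) s ⊆ Metric.ball (u : ℂ) R := Metric.ball_subset_ball hsR.le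
  obtain ⟨h, hh, B₁, hnear⟩ := exists_near_saddle_bound (f := tilted P Y L₀) (Λ := Λ) (L := L₀) (k := k)
    (C := max C₁ C₂) (K := K) hs hδ
    (fun ε hε => (hfd ε (hδle ε hε).2.2).mono fun z hz => (hgood _ (hball z (hss hz))).1)
    (fun ε hε z hz => (hst ε (hδle ε hε).2.2).2 z (hball z (hss hz))) hF
    (fun ε hε z hz => (hfF ε (hδle ε hε).1 z hz).trans
      (mul_le_mul_of_nonneg_right (le_max_left _ _) hε.1.le)) hFl hl
    (fun ε hε => by
      have := hexp (hδle ε hε).2.1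
      rw [mem_ofPred_eq, Real.norm_of_nonneg (pow_nonneg hε.1.le 2)] at this
      exact this.trans (mul_le_mul_of_nonneg_right (le_max_right _ _) (by positivity)))
    (hLball.mono hss) (fun x hx => hLeq x (hx.trans hsR)) hk h0 h1 hv
  obtain ⟨η, hη, hgap⟩ := hY.exists_vertical_gap hu h0 hh
  set ker : ℝ → ℂ := fun q => 1 / (((u : ℂ) + q * Complex.I) * ((u : ℂ) + q * Complex.I - 1)) with hker
  have hkint : Integrable ker := integrable_kernel h0 h1
  have hK0 : 0 ≤ K := (norm_nonneg _).trans ((hst ε₁ ⟨hε₁, le_rfl⟩).2 u (by simpa using hR.le))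
  refine ⟨max δ⁻¹ 1, by positivity, B₁ + K * (6 / η ^ 3) * ∫ q, ‖ker q‖, fun τ hτ => ?_⟩
  have hτδ : δ⁻¹ ≤ τ := (le_max_left _ _).trans hτ
  have hτ1 : 1 ≤ τ := (le_max_right _ _).trans hτ
  have hτ0 : 0 < τ := by linarith
  have hε : τ⁻¹ ∈ Ioc 0 ε₁ := (hδle _ ⟨inv_pos.2 hτ0, inv_le_of_inv_le₀ hδ hτδ⟩).2.2
  refine ⟨(hst _ hε).1, ?_⟩
  set E : ℝ → ℂ := fun q => tilted P Y L₀ τ⁻¹ ((u : ℂ) + q * Complex.I) *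
    Complex.exp (τ * (L₀ ((u : ℂ) + q * Complex.I) - L₀ u - k * (q * Complex.I))) with hE
  have hline : ∀ q : ℝ, ((u : ℂ) + q * Complex.I).re = u := fun q => by simp
  have hre : ∀ q : ℝ, (τ * (L₀ ((u : ℂ) + q * Complex.I) - L₀ u - k * (q * Complex.I))).re =
      τ * ((L₀ ((u : ℂ) + q * Complex.I)).re - Λ 0 u) := fun q => by
    rw [Complex.re_ofReal_mul, hY.ext_eq u hu]
    simp
  have hEn : ∀ q : ℝ, ‖E q‖ ≤ K * Real.exp (τ * ((L₀ ((u : ℂ) + q * Complex.I)).re - Λ 0 u)) :=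
    fun q => by
      rw [hE]
      simp only [norm_mul, Complex.norm_exp, hre]
      exact mul_le_mul_of_nonneg_right ((hst _ hε).2 _ (by rw [hline]; simpa using hR.le))
        (Real.exp_nonneg _)
  have hEK : ∀ q : ℝ, ‖E q‖ ≤ K := fun q => by
    refine (hEn q).trans (mul_le_of_le_one_right hK0 (Real.exp_le_one_iff.2 ?_))
    have := hY.re_ext_le (z := (u : ℂ) + q * Complex.I) (by rwa [hline]) (by rwa [hline])
    rw [hline] at this
    exact mul_nonpos_of_nonneg_of_nonpos hτ0.le (by linarith)
  have hlc : Continuous fun q : ℝ => (u : ℂ) + q * Complex.I := by fun_prop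
  have hLc : Continuous fun q : ℝ => L₀ ((u : ℂ) + q * Complex.I) :=
    hY.ext_analytic.continuousOn.comp_continuous hlc fun q => by
      rw [mem_ofPred_eq, hline]; exact hu
  have hfc : Continuous fun q : ℝ => tilted P Y L₀ τ⁻¹ ((u : ℂ) + q * Complex.I) :=
    (hfd _ hε).continuousOn.comp_continuous hlc fun q => by
      rw [mem_ofPred_eq, hline]; exact hu
  have hEc : Continuous E :=
    hfc.mul (continuous_const.mul ((hLc.sub continuous_const).sub (by fun_prop))).cexp
  have hEint : Integrable fun q => E q * ker q :=
    hkint.bdd_mul hEc.aestronglyMeasurable (Eventually.of_forall hEK)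
  -- Off the saddle the integrand is at most `K exp(-ητ)` times the integrable kernel; the
  -- exponential is weakened to `τ^{-5/2}` to match the near part.
  have hfar : ‖∫ q in (Icc (-h) h)ᶜ, E q * ker q‖ ≤ K * (6 / η ^ 3 / √τ ^ 5) * ∫ q, ‖ker q‖ := by
    have hb : ∀ q ∈ (Icc (-h) h)ᶜ, ‖E q * ker q‖ ≤ K * (6 / η ^ 3 / √τ ^ 5) * ‖ker q‖ := fun q hq => by
      have hq' : h ≤ |q| := by
        by_contra hc
        exact hq (abs_le.1 (not_le.1 hc).le)
      rw [norm_mul]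
      refine mul_le_mul_of_nonneg_right ((hEn q).trans (mul_le_mul_of_nonneg_left ?_ hK0))
        (norm_nonneg _)
      refine (Real.exp_le_exp.2 ?_).trans (exp_neg_mul_le hη hτ1)
      have := mul_le_mul_of_nonneg_left (sub_nonpos.2 (hgap q hq')) hτ0.le
      linarith
    have hki := hkint.norm.const_mul (K * (6 / η ^ 3 / √τ ^ 5))
    refine (norm_integral_le_of_norm_le hki.integrableOn
      ((ae_restrict_iff' measurableSet_Icc.compl).2 (Eventually.of_forall hb))).trans ?_
    rw [← integral_const_mul]
    exact setIntegral_le_integral hki (Eventually.of_forall fun q => by positivity)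
  have hnear' := hnear τ hτδ
  rw [← integral_add_compl measurableSet_Icc hEint, add_sub_right_comm]
  refine (norm_add_le _ _).trans ((add_le_add hnear' hfar).trans (le_of_eq ?_))
  ring

end

/-! ### Expansion of the payoffs -/

theorem SharpLDAssumption.exists_kinkPayoff_expansion {Ω : Type*} [MeasurableSpace Ω] {P : Measure Ω} [IsProbabilityMeasure P]
    {Y : ℝ → Ω → ℝ} {Λ : Fin 3 → ℝ → ℝ} {L₀ : ℂ → ℂ}
    (hY : SharpLDAssumption P Y Λ L₀) {u k a b : ℝ} (hu : u ∈ interior (limDomain P Y)) (h0 : u ≠ 0)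
    (h1 : u ≠ 1) (hk : coeffDeriv Λ 0 1 u = k) (hm : ∀ ε > 0, AEMeasurable (fun ω => Y ε ω / ε) P)
    (hab : KinkDomain a b u) :
    ∃ T > 0, ∃ B, ∃ r : ℝ → ℝ, ∀ τ : ℝ, T ≤ τ → interior (limDomain P Y) ⊆ effDomain P Y τ⁻¹ ∧
      |r τ| ≤ B * (1 / τ ^ 2) ∧
      Real.exp (k * τ) * ∫ ω, kinkPayoff a b (Y τ⁻¹ ω / τ⁻¹ - k * τ) ∂P =
        Real.exp (-τ * (u * k - Λ 0 u - k) + Λ 1 u) * τ ^ (-(1 / 2) : ℝ) /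
          (u * (u - 1) * √(2 * Real.pi * coeffDeriv Λ 0 2 u)) * (1 + upsilon Λ 1 u / τ + r τ) := by
  obtain ⟨-, -, hv, T, hT, B, hB⟩ := hY.exists_inversion_expansion hu h0 h1 hk
  set v := coeffDeriv Λ 0 2 u
  set p : ℝ := u * (u - 1) with hp
  have hp0 : p ≠ 0 := mul_ne_zero h0 (sub_ne_zero.2 h1)
  set W : ℝ → ℝ := fun τ => Real.exp (u * (k * τ) - τ * Λ 0 u) *
    (2 * Real.pi * ∫ ω, kinkPayoff a b (Y τ⁻¹ ω / τ⁻¹ - k * τ) ∂P) with hW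
  set A : ℝ → ℝ := fun τ => √(2 * Real.pi / (v * τ)) * (Real.exp (Λ 1 u) / p) with hA
  set a₀ : ℝ := √(2 * Real.pi / v) * (Real.exp (Λ 1 u) / |p|) with ha₀
  have ha₀0 : 0 < a₀ := by positivity
  -- The remainder is defined by solving the identity for it, so the equality is exact and the
  -- analysis enters only in its bound: an absolute error `τ^{-5/2}` against a leading term of size
  -- `τ^{-1/2}`.
  refine ⟨T, hT, B / a₀, fun τ => W τ / A τ - 1 - upsilon Λ 1 u / τ, fun τ hτ => ?_⟩
  have hτ0 : 0 < τ := hT.trans_le hτ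
  have hsτ : 0 < √τ := Real.sqrt_pos.2 hτ0
  obtain ⟨hdom, hJ⟩ := hB τ hτ
  have hdom' := hdom.trans interior_subset
  have hsv : 0 < √v := Real.sqrt_pos.2 hv
  have hA0 : A τ ≠ 0 := by
    have : 0 < √(2 * Real.pi / (v * τ)) := by positivity
    exact mul_ne_zero this.ne' (div_ne_zero (Real.exp_ne_zero _) hp0)
  have hAabs : |A τ| = a₀ / √τ := by
    rw [hA, ha₀]
    simp only
    rw [abs_mul, abs_div, Real.abs_exp, abs_of_nonneg (Real.sqrt_nonneg _), ← div_div,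
      Real.sqrt_div (by positivity)]
    ring
  refine ⟨hdom', ?_, ?_⟩
  · have hinv := integral_kinkPayoff_eq (hm τ⁻¹ (inv_pos.2 hτ0)) hab h0 h1 (hdom' hu) (k * τ)
    have hWJ : (W τ : ℂ) = ∫ q : ℝ, tilted P Y L₀ τ⁻¹ ((u : ℂ) + q * Complex.I) *
          Complex.exp (τ * (L₀ ((u : ℂ) + q * Complex.I) - L₀ u - k * (q * Complex.I))) *
          (1 / (((u : ℂ) + q * Complex.I) * ((u : ℂ) + q * Complex.I - 1))) := by
      rw [hW]
      simp only
      rw [Complex.ofReal_mul, hinv, ← integral_const_mul]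
      congr 1
      funext q
      rw [tilted, cmgf, inv_inv, hY.ext_eq u hu, ← mul_assoc, ← mul_assoc, Complex.ofReal_exp]
      congr 1
      rw [mul_assoc, mul_assoc, ← Complex.exp_add, mul_left_comm, ← Complex.exp_add]
      congr 2
      push_cast
      ring
    rw [← hWJ, ← Complex.ofReal_sub, Complex.norm_real, Real.norm_eq_abs] at hJ
    have e : W τ / A τ - 1 - upsilon Λ 1 u / τ =
        (W τ - √(2 * Real.pi / (v * τ)) * (Real.exp (Λ 1 u) / p * (1 + upsilon Λ 1 u / τ))) / A τ := by
      rw [eq_div_iff hA0, sub_mul, sub_mul, div_mul_cancel₀ _ hA0, hA]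
      ring
    simp only
    rw [e, abs_div, hAabs, div_le_iff₀ (by positivity)]
    refine hJ.trans (le_of_eq ?_)
    have hsq : τ ^ 2 = √τ ^ 4 := by
      rw [show √τ ^ 4 = (√τ ^ 2) ^ 2 by ring, Real.sq_sqrt hτ0.le]
    rw [hsq]
    field_simp
  · have hsum : 1 + upsilon Λ 1 u / τ + (W τ / A τ - 1 - upsilon Λ 1 u / τ) = W τ / A τ := by ring
    simp only
    rw [hsum, hW, hA]
    simp only
    generalize ∫ ω, kinkPayoff a b (Y τ⁻¹ ω / τ⁻¹ - k * τ) ∂P = V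
    have hpow : τ ^ (-(1 / 2) : ℝ) = 1 / √τ := by
      rw [Real.rpow_neg hτ0.le, Real.sqrt_eq_rpow, one_div (τ ^ _)]
    have hexp : Real.exp (-τ * (u * k - Λ 0 u - k) + Λ 1 u) * Real.exp (u * (k * τ) - τ * Λ 0 u) =
        Real.exp (k * τ) * Real.exp (Λ 1 u) := by
      rw [← Real.exp_add, ← Real.exp_add]
      congr 1
      ring
    have h2π : √(2 * Real.pi) ^ 2 = 2 * Real.pi := Real.sq_sqrt (by positivity)
    have hs2 : 0 < √(2 * Real.pi) := by positivity
    rw [hpow, Real.sqrt_mul (by positivity : (0 : ℝ) ≤ 2 * Real.pi) v, Real.sqrt_div (by positivity),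
      Real.sqrt_mul hv.le]
    generalize Real.exp (-τ * (u * k - Λ 0 u - k) + Λ 1 u) = x1 at hexp ⊢
    generalize hx2 : Real.exp (u * (k * τ) - τ * Λ 0 u) = x2 at hexp ⊢
    have hx2 : x2 ≠ 0 := hx2 ▸ Real.exp_ne_zero _
    have hx3 := Real.exp_ne_zero (Λ 1 u)
    generalize Real.exp (Λ 1 u) = x3 at hexp hx3 ⊢
    generalize Real.exp (k * τ) = x4 at hexp ⊢
    generalize √(2 * Real.pi) = s at h2π hs2 ⊢
    rw [← h2π]
    field_simp
    linear_combination (-V) * hexp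

/-! ### Call, put and covered call as kink payoffs -/

theorem exp_mul_kinkPayoff_zero_zero (z κ : ℝ) :
    Real.exp κ * kinkPayoff 0 0 (z - κ) = max (Real.exp z - Real.exp κ) 0 := by
  have h : Real.exp κ * Real.exp (z - κ) = Real.exp z := by rw [← Real.exp_add]; ring_nf
  rw [kinkPayoff]
  split_ifs with hz
  · rw [max_eq_right (sub_nonpos.2 (Real.exp_le_exp.2 (by linarith)))]; ring
  · rw [max_eq_left (sub_nonneg.2 (Real.exp_le_exp.2 (by linarith)))]; linear_combination h

theorem exp_mul_kinkPayoff_neg_one_one (z κ : ℝ) :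
    Real.exp κ * kinkPayoff (-1) 1 (z - κ) = max (Real.exp κ - Real.exp z) 0 := by
  have h : Real.exp κ * Real.exp (z - κ) = Real.exp z := by rw [← Real.exp_add]; ring_nf
  rw [kinkPayoff]
  split_ifs with hz
  · rw [max_eq_left (sub_nonneg.2 (Real.exp_le_exp.2 (by linarith)))]; linear_combination -h
  · rw [max_eq_right (sub_nonpos.2 (Real.exp_le_exp.2 (by linarith)))]; ring

theorem exp_mul_kinkPayoff_neg_one_zero (z κ : ℝ) :
    Real.exp κ * kinkPayoff (-1) 0 (z - κ) = -min (Real.exp z) (Real.exp κ) := by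
  have h : Real.exp κ * Real.exp (z - κ) = Real.exp z := by rw [← Real.exp_add]; ring_nf
  rw [kinkPayoff]
  split_ifs with hz
  · rw [min_eq_left (Real.exp_le_exp.2 (by linarith))]; linear_combination -h
  · rw [min_eq_right (Real.exp_le_exp.2 (by linarith))]; ring

theorem largeMat_div {Ω : Type*} (X : ℝ → Ω → ℝ) (t : ℝ) {ε : ℝ} (hε : ε ≠ 0) (ω : Ω) :
    largeMat X t ε ω / ε = fwd X t ε⁻¹ ω := by
  rw [largeMat, mul_div_cancel_left₀ _ hε]

end ForwardStart

/-! ### The large-maturity expansion -/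

theorem corollary2p9 {Ω : Type*} [MeasurableSpace Ω] (P : Measure Ω) [IsProbabilityMeasure P]
    (X : ℝ → Ω → ℝ) (hX : ∀ s, 0 ≤ s → AEMeasurable (X s) P) (t : ℝ) (ht : 0 ≤ t)
    (Λ : Fin 3 → ℝ → ℝ) (L₀ : ℂ → ℂ)
    (hY : ForwardStart.SharpLDAssumption P (ForwardStart.largeMat X t) Λ L₀)
    (U : Set ℝ) (hU : U = interior (ForwardStart.limDomain P (ForwardStart.largeMat X t)))
    (h1 : (1 : ℝ) ∈ U)
    (k : ℝ) (hk : k ∈ ForwardStart.coeffDeriv Λ 0 1 '' U)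
    (hk0 : k ≠ ForwardStart.coeffDeriv Λ 0 1 0) (hk1 : k ≠ ForwardStart.coeffDeriv Λ 0 1 1) :
    -- the saddlepoint is unique, and the coefficients of the expansion are well defined
    (∃! u, u ∈ U ∧ ForwardStart.coeffDeriv Λ 0 1 u = k) ∧
    ContDiffAt ℝ 4 (Λ 0) (ForwardStart.saddle U Λ k) ∧
    ContDiffAt ℝ 2 (Λ 1) (ForwardStart.saddle U Λ k) ∧
    0 < ForwardStart.coeffDeriv Λ 0 2 (ForwardStart.saddle U Λ k) ∧
    -- the expansion, with remainder `r`
    ∃ r : ℝ → ℝ, r =O[atTop] (fun τ : ℝ => 1 / τ ^ 2) ∧ ∀ᶠ τ : ℝ in atTop,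
      (ForwardStart.coeffDeriv Λ 0 1 1 < k →
        Integrable (fun ω => max (Real.exp (ForwardStart.fwd X t τ ω) - Real.exp (k * τ)) 0) P ∧
        ∫ ω, max (Real.exp (ForwardStart.fwd X t τ ω) - Real.exp (k * τ)) 0 ∂P =
          ForwardStart.prefactor U Λ k τ *
            (1 + ForwardStart.upsilon Λ 1 (ForwardStart.saddle U Λ k) / τ + r τ)) ∧
      (k < ForwardStart.coeffDeriv Λ 0 1 0 →
        Integrable (fun ω => max (Real.exp (k * τ) - Real.exp (ForwardStart.fwd X t τ ω)) 0) P ∧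
        ∫ ω, max (Real.exp (k * τ) - Real.exp (ForwardStart.fwd X t τ ω)) 0 ∂P =
          ForwardStart.prefactor U Λ k τ *
            (1 + ForwardStart.upsilon Λ 1 (ForwardStart.saddle U Λ k) / τ + r τ)) ∧
      (ForwardStart.coeffDeriv Λ 0 1 0 < k → k < ForwardStart.coeffDeriv Λ 0 1 1 →
        Integrable (fun ω => min (Real.exp (ForwardStart.fwd X t τ ω)) (Real.exp (k * τ))) P ∧
        -∫ ω, min (Real.exp (ForwardStart.fwd X t τ ω)) (Real.exp (k * τ)) ∂P =
          ForwardStart.prefactor U Λ k τ *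
            (1 + ForwardStart.upsilon Λ 1 (ForwardStart.saddle U Λ k) / τ + r τ)) := by
  subst hU
  set U := interior (ForwardStart.limDomain P (ForwardStart.largeMat X t))
  have hd : ForwardStart.coeffDeriv Λ 0 1 = deriv (Λ 0) := by
    funext x
    rw [ForwardStart.coeffDeriv, iteratedDeriv_one]
  have hdiff : ∀ x ∈ U, DifferentiableAt ℝ (Λ 0) x := fun x hx =>
    hY.essSmooth.differentiableOn.differentiableAt (isOpen_interior.mem_nhds hx)
  have hmono : StrictMonoOn (ForwardStart.coeffDeriv Λ 0 1) U := by
    rw [hd]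
    exact hY.strictConvex.strictMonoOn_deriv hdiff
  have huU : ForwardStart.saddle U Λ k ∈ U := Function.invFunOn_mem hk
  have huk : ForwardStart.coeffDeriv Λ 0 1 (ForwardStart.saddle U Λ k) = k := Function.invFunOn_eq hk
  have hleg : ForwardStart.legendre U Λ k =
      ForwardStart.saddle U Λ k * k - Λ 0 (ForwardStart.saddle U Λ k) := by
    refine (ForwardStart.isGreatest_legendre hY.strictConvex.convexOn huU ?_).csSup_eq
    have := (hdiff _ huU).hasDerivAt
    rwa [← hd, huk] at this
  unfold ForwardStart.prefactor
  simp only [hleg]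
  generalize ForwardStart.saddle U Λ k = u at huU huk
  have hu0 : u ≠ 0 := by
    rintro rfl
    exact hk0 huk.symm
  have hu1 : u ≠ 1 := by
    rintro rfl
    exact hk1 huk.symm
  have hk1iff : ForwardStart.coeffDeriv Λ 0 1 1 < k ↔ 1 < u := by
    rw [← huk]; exact hmono.lt_iff_lt h1 huU
  have hk1iff' : k < ForwardStart.coeffDeriv Λ 0 1 1 ↔ u < 1 := by
    rw [← huk]; exact hmono.lt_iff_lt huU h1
  have hk0iff : k < ForwardStart.coeffDeriv Λ 0 1 0 ↔ u < 0 := by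
    rw [← huk]; exact hmono.lt_iff_lt huU hY.zero_mem
  have hk0iff' : ForwardStart.coeffDeriv Λ 0 1 0 < k ↔ 0 < u := by
    rw [← huk]; exact hmono.lt_iff_lt hY.zero_mem huU
  rw [hk1iff, hk1iff', hk0iff, hk0iff']
  obtain ⟨c0, c1, hv, -⟩ := hY.exists_inversion_expansion huU hu0 hu1 huk
  refine ⟨⟨u, ⟨huU, huk⟩, fun w hw => hmono.injOn hw.1 huU (hw.2.trans huk.symm)⟩, c0, c1, hv, ?_⟩
  have hm : ∀ ε > 0, AEMeasurable (fun ω => ForwardStart.largeMat X t ε ω / ε) P := fun ε hε => by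
    simp only [ForwardStart.largeMat_div X t hε.ne']
    exact (hX _ (by positivity)).sub (hX t ht)
  have hZ : ∀ τ : ℝ, 0 < τ →
      (fun ω => ForwardStart.largeMat X t τ⁻¹ ω / τ⁻¹) = ForwardStart.fwd X t τ := fun τ hτ => by
    funext ω
    rw [ForwardStart.largeMat_div X t (inv_ne_zero hτ.ne'), inv_inv]
  -- This is where `1 ∈ U` yields integrability: `exp(X)` is the exponential moment at abscissa `1`.
  have hexp : ∀ τ : ℝ, 0 < τ → U ⊆ ForwardStart.effDomain P (ForwardStart.largeMat X t) τ⁻¹ →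
      Integrable (fun ω => Real.exp (ForwardStart.fwd X t τ ω)) P := fun τ hτ hdom => by
    have := hdom h1
    rw [ForwardStart.effDomain, hZ τ hτ] at this
    simpa [integrableExpSet] using this
  have hmain : ∀ a b : ℝ, ForwardStart.KinkDomain a b u →
      ∃ r : ℝ → ℝ, r =O[atTop] (fun τ : ℝ => 1 / τ ^ 2) ∧ ∀ᶠ τ : ℝ in atTop,
        Integrable (fun ω => Real.exp (ForwardStart.fwd X t τ ω)) P ∧
        ∫ ω, Real.exp (k * τ) * ForwardStart.kinkPayoff a b (ForwardStart.fwd X t τ ω - k * τ) ∂P =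
        Real.exp (-τ * (u * k - Λ 0 u - k) + Λ 1 u) * τ ^ (-(1 / 2) : ℝ) /
          (u * (u - 1) * √(2 * Real.pi * ForwardStart.coeffDeriv Λ 0 2 u)) *
          (1 + ForwardStart.upsilon Λ 1 u / τ + r τ) := by
    intro a b hab
    obtain ⟨T, hT, B, r, hr⟩ := hY.exists_kinkPayoff_expansion huU hu0 hu1 huk hm hab
    refine ⟨r, IsBigO.of_bound B ?_, ?_⟩
    · filter_upwards [eventually_ge_atTop T] with τ hτ
      rw [Real.norm_eq_abs, Real.norm_of_nonneg (by positivity)]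
      exact (hr τ hτ).2.1
    · filter_upwards [eventually_ge_atTop T] with τ hτ
      have hτ0 : 0 < τ := hT.trans_le hτ
      obtain ⟨hdom, -, hval⟩ := hr τ hτ
      refine ⟨hexp τ hτ0 hdom, ?_⟩
      rw [integral_const_mul, ← hval]
      simp only [ForwardStart.largeMat_div X t (inv_ne_zero hτ0.ne'), inv_inv]
  -- The saddle lies in exactly one of the three intervals cut out by the poles. The remainder is
  -- taken for that payoff, and the other two implications are vacuous.
  rcases lt_or_gt_of_ne hu0 with hlt0 | hgt0
  · obtain ⟨r, hr, hval⟩ := hmain (-1) 1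
      ⟨.inr (by linarith), .inr hlt0, .inl (by norm_num), .inl (by norm_num)⟩
    refine ⟨r, hr, hval.mono fun τ hτ => ⟨fun h => by linarith, fun _ => ⟨?_, ?_⟩,
      fun h => by linarith⟩⟩
    · exact ((integrable_const _).sub hτ.1).sup (integrable_const 0)
    · simpa only [ForwardStart.exp_mul_kinkPayoff_neg_one_one] using hτ.2
  · rcases lt_or_gt_of_ne hu1 with hlt1 | hgt1
    · obtain ⟨r, hr, hval⟩ := hmain (-1) 0
        ⟨.inr hlt1, .inl rfl, .inl (by norm_num), .inr hgt0⟩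
      refine ⟨r, hr, hval.mono fun τ hτ => ⟨fun h => by linarith, fun h => by linarith,
        fun _ _ => ⟨?_, ?_⟩⟩⟩
      · exact hτ.1.inf (integrable_const _)
      · simpa only [ForwardStart.exp_mul_kinkPayoff_neg_one_zero, integral_neg] using hτ.2
    · obtain ⟨r, hr, hval⟩ := hmain 0 0 ⟨.inl rfl, .inl rfl, .inr hgt1, .inr hgt0⟩
      refine ⟨r, hr, hval.mono fun τ hτ => ⟨fun _ => ⟨?_, ?_⟩, fun h => by linarith,
        fun _ h => by linarith⟩⟩
      · exact (hτ.1.sub (integrable_const _)).sup (integrable_const 0)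
      · simpa only [ForwardStart.exp_mul_kinkPayoff_zero_zero] using hτ.2
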